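/- Let $d\ge1$ and let $\hat v:\mathbb Z^d\to\mathbb R$, $\hat v\not\equiv0$, satisfy $|\hat v(x)|\le Ce^{-a|x|}$ for some $C,a>0$. Put $\mathbb T^d=(\mathbb R/2\pi\mathbb Z)^d$ (with Lebesgue measure $dq$ of total mass $(2\pi)^d$), $$v(p)=(2\pi)^{-d/2}\sum_{x\in\mathbb Z^d}\hat v(x)e^{ix\cdot p},\qquad \mathfrak e(p)=\Big(\sum_{i=1}^d(1-\cos p_i)\Big)^2,\qquad \mu_o=\Big(\int_{\mathbb T^d}\frac{|v|^2}{\mathfrak e}\,dq\Big)^{-1}$$ (with $\mu_o=0$ if the integral is $+\infty$). For $\mu\in\mathbb R$ let $$(\mathbf h_\mu f)(p)=\mathfrak e(p)f(p)-\mu\, v(p)\int_{\mathbb T^d}\overline{v(q)}f(q)\,dq ,$$ a bounded operator in $L^2(\mathbb T^d)$ (the momentum representation of the discrete bilaplacian on $\ell^2(\mathbb Z^d)$ minus $\mu\,\hat v\langle \hat v,\cdot\rangle$); the same formula defines $\mathbf h_\mu f$ a.e. for functions $f$ with $\overline vf\in L^1(\mathbb T^d)$. Let $n_o\ge0$ be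 such that $D^{2j}|v|^2(0)=0$ for $0\le j<n_o$ and $D^{2n_o}|v|^2(0)\neq0$, where $D^j$ is the $j$-th order differential (a symmetric $j$-linear form). Then $$c_v:=\frac{2^{2n_o+d}}{(2n_o)!}\int_{\mathbb S^{d-1}}D^{2n_o}|v|^2(0)[w,\dots,w]\,d\mathcal H^{d-1}(w)>0,\qquad \hat c_v:=\int_{\mathbb T^d}\frac{|v|^2}{\mathfrak e^2}\,dq\in(0,+\infty].$$ If $2n_o+d\ge5$, then $f=v/\mathfrak e$ is a non-zero solution of $\mathbf h_{\mu_o}f=0$ (with $\overline vf$ integrable); $f\notin L^2(\mathbb T^d)$ if $2n_o+d\in\{5,6,7,8\}$, and $f\in L^2(\mathbb T^d)$ if $2n_o+d\ge9$. Moreover $\mu_o=0$ if $2n_o+d\le4$ and $\mu_o>0$ if $2n_o+d\ge5$. For every $\mu>\mu_o$ the operator $\mathbf h_\mu$ has exactly one negative eigenvalue $e(\mu)$. Write $s=\mu-\mu_o$. There are real coefficients (depending only on $d$ and $\hat v$) such that, for all sufficiently small $s>0$, the following expansions hold, with absolutely convergent series. (a) For $d$ odd, $(-e(\mu))^{1/4}$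 equals - $c_1\mu^{1/3}+\sum_{n\ge1}c_{1,n}\mu^{(n+1)/3}$ if $2n_o+d=1$, with $c_1=(\pi c_v/4)^{1/3}$; - $c_3\mu+\sum_{n\ge1}c_{3,n}\mu^{n+1}$ if $2n_o+d=3$, with $c_3=\pi c_v/8$; - $c_5s+\sum_{n\ge1}c_{5,n}s^{n+1}$ if $2n_o+d=5$, with $c_5=\frac{16}{\pi c_v\mu_o^2}$; - $c_7s^{1/3}+\sum_{n\ge1}c_{7,n}s^{(n+1)/3}$ if $2n_o+d=7$, with $c_7=\big(\frac{32}{\pi c_v\mu_o^2}\big)^{1/3}$; - $c_9s^{1/4}+\sum_{n\ge1}c_{9,n}s^{(n+1)/4}$ if $2n_o+d\ge9$, with $c_9=(\mu_o^2\hat c_v)^{-1/4}$. (b) For $d$ even, put $\tau=s^{1/2}$, $\theta=-\tau^2\ln\tau$, $\sigma=(-1/\ln\tau)^{1/2}$, $\eta=-\frac{\ln\ln\tau^{-1}}{\ln\tau}$. Then $(-e(\mu))^{1/2}$ equals (all indices being $\ge0$) - $c_2\mu+\sum_{n+m\ge1}c_{2,nm}\mu^{n+1}(-\mu\ln\mu)^m$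 if $2n_o+d=2$, with $c_2=\pi c_v/8$; - $ce^{-1/(c_4\mu)}+\sum_{n+m\ge1}c_{4,nm}\mu^{n+1}\big(\tfrac1\mu e^{-1/(c_4\mu)}\big)^{m+1}$ if $2n_o+d=4$, with some $c>0$ and $c_4=c_v/8$; - $c_6\tau^2+\sum_{n+m\ge1}c_{6,nm}\tau^{2n+2}\theta^m$ if $2n_o+d=6$, with $c_6=\frac{32}{\pi c_v\mu_o^2}$; - $c_8\tau\sigma+\sum_{n+m+k\ge1}c_{8,nmk}\tau^{n+1}\sigma^{m+1}\eta^k$ if $2n_o+d=8$, with $c_8=\big(\frac{32}{c_v\mu_o^2}\big)^{1/2}$; - $c_{10}\tau+\sum_{n+m\ge1}c_{10,nm}\tau^{n+1}\theta^m$ if $2n_o+d\ge10$, with $c_{10}=(\mu_o^2\hat c_v)^{-1/2}$. -/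

import Mathlib

open Real Set Filter Topology MeasureTheory

noncomputable section

namespace LatticeBilaplacian

/-- Momentum space `ℝ^d`; functions on the torus are treated as functions on `ℝ^d`
restricted to the fundamental cube. -/
abbrev Mom (d : ℕ) : Type := EuclideanSpace ℝ (Fin d)

/-- The fundamental cube `(-π, π]^d` of the torus `𝕋^d = (ℝ / 2πℤ)^d`. -/
def cube (d : ℕ) : Set (Mom d) := {p | ∀ i, p i ∈ Ioc (-π) π}

/-- The measure `dq` of the torus (total mass `(2π)^d`). -/
def torusMeasure (d : ℕ) : Measure (Mom d) := volume.restrict (cube d)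

/-- The dispersion relation `𝔢(p) = (∑ᵢ (1 - cos pᵢ))²`, symbol of the discrete bilaplacian. -/
def disp {d : ℕ} (p : Mom d) : ℝ := (∑ i, (1 - Real.cos (p i))) ^ 2

/-- Exponential decay `|v̂(x)| ≤ C e^{-a|x|}` for some `C, a > 0`. -/
def ExpDecay {d : ℕ} (vhat : (Fin d → ℤ) → ℝ) : Prop :=
  ∃ C a : ℝ, 0 < C ∧ 0 < a ∧
    ∀ x, |vhat x| ≤ C * Real.exp (-a * Real.sqrt (∑ i, (x i : ℝ) ^ 2))

/-- The Fourier image `v(p) = (2π)^{-d/2} ∑ₓ v̂(x) e^{i x·p}`. -/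
def v {d : ℕ} (vhat : (Fin d → ℤ) → ℝ) (p : Mom d) : ℂ :=
  (((2 * π) ^ (-(d : ℝ) / 2) : ℝ) : ℂ) *
    ∑' x : Fin d → ℤ,
      (vhat x : ℂ) * Complex.exp (Complex.I * ((∑ i, (x i : ℝ) * p i : ℝ) : ℂ))

/-- The function `|v|²`. -/
def vSq {d : ℕ} (vhat : (Fin d → ℤ) → ℝ) (p : Mom d) : ℝ := ‖v vhat p‖ ^ 2

/-- The action of `h_μ` in momentum space:
`(h_μ f)(p) = 𝔢(p) f(p) - μ v(p) ∫ conj(v(q)) f(q) dq`. -/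
def hAct {d : ℕ} (vhat : (Fin d → ℤ) → ℝ) (μ : ℝ) (f : Mom d → ℂ) (p : Mom d) : ℂ :=
  (disp p : ℂ) * f p -
    (μ : ℂ) * (v vhat p * ∫ q, (starRingEnd ℂ) (v vhat q) * f q ∂(torusMeasure d))

/-- `z` is an eigenvalue of `h_μ` in `L²(𝕋^d)`. -/
def IsEigenvalue {d : ℕ} (vhat : (Fin d → ℤ) → ℝ) (μ : ℝ) (z : ℂ) : Prop :=
  ∃ f : Mom d → ℂ, MemLp f 2 (torusMeasure d) ∧ ¬ (f =ᵐ[torusMeasure d] 0) ∧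
    hAct vhat μ f =ᵐ[torusMeasure d] fun p => z * f p

/-- The coupling constant threshold `μ_o = (∫ |v|² / 𝔢)⁻¹`, which is `0` when the integral
is `+∞`. -/
def muO {d : ℕ} (vhat : (Fin d → ℤ) → ℝ) : ℝ :=
  ((∫⁻ q, ENNReal.ofReal (vSq vhat q / disp q) ∂(torusMeasure d))⁻¹).toReal

/-- `c_v = 2^{2n+d} / (2n)! ∫_{S^{d-1}} D^{2n}|v(0)|²[w,…,w] dH^{d-1}(w)`. -/
def cV {d : ℕ} (vhat : (Fin d → ℤ) → ℝ) (n : ℕ) : ℝ :=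
  2 ^ (2 * n + d) / ((2 * n).factorial : ℝ) *
    ∫ w : Metric.sphere (0 : Mom d) 1,
      iteratedFDeriv ℝ (2 * n) (vSq vhat) 0 (fun _ => (w : Mom d))
        ∂((volume : Measure (Mom d)).toSphere)

/-- `ĉ_v = ∫ |v|² / 𝔢²`, an element of `[0, +∞]`. -/
def cHat {d : ℕ} (vhat : (Fin d → ℤ) → ℝ) : ENNReal :=
  ∫⁻ q, ENNReal.ofReal (vSq vhat q / disp q ^ 2) ∂(torusMeasure d)

/-- The function `f = v / 𝔢`. -/
def zeroState {d : ℕ} (vhat : (Fin d → ℤ) → ℝ) (p : Mom d) : ℂ :=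
  v vhat p / (disp p : ℂ)

/-- `τ = s^{1/2}`, where `s = μ - μ_o`. -/
def tau (s : ℝ) : ℝ := s ^ (1 / 2 : ℝ)

/-- `θ = -τ² ln τ`. -/
def theta (s : ℝ) : ℝ := -(tau s ^ 2 * Real.log (tau s))

/-- `σ = (-1 / ln τ)^{1/2}`. -/
def sigma (s : ℝ) : ℝ := (-1 / Real.log (tau s)) ^ (1 / 2 : ℝ)

/-- `η = -(ln ln τ⁻¹) / ln τ`. -/
def eta (s : ℝ) : ℝ := -(Real.log (Real.log (tau s)⁻¹) / Real.log (tau s))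

end LatticeBilaplacian

end

open LatticeBilaplacian

noncomputable section

/-! The perturbation of `𝔢` has rank one, so the negative spectrum is governed by the scalar
function B(t) = ∫ |v|² / (𝔢 + t), called `resolventForm`. For t > 0, -t is an eigenvalue of h_μ
exactly when μ B(t) = 1 (`isEigenvalue_neg_iff`). B is continuous and strictly decreasing on (0, ∞),
tends to 0 at infinity and, by monotone convergence, to ∫ |v|² / 𝔢 = 1/μ_o at 0⁺ (possibly +∞).
Hence there is one root for each μ > μ_o. When B(0⁺) is finite, (B(0⁺) - B(t)) / t increases to ĉ_v
= ‖v/𝔢‖² as t decreases to 0, so square integrability of v/𝔢 is also read off from B near 0.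

What remains is the precise form of B at 0⁺. Away from the origin 𝔢 is bounded below and the
integral is analytic in t. Near the origin the substitution y_i = √2 sin(p_i / 2) turns 𝔢 into |y|⁴
exactly. Exponential decay of v̂ makes |v|² analytic at 0, and reality of v̂ makes it even, so its
weighted spherical means are power series in r whose exponents are N - 1 + 2j with N = 2n₀ + d. The
integrals of r^k / (r⁴ + t) satisfy a recursion of step 4 in k; the terms with j even and those with
j odd therefore sum up separately, which gives B = A + φ S_N + ψ S_{N+2}, with A, φ, ψ analytic at
0, S_n explicit, and φ(0) = c_v / √2^N (`exists_radial_decomposition`,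
`exists_resolventForm_structure`, `HasSingularExpansion`). For odd N every term is a Laurent
monomial in κ = t^{1/4} times an analytic function; for even N the variable is x = t^{1/2}, and a
factor log x appears. The value of N decides whether S_N diverges (N ≤ 4), is finite but dominates
the linear term of A (5 ≤ N ≤ 8), or is dominated by it (N ≥ 9).

Finally μ B(t) = 1 is inverted. Writing the unknown as its leading behaviour times a factor w, and
treating each logarithmic or exponential quantity as an additional independent small variable, turns
the equation into an analytic one with nonzero w-derivative. The analytic implicit function theorem
then gives a convergent multivariate power series for w, hence for the eigenvalue
(`exists_solution_odd`, `exists_solution_even`, `exists_solution_four`, `exists_solution_eight`). -/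

/-! ### Convergent power series and the analytic implicit function theorem -/

/-- Each p_n(y, …, y) is expanded multilinearly over words in the standard basis, and words with
equal letter counts give the same monomial. Since the sum of ∏ |y_{x i}| over words of length n is
(∑ |y_j|)^n, absolute convergence holds once the ℓ¹ norm of y is below the radius; this licenses the
regrouping. -/
theorem AnalyticAt.exists_hasSum_monomials {ι : Type*} [Fintype ι] [DecidableEq ι]
    {f : (ι → ℝ) → ℝ} (hf : AnalyticAt ℝ f 0) :
    ∃ c : (ι → ℕ) → ℝ, ∀ᶠ y in 𝓝 (0 : ι → ℝ),
      HasSum (fun k => c k * ∏ j, y j ^ k j) (f y) := by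
  obtain ⟨p, r, hp⟩ := hf
  let a : (Σ n : ℕ, (Fin n → ι)) → ℝ := fun x => p x.1 (fun i => Pi.single (x.2 i) (1 : ℝ))
  let cnt : (Σ n : ℕ, (Fin n → ι)) → (ι → ℕ) := fun x j => (Finset.univ.filter (fun i => x.2 i = j)).card
  have hcnt : ∀ (y : ι → ℝ) x, ∏ i, y (x.2 i) = ∏ j, y j ^ cnt x j := by
    intro y x
    have := Finset.prod_fiberwise (s := (Finset.univ : Finset (Fin x.1))) (fun i => x.2 i) (fun i => y (x.2 i))
    rw [← this]
    refine Finset.prod_congr rfl fun j _ => ?_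
    rw [Finset.prod_congr rfl (g := fun _ => y j), Finset.prod_const]
    intro i hi
    rw [(Finset.mem_filter.1 hi).2]
  have hna : ∀ x, ‖a x‖ ≤ ‖p x.1‖ := by
    intro x
    refine ((p x.1).le_opNorm _).trans ?_
    have : ∏ i, ‖(Pi.single (x.2 i) (1 : ℝ) : ι → ℝ)‖ = 1 :=
      Finset.prod_eq_one fun i _ => by simp [Pi.norm_single]
    rw [this, mul_one]
  -- The coefficient of a monomial collects all words with the prescribed letter counts.
  refine ⟨fun k => ∑' x : cnt ⁻¹' {k}, a x, ?_⟩
  obtain ⟨ρ, hρ0, hρ⟩ := ENNReal.lt_iff_exists_nnreal_btwn.1 hp.r_pos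
  have hρ0' : 0 < (ρ : ℝ) := by exact_mod_cast hρ0
  have hev : ∀ᶠ y : ι → ℝ in 𝓝 0, ∑ j, ‖y j‖ < ρ := by
    have : Continuous (fun y : ι → ℝ => ∑ j, ‖y j‖) :=
      continuous_finsetSum _ fun j _ => (continuous_apply j).norm
    exact this.continuousAt.eventually_lt continuousAt_const (by simpa using hρ0')
  filter_upwards [hev, Metric.eball_mem_nhds (0 : ι → ℝ) hp.r_pos]
    with y hy hyr
  have hsum := hp.hasSum hyr
  rw [zero_add] at hsum
  have hS : Summable (fun x : Σ n : ℕ, (Fin n → ι) => a x * ∏ i, y (x.2 i)) := by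
    refine Summable.of_norm_bounded (g := fun x : Σ n : ℕ, (Fin n → ι) =>
      ‖p x.1‖ * ∏ i, ‖y (x.2 i)‖) ?_ ?_
    · have hin : ∀ n, ∑ x : Fin n → ι, ‖p n‖ * ∏ i, ‖y (x i)‖ = ‖p n‖ * (∑ j, ‖y j‖) ^ n := by
        intro n
        rw [← Finset.mul_sum]
        congr 1
        rw [← Fin.prod_const, Finset.prod_univ_sum]
        simp
      rw [summable_sigma_of_nonneg]
      · refine ⟨fun n => Summable.of_finite, ?_⟩
        simp only [tsum_fintype, hin]
        obtain ⟨q, hq⟩ : ∃ q : NNReal, (q : ℝ) = ∑ j, ‖y j‖ :=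
          ⟨Real.toNNReal (∑ j, ‖y j‖), Real.coe_toNNReal _ (by positivity)⟩
        simp only [← hq] at hy ⊢
        refine p.summable_norm_mul_pow (lt_of_lt_of_le ?_ (hρ.le.trans hp.r_le))
        exact_mod_cast hy
      · intro x; positivity
    · intro x
      rw [norm_mul, norm_prod]
      gcongr
      exact hna x
  have hfin : ∀ n, HasSum (fun x : Fin n → ι => a ⟨n, x⟩ * ∏ i, y (x i)) (p n fun _ => y) := by
    intro n
    have : (p n fun _ => y) = ∑ x : Fin n → ι, a ⟨n, x⟩ * ∏ i, y (x i) := by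
      have hy' : y = ∑ j, y j • (Pi.single j (1 : ℝ) : ι → ℝ) := by
        ext j; simp [Finset.sum_apply, Pi.single_apply]
      conv_lhs => rw [hy']
      rw [ContinuousMultilinearMap.map_sum]
      refine Finset.sum_congr rfl fun x _ => ?_
      rw [ContinuousMultilinearMap.map_smul_univ, smul_eq_mul, mul_comm]
    rw [this]
    exact hasSum_fintype _
  have htot : HasSum (fun x : Σ n : ℕ, (Fin n → ι) => a x * ∏ i, y (x.2 i)) (f y) := by
    have := hS.hasSum.sigma hfin
    rw [hsum.unique this]
    exact hS.hasSum
  have := htot.tsum_fiberwise cnt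
  refine this.congr_fun fun k => ?_
  rw [← tsum_mul_right]
  refine tsum_congr fun x => ?_
  rw [hcnt, show cnt x = k from x.2]

theorem exists_analyticAt_implicit {E : Type*} [NormedAddCommGroup E] [NormedSpace ℝ E]
    [CompleteSpace E] {F : E × ℝ → ℝ} {w : ℝ} {c : ℝ} (hF : AnalyticAt ℝ F (0, w))
    (h0 : F (0, w) = 0) (hc : c ≠ 0) (hd : HasDerivAt (fun u => F (0, u)) c w) :
    ∃ g : E → ℝ, AnalyticAt ℝ g 0 ∧ g 0 = w ∧ ∀ᶠ y in 𝓝 (0 : E), F (y, g y) = 0 := by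
  -- Smoothness exponent `⊤` is ω, that is, real analyticity; the implicit function inherits it.
  have hF' : ContDiffAt ℝ ⊤ F (0, w) := hF.contDiffAt
  have hder : ∀ x, (fderiv ℝ F (0, w) ∘L ContinuousLinearMap.inr ℝ E ℝ) x = c * x := by
    intro x
    have h1 : HasFDerivAt F (fderiv ℝ F (0, w)) ((fun u : ℝ => ((0 : E), u)) w) :=
      hF.differentiableAt.hasFDerivAt
    have h2 : HasFDerivAt (fun u : ℝ => ((0 : E), u)) (ContinuousLinearMap.inr ℝ E ℝ) w :=
      hasFDerivAt_prodMk_right (𝕜 := ℝ) (0 : E) w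
    have h3 := (h1.comp w h2).unique hd.hasFDerivAt
    rw [h3]; simp [mul_comm]
  have hinv : (fderiv ℝ F (0, w) ∘L ContinuousLinearMap.inr ℝ E ℝ).IsInvertible := by
    refine ⟨ContinuousLinearEquiv.unitsEquivAut ℝ (Units.mk0 c hc), ?_⟩
    ext
    rw [hder]; simp
  refine ⟨hF'.implicitFunction (by simp) hinv, ?_, hF'.implicitFunction_apply_self _ hinv, ?_⟩
  · exact (hF'.contDiffAt_implicitFunction _ hinv).analyticAt
  · simpa [h0] using hF'.eventually_apply_implicitFunction (by simp) hinv

theorem analyticAt_zero_of_hasSum {a : ℕ → ℝ} {f : ℝ → ℝ}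
    (h : ∀ᶠ z in 𝓝 (0 : ℝ), HasSum (fun n => a n * z ^ n) (f z)) : AnalyticAt ℝ f 0 := by
  refine ⟨FormalMultilinearSeries.ofScalars ℝ a, hasFPowerSeriesAt_iff.2 ?_⟩
  filter_upwards [h] with z hz
  simpa [FormalMultilinearSeries.coeff_ofScalars, mul_comm] using hz

theorem AnalyticAt.exists_hasSum_zero {f : ℝ → ℝ} (h : AnalyticAt ℝ f 0) :
    ∃ a : ℕ → ℝ, ∀ᶠ z in 𝓝 (0 : ℝ), HasSum (fun n => a n * z ^ n) (f z) := by
  obtain ⟨p, hp⟩ := h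
  refine ⟨p.coeff, ?_⟩
  filter_upwards [hasFPowerSeriesAt_iff.1 hp] with z hz
  simpa [mul_comm] using hz

theorem hasSum_zero_pow_mul (a : ℕ → ℝ) : HasSum (fun n => a n * (0 : ℝ) ^ n) (a 0) := by
  convert hasSum_single (f := fun n => a n * (0 : ℝ) ^ n) 0 ?_ using 1
  · simp
  · intro n hn; simp [hn]

theorem exists_analyticAt_pow_mul {a : ℕ → ℝ} {f : ℝ → ℝ}
    (h : ∀ᶠ z in 𝓝 (0 : ℝ), HasSum (fun n => a n * z ^ n) (f z)) {j : ℕ}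
    (hj : ∀ n < j, a n = 0) :
    ∃ g : ℝ → ℝ, AnalyticAt ℝ g 0 ∧ g 0 = a j ∧ ∀ᶠ z in 𝓝 (0 : ℝ), f z = z ^ j * g z := by
  have key : ∀ᶠ z in 𝓝 (0 : ℝ), z ≠ 0 → HasSum (fun n => a (n + j) * z ^ n) (f z / z ^ j) := by
    filter_upwards [h] with z hz hz0
    have h1 := ((hasSum_nat_add_iff' j).2 hz).div_const (z ^ j)
    rw [Finset.sum_eq_zero (fun n hn => by rw [hj n (Finset.mem_range.1 hn), zero_mul]),
      sub_zero] at h1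
    refine h1.congr_fun fun n => ?_
    rw [pow_add]; field_simp
  -- The quotient has to be patched at 0, where division by `0 ^ j` would give the wrong value for j
  -- > 0.
  refine ⟨fun z => if z = 0 then a j else f z / z ^ j,
    analyticAt_zero_of_hasSum (a := fun n => a (n + j)) ?_, by simp, ?_⟩
  · filter_upwards [key] with z hz
    by_cases hz0 : z = 0
    · subst hz0
      simpa using hasSum_zero_pow_mul (fun n => a (n + j))
    · simpa [hz0] using hz hz0
  · filter_upwards with z
    by_cases hz0 : z = 0
    · subst hz0
      have h0 := h.self_of_nhds.unique (hasSum_zero_pow_mul a)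
      rcases Nat.eq_zero_or_pos j with rfl | hjp
      · simpa using h0
      · simp [h0, hj 0 hjp, hjp.ne']
    · simp only [hz0, if_false]; field_simp

/-- A one-sided limit suffices: by strong induction, the first coefficient that could be nonzero
below order m is the limit of f(r)/r^n = (f(r)/r^m) r^{m-n}, which is 0. This is how Taylor
coefficients along a ray are obtained from asymptotics for r > 0 only. -/
theorem coeff_of_tendsto_div_pow {a : ℕ → ℝ} {f : ℝ → ℝ}
    (h : ∀ᶠ z in 𝓝 (0 : ℝ), HasSum (fun n => a n * z ^ n) (f z)) {m : ℕ} {l : ℝ}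
    (hl : Tendsto (fun r => f r / r ^ m) (𝓝[>] 0) (𝓝 l)) :
    (∀ n < m, a n = 0) ∧ a m = l := by
  have step : ∀ j, (∀ n < j, a n = 0) → Tendsto (fun r => f r / r ^ j) (𝓝[>] 0) (𝓝 (a j)) := by
    intro j hj
    obtain ⟨g, hg, hg0, hfg⟩ := exists_analyticAt_pow_mul h hj
    rw [← hg0]
    refine (hg.continuousAt.tendsto.mono_left nhdsWithin_le_nhds).congr' ?_
    filter_upwards [hfg.filter_mono nhdsWithin_le_nhds, self_mem_nhdsWithin] with r hr (hr0 : 0 < r)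
    rw [hr]; field_simp
  have hz : ∀ n < m, a n = 0 := by
    intro n
    induction n using Nat.strong_induction_on with
    | _ n ih =>
      intro hn
      have h1 := step n fun k hk => ih k hk (hk.trans hn)
      have hpow : Tendsto (fun r : ℝ => r ^ (m - n)) (𝓝[>] 0) (𝓝 0) := by
        have : Continuous fun r : ℝ => r ^ (m - n) := by fun_prop
        have := this.tendsto 0
        rw [zero_pow (by omega)] at this
        exact this.mono_left nhdsWithin_le_nhds
      have h2 := hl.mul hpow
      rw [mul_zero] at h2
      refine tendsto_nhds_unique h1 (h2.congr' ?_)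
      filter_upwards [self_mem_nhdsWithin] with r (hr0 : 0 < r)
      have : r ^ m = r ^ n * r ^ (m - n) := by rw [← pow_add]; congr 1; omega
      rw [this]; field_simp
  exact ⟨hz, tendsto_nhds_unique (step m hz) hl⟩

/-- The series at z minus the series at -z represents 0 and has coefficients a_n (1 - (-1)^n). -/
theorem coeff_odd_eq_zero {a : ℕ → ℝ} {f : ℝ → ℝ}
    (h : ∀ᶠ z in 𝓝 (0 : ℝ), HasSum (fun n => a n * z ^ n) (f z))
    (he : ∀ z, f (-z) = f z) {n : ℕ} (hn : Odd n) : a n = 0 := by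
  have h' : ∀ᶠ z in 𝓝 (0 : ℝ), HasSum (fun n => a n * (-z) ^ n) (f (-z)) := by
    have : Tendsto (fun z : ℝ => -z) (𝓝 0) (𝓝 0) := by simpa using (continuous_neg (G := ℝ)).tendsto 0
    exact this.eventually h
  have hd : ∀ᶠ z in 𝓝 (0 : ℝ), HasSum (fun n => (a n - a n * (-1) ^ n) * z ^ n) ((fun _ => 0) z) := by
    filter_upwards [h, h'] with z h1 h2
    have := h1.sub h2
    rw [he, sub_self] at this
    refine this.congr_fun fun n => ?_
    rw [neg_pow z]; ring
  have := (coeff_of_tendsto_div_pow hd (m := n) (l := 0) (by simp)).2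
  rw [hn.neg_one_pow] at this
  linarith

/-- Geometric expansion of 1/(ε + t) in powers of -t/ε, integrated termwise; it is dominated by
(|t|/δ)^n |w/ε| for |t| < δ. -/
theorem analyticAt_integral_div_add {X : Type*} [MeasurableSpace X] {ν : Measure X}
    {ε w : X → ℝ} {δ : ℝ} (hδ : 0 < δ) (hε : ∀ᵐ x ∂ν, δ ≤ ε x) (hεm : AEStronglyMeasurable ε ν)
    (hw : Integrable (fun x => w x / ε x) ν) :
    AnalyticAt ℝ (fun t => ∫ x, w x / (ε x + t) ∂ν) 0 := by
  refine analyticAt_zero_of_hasSum (a := fun n => ∫ x, w x / ε x * (-(ε x)⁻¹) ^ n ∂ν) ?_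
  have hball : ∀ᶠ t in 𝓝 (0 : ℝ), |t| < δ := by
    simpa using (continuous_abs.tendsto (0 : ℝ)).eventually_lt_const (by simpa using hδ)
  filter_upwards [hball] with t ht
  set q := |t| / δ with hq
  have hq0 : 0 ≤ q := by positivity
  have hq1 : q < 1 := (div_lt_one hδ).2 ht
  have hbd : ∀ n, ∀ᵐ x ∂ν, ‖w x / ε x * (-(ε x)⁻¹ * t) ^ n‖ ≤ ‖w x / ε x‖ * q ^ n := by
    intro n
    filter_upwards [hε] with x hx
    rw [norm_mul, norm_pow, norm_mul, norm_neg, norm_inv, Real.norm_eq_abs (ε x),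
      abs_of_pos (hδ.trans_le hx), Real.norm_eq_abs t]
    have h1 : (ε x)⁻¹ * |t| ≤ q := by
      rw [hq, inv_mul_eq_div]
      gcongr
    have h2 : 0 ≤ (ε x)⁻¹ * |t| := mul_nonneg (inv_nonneg.2 (hδ.le.trans hx)) (abs_nonneg t)
    gcongr
  have hintg : ∀ n, Integrable (fun x => w x / ε x * (-(ε x)⁻¹ * t) ^ n) ν := by
    intro n
    refine (hw.norm.mul_const (q ^ n)).mono' ?_ (hbd n)
    exact hw.aestronglyMeasurable.mul
      (((hεm.aemeasurable.inv.neg).mul_const t).pow_const n).aestronglyMeasurable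
  have hs : Summable fun n => ∫ x, ‖w x / ε x * (-(ε x)⁻¹ * t) ^ n‖ ∂ν := by
    refine Summable.of_nonneg_of_le (fun n => by positivity) (fun n => ?_)
      ((summable_geometric_of_lt_one hq0 hq1).mul_left (∫ x, ‖w x / ε x‖ ∂ν))
    rw [← integral_mul_const]
    exact integral_mono_ae (hintg n).norm (hw.norm.mul_const _) (hbd n)
  have hmain := hasSum_integral_of_summable_integral_norm hintg hs
  have heq : ∫ x, ∑' n, w x / ε x * (-(ε x)⁻¹ * t) ^ n ∂ν = ∫ x, w x / (ε x + t) ∂ν := by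
    refine integral_congr_ae ?_
    filter_upwards [hε] with x hx
    have hx0 : 0 < ε x := hδ.trans_le hx
    have hlt : |-(ε x)⁻¹ * t| < 1 := by
      rw [abs_mul, abs_neg, abs_inv, abs_of_pos hx0, inv_mul_lt_iff₀ hx0]
      linarith
    have hpos : 0 < ε x + t := by linarith [neg_abs_le t]
    rw [tsum_mul_left, tsum_geometric_of_abs_lt_one hlt]
    have : 1 - -(ε x)⁻¹ * t = (ε x + t) / ε x := by field_simp; ring
    rw [this]; field_simp
  rw [heq] at hmain
  refine hmain.congr_fun fun n => ?_
  rw [← integral_mul_const]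
  congr 1
  ext x
  rw [mul_pow, mul_assoc]

/-! ### Inverting the threshold equation by rescaling -/

theorem AnalyticAt.zpow_of_ne_zero {E : Type*} [NormedAddCommGroup E] [NormedSpace ℝ E]
    {f : E → ℝ} {x : E} (hf : AnalyticAt ℝ f x) (h0 : f x ≠ 0) (m : ℤ) :
    AnalyticAt ℝ (fun y => f y ^ m) x := by
  obtain ⟨n, rfl | rfl⟩ := m.eq_nat_or_neg
  · simpa only [zpow_natCast] using hf.fun_pow n
  · simpa only [zpow_neg, zpow_natCast] using (hf.fun_pow n).fun_inv (pow_ne_zero n h0)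

theorem rpow_one_div_zpow {b : ℝ} (hb : 0 < b) {m : ℤ} (hm : m ≠ 0) :
    (b ^ ((1 : ℝ) / m)) ^ m = b := by
  rw [← Real.rpow_intCast, ← Real.rpow_mul hb.le, one_div, inv_mul_cancel₀ (by exact_mod_cast hm),
    Real.rpow_one]

theorem tendsto_nhdsGT_zero_of_mul {α : Type*} {l : Filter α} {u w : α → ℝ} {w₀ : ℝ}
    (hu : Tendsto u l (𝓝[>] 0)) (hw : Tendsto w l (𝓝 w₀)) (h0 : 0 < w₀) :
    Tendsto (fun y => u y * w y) l (𝓝[>] 0) := by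
  rw [tendsto_nhdsWithin_iff] at hu ⊢
  refine ⟨by simpa using hu.1.mul hw, ?_⟩
  filter_upwards [hu.2, hw.eventually_const_lt h0] with y h1 h2 using mul_pos h1 h2

/-- With κ = y w the factor y^m cancels, leaving w^m E(y w) = D(y), which is nondegenerate at y = 0,
w₀ = (D 0 / E 0)^{1/m}. The exponent m may be negative: this is the case where the resolvent form
blows up at the threshold. -/
theorem exists_solution_odd {m : ℤ} (hm : m ≠ 0) {D E : ℝ → ℝ} (hD : AnalyticAt ℝ D 0)
    (hE : AnalyticAt ℝ E 0) (hD0 : 0 < D 0) (hE0 : 0 < E 0) :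
    ∃ (c : ℕ → ℝ) (κ : ℝ → ℝ), c 0 = (D 0 / E 0) ^ ((1 : ℝ) / m) ∧
      Tendsto κ (𝓝[>] 0) (𝓝[>] 0) ∧ ∀ᶠ y in 𝓝[>] (0 : ℝ),
        HasSum (fun n => c n * y ^ (n + 1)) (κ y) ∧ y ^ m * D y = κ y ^ m * E (κ y) := by
  set w₀ := (D 0 / E 0) ^ ((1 : ℝ) / m) with hw₀
  have hb : 0 < D 0 / E 0 := div_pos hD0 hE0
  have hw0 : 0 < w₀ := Real.rpow_pos_of_pos hb _
  have hwm : w₀ ^ m = D 0 / E 0 := rpow_one_div_zpow hb hm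
  let F : ℝ × ℝ → ℝ := fun p => p.2 ^ m * E (p.1 * p.2) - D p.1
  have hF : AnalyticAt ℝ F (0, w₀) := by
    refine ((analyticAt_snd.zpow_of_ne_zero hw0.ne' m).fun_mul ?_).fun_sub ?_
    · exact AnalyticAt.fun_comp_of_eq hE (analyticAt_fst.fun_mul analyticAt_snd) (by simp)
    · exact AnalyticAt.fun_comp_of_eq hD analyticAt_fst rfl
  have hd : HasDerivAt (fun u => F (0, u)) (m * w₀ ^ (m - 1) * E 0) w₀ := by
    simpa [F] using ((hasDerivAt_zpow m w₀ (Or.inl hw0.ne')).mul_const (E 0)).sub_const (D 0)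
  obtain ⟨g, hg, hg0, hgF⟩ := exists_analyticAt_implicit hF
    (by simp [F, hwm, hE0.ne']) (by
      have : (m : ℝ) ≠ 0 := by exact_mod_cast hm
      have := zpow_pos hw0 (m - 1)
      positivity) hd
  obtain ⟨c, hc⟩ := hg.exists_hasSum_zero
  refine ⟨c, fun y => y * g y, ?_, ?_, ?_⟩
  · rw [← hg0]; exact (hasSum_zero_pow_mul c).unique hc.self_of_nhds
  · exact tendsto_nhdsGT_zero_of_mul tendsto_id
      (hg.continuousAt.tendsto.mono_left nhdsWithin_le_nhds) (hg0 ▸ hw0)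
  · filter_upwards [hc.filter_mono nhdsWithin_le_nhds, hgF.filter_mono nhdsWithin_le_nhds]
      with y h1 h2
    refine ⟨?_, ?_⟩
    · refine (h1.mul_left y).congr_fun fun n => ?_
      ring
    · rw [mul_zpow, mul_assoc, sub_eq_zero.1 h2]

theorem hasSum_finTwo {c : (Fin 2 → ℕ) → ℝ} {y : Fin 2 → ℝ} {s : ℝ}
    (h : HasSum (fun k => c k * ∏ j, y j ^ k j) s) :
    HasSum (fun k : ℕ × ℕ => c ![k.1, k.2] * (y 0 ^ k.1 * y 1 ^ k.2)) s := by
  rw [← (finTwoArrowEquiv ℕ).symm.hasSum_iff] at h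
  refine h.congr_fun fun k => ?_
  simp [Fin.prod_univ_two, finTwoArrowEquiv]

/-- Triples as functions on `Fin 3`. -/
def tripleArrowEquiv (α : Type*) : α × α × α ≃ (Fin 3 → α) where
  toFun k := ![k.1, k.2.1, k.2.2]
  invFun f := (f 0, f 1, f 2)
  left_inv _ := rfl
  right_inv f := by ext i; fin_cases i <;> rfl

theorem hasSum_finThree {c : (Fin 3 → ℕ) → ℝ} {y : Fin 3 → ℝ} {s : ℝ}
    (h : HasSum (fun k => c k * ∏ j, y j ^ k j) s) :
    HasSum (fun k : ℕ × ℕ × ℕ =>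
      c ![k.1, k.2.1, k.2.2] * (y 0 ^ k.1 * y 1 ^ k.2.1 * y 2 ^ k.2.2)) s := by
  rw [← (tripleArrowEquiv ℕ).hasSum_iff] at h
  refine h.congr_fun fun k => ?_
  simp only [Function.comp_apply, Fin.prod_univ_three]
  rfl

theorem hasSum_monomials_zero {ι : Type*} [Fintype ι] [DecidableEq ι] (c : (ι → ℕ) → ℝ) :
    HasSum (fun k => c k * ∏ j, (0 : ι → ℝ) j ^ k j) (c 0) := by
  convert hasSum_single (f := fun k => c k * ∏ j, (0 : ι → ℝ) j ^ k j) 0 ?_ using 1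
  · simp
  · intro k hk
    obtain ⟨j, hj⟩ := Function.ne_iff.1 hk
    rw [Finset.prod_eq_zero (Finset.mem_univ j) (by simpa using hj), mul_zero]

theorem AnalyticAt.exists_hasSum_two {g : (Fin 2 → ℝ) → ℝ} (hg : AnalyticAt ℝ g 0) :
    ∃ c : ℕ × ℕ → ℝ, c (0, 0) = g 0 ∧ ∀ᶠ y in 𝓝 (0 : Fin 2 → ℝ),
      HasSum (fun k => c k * (y 0 ^ k.1 * y 1 ^ k.2)) (g y) := by
  obtain ⟨c, hc⟩ := hg.exists_hasSum_monomials
  refine ⟨fun k => c ![k.1, k.2], ?_, hc.mono fun y hy => hasSum_finTwo hy⟩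
  rw [hc.self_of_nhds.unique (hasSum_monomials_zero c)]
  exact congrArg c (by ext i; fin_cases i <;> rfl)

theorem AnalyticAt.exists_hasSum_three {g : (Fin 3 → ℝ) → ℝ} (hg : AnalyticAt ℝ g 0) :
    ∃ c : ℕ × ℕ × ℕ → ℝ, c (0, 0, 0) = g 0 ∧ ∀ᶠ y in 𝓝 (0 : Fin 3 → ℝ),
      HasSum (fun k => c k * (y 0 ^ k.1 * y 1 ^ k.2.1 * y 2 ^ k.2.2)) (g y) := by
  obtain ⟨c, hc⟩ := hg.exists_hasSum_monomials
  refine ⟨fun k => c ![k.1, k.2.1, k.2.2], ?_, hc.mono fun y hy => hasSum_finThree hy⟩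
  rw [hc.self_of_nhds.unique (hasSum_monomials_zero c)]
  exact congrArg c (by ext i; fin_cases i <;> rfl)

theorem analyticAt_pi_apply_fst {n : ℕ} (i : Fin n) (x : (Fin n → ℝ) × ℝ) :
    AnalyticAt ℝ (fun p : (Fin n → ℝ) × ℝ => p.1 i) x :=
  ((ContinuousLinearMap.proj (R := ℝ) (φ := fun _ : Fin n => ℝ) i).comp
    (ContinuousLinearMap.fst ℝ (Fin n → ℝ) ℝ)).analyticAt x

theorem tendsto_vec_two {α : Type*} {l : Filter α} {a b : α → ℝ} (ha : Tendsto a l (𝓝 0))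
    (hb : Tendsto b l (𝓝 0)) : Tendsto (fun s => ![a s, b s]) l (𝓝 0) := by
  rw [tendsto_pi_nhds]
  intro i; fin_cases i
  exacts [ha, hb]

theorem tendsto_vec_three {α : Type*} {l : Filter α} {a b c : α → ℝ} (ha : Tendsto a l (𝓝 0))
    (hb : Tendsto b l (𝓝 0)) (hc : Tendsto c l (𝓝 0)) :
    Tendsto (fun s => ![a s, b s, c s]) l (𝓝 0) := by
  rw [tendsto_pi_nhds]
  intro i; fin_cases i
  exacts [ha, hb, hc]

theorem tendsto_pow_mul_log_nhdsGT_zero {k : ℕ} (hk : 1 ≤ k) :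
    Tendsto (fun y : ℝ => y ^ k * Real.log y) (𝓝[>] 0) (𝓝 0) := by
  have := tendsto_log_mul_rpow_nhdsGT_zero (r := k) (by exact_mod_cast hk)
  simpa [mul_comm] using this

/-- With x = y w, x^k log x = w^k (y^k log y + y^k log w). Treating θ = -y^k log y as a variable
independent of y makes the equation analytic in (y, θ, w) near w₀ > 0; since k ≥ 1 all logarithmic
contributions vanish at y = θ = 0. -/
theorem exists_solution_even {m : ℤ} (hm : m ≠ 0) {k : ℕ} (hk : 1 ≤ k) {D A L : ℝ → ℝ}
    (hD : AnalyticAt ℝ D 0) (hA : AnalyticAt ℝ A 0) (hL : AnalyticAt ℝ L 0)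
    (hD0 : 0 < D 0) (hA0 : 0 < A 0) :
    ∃ (c : ℕ × ℕ → ℝ) (x : ℝ → ℝ), c (0, 0) = (D 0 / A 0) ^ ((1 : ℝ) / m) ∧
      Tendsto x (𝓝[>] 0) (𝓝[>] 0) ∧ ∀ᶠ y in 𝓝[>] (0 : ℝ),
        HasSum (fun n => c n * y ^ (n.1 + 1) * (-(y ^ k * Real.log y)) ^ n.2) (x y) ∧
        y ^ m * D y = x y ^ m * (A (x y) + L (x y) * x y ^ k * Real.log (x y)) := by
  set w₀ := (D 0 / A 0) ^ ((1 : ℝ) / m) with hw₀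
  have hb : 0 < D 0 / A 0 := div_pos hD0 hA0
  have hw0 : 0 < w₀ := Real.rpow_pos_of_pos hb _
  have hwm : w₀ ^ m = D 0 / A 0 := rpow_one_div_zpow hb hm
  let F : (Fin 2 → ℝ) × ℝ → ℝ := fun p => p.2 ^ m * (A (p.1 0 * p.2) +
    L (p.1 0 * p.2) * p.2 ^ k * (-p.1 1 + p.1 0 ^ k * Real.log p.2)) - D (p.1 0)
  have hF : AnalyticAt ℝ F (0, w₀) := by
    have h0 := analyticAt_pi_apply_fst (n := 2) 0 (0, w₀)
    have h1 := analyticAt_pi_apply_fst (n := 2) 1 (0, w₀)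
    have hw : AnalyticAt ℝ (fun p : (Fin 2 → ℝ) × ℝ => p.2) (0, w₀) := analyticAt_snd
    have hA' := AnalyticAt.fun_comp_of_eq hA (h0.fun_mul hw) (by simp)
    have hL' := AnalyticAt.fun_comp_of_eq hL (h0.fun_mul hw) (by simp)
    have hD' := AnalyticAt.fun_comp_of_eq hD h0 (by simp)
    have hlog : AnalyticAt ℝ (fun p : (Fin 2 → ℝ) × ℝ => Real.log p.2) (0, w₀) :=
      AnalyticAt.fun_comp_of_eq (analyticAt_log hw0) hw rfl
    exact ((hw.zpow_of_ne_zero hw0.ne' m).fun_mul (hA'.fun_add ((hL'.fun_mul (hw.fun_pow k)).fun_mul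
      (h1.fun_neg.fun_add ((h0.fun_pow k).fun_mul hlog))))).fun_sub hD'
  have hk0 : k ≠ 0 := by omega
  have hd : HasDerivAt (fun u => F (0, u)) (m * w₀ ^ (m - 1) * A 0) w₀ := by
    simpa [F, hk0] using ((hasDerivAt_zpow m w₀ (Or.inl hw0.ne')).mul_const (A 0)).sub_const (D 0)
  obtain ⟨g, hg, hg0, hgF⟩ := exists_analyticAt_implicit hF
    (by simp [F, hwm, hA0.ne', hk0]) (by
      have : (m : ℝ) ≠ 0 := by exact_mod_cast hm
      have := zpow_pos hw0 (m - 1)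
      positivity) hd
  obtain ⟨c, hc0, hc⟩ := hg.exists_hasSum_two
  have hid : Tendsto (fun y : ℝ => y) (𝓝[>] 0) (𝓝 0) := nhdsWithin_le_nhds
  have hth : Tendsto (fun y : ℝ => -(y ^ k * Real.log y)) (𝓝[>] 0) (𝓝 0) := by
    simpa using (tendsto_pow_mul_log_nhdsGT_zero hk).neg
  have hP := tendsto_vec_two hid hth
  have hgP := hg.continuousAt.tendsto.comp hP
  rw [hg0] at hgP
  refine ⟨c, fun y => y * g ![y, -(y ^ k * Real.log y)], by rw [hc0, hg0], ?_, ?_⟩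
  · exact tendsto_nhdsGT_zero_of_mul tendsto_id hgP hw0
  · filter_upwards [hP.eventually hc, hP.eventually hgF, self_mem_nhdsWithin,
      hgP.eventually_const_lt hw0] with y h1 h2 (hy : 0 < y) h3
    simp only [Function.comp_apply] at h3
    set w := g ![y, -(y ^ k * Real.log y)] with hw
    refine ⟨?_, ?_⟩
    · refine (h1.mul_left y).congr_fun fun n => ?_
      simp only [Matrix.cons_val_zero, Matrix.cons_val_one]
      ring
    · simp only [F, Matrix.cons_val_zero, Matrix.cons_val_one, sub_eq_zero] at h2
      rw [mul_zpow, mul_assoc, Real.log_mul hy.ne' h3.ne', ← h2]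
      ring

/-- The ansatz is x = e^{-1/(aμ)} w, for which -a log x = 1/μ - a log w cancels the large term 1/μ.
The leftover x² log x contains x²/μ, which is not analytic in (μ, e^{-1/(aμ)}); with E = μ⁻¹
e^{-1/(aμ)} and x = μ E w it becomes the polynomial μ E² w². Hence the pair of variables (μ, E) and
the limit value w₀ = e^{A(0)/a}. -/
theorem exists_solution_four {a : ℝ} (ha : 0 < a) {A M : ℝ → ℝ}
    (hA : AnalyticAt ℝ A 0) (hM : AnalyticAt ℝ M 0) :
    ∃ (c : ℕ × ℕ → ℝ) (x : ℝ → ℝ), 0 < c (0, 0) ∧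
      Tendsto x (𝓝[>] 0) (𝓝[>] 0) ∧ ∀ᶠ μ in 𝓝[>] (0 : ℝ),
        HasSum (fun k => c k * μ ^ (k.1 + 1) * (1 / μ * Real.exp (-1 / (a * μ))) ^ (k.2 + 1)) (x μ) ∧
        1 / μ = A (x μ) + (-a + x μ ^ 2 * M (x μ)) * Real.log (x μ) := by
  set w₀ := Real.exp (A 0 / a) with hw₀
  have hw0 : 0 < w₀ := Real.exp_pos _
  let F : (Fin 2 → ℝ) × ℝ → ℝ := fun p => A (p.1 0 * p.1 1 * p.2) - a * Real.log p.2 +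
    M (p.1 0 * p.1 1 * p.2) * (-(p.1 0 * p.1 1 ^ 2 * p.2 ^ 2 / a) +
      (p.1 0 * p.1 1 * p.2) ^ 2 * Real.log p.2)
  have hF : AnalyticAt ℝ F (0, w₀) := by
    have h0 := analyticAt_pi_apply_fst (n := 2) 0 (0, w₀)
    have h1 := analyticAt_pi_apply_fst (n := 2) 1 (0, w₀)
    have hw : AnalyticAt ℝ (fun p : (Fin 2 → ℝ) × ℝ => p.2) (0, w₀) := analyticAt_snd
    have hx := (h0.fun_mul h1).fun_mul hw
    have hA' := AnalyticAt.fun_comp_of_eq hA hx (by simp)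
    have hM' := AnalyticAt.fun_comp_of_eq hM hx (by simp)
    have hlog : AnalyticAt ℝ (fun p : (Fin 2 → ℝ) × ℝ => Real.log p.2) (0, w₀) :=
      AnalyticAt.fun_comp_of_eq (analyticAt_log hw0) hw rfl
    exact (hA'.fun_sub (analyticAt_const.fun_mul hlog)).fun_add (hM'.fun_mul
      ((((h0.fun_mul (h1.fun_pow 2)).fun_mul (hw.fun_pow 2)).fun_div analyticAt_const ha.ne').fun_neg.fun_add
        ((hx.fun_pow 2).fun_mul hlog)))
  have hd : HasDerivAt (fun u => F (0, u)) (-(a * w₀⁻¹)) w₀ := by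
    simpa [F] using ((Real.hasDerivAt_log hw0.ne').const_mul a).const_sub (A 0)
  obtain ⟨g, hg, hg0, hgF⟩ := exists_analyticAt_implicit hF
    (by simp [F, hw₀]; field_simp; simp) (by
      have := inv_pos.2 hw0
      exact (neg_lt_zero.2 (mul_pos ha this)).ne) hd
  obtain ⟨c, hc0, hc⟩ := hg.exists_hasSum_two
  have hid : Tendsto (fun y : ℝ => y) (𝓝[>] 0) (𝓝 0) := nhdsWithin_le_nhds
  have hE : Tendsto (fun μ : ℝ => 1 / μ * Real.exp (-1 / (a * μ))) (𝓝[>] 0) (𝓝 0) := by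
    have h1 := (tendsto_rpow_mul_exp_neg_mul_atTop_nhds_zero 1 a⁻¹ (inv_pos.2 ha)).comp
      tendsto_inv_nhdsGT_zero
    refine h1.congr fun μ => ?_
    simp only [Function.comp_apply, Real.rpow_one, one_div]
    congr 2
    rw [neg_div, one_div, mul_inv]; ring
  have hP := tendsto_vec_two hid hE
  have hgP := hg.continuousAt.tendsto.comp hP
  rw [hg0] at hgP
  refine ⟨c, fun y => y * (1 / y * Real.exp (-1 / (a * y))) *
    g ![y, 1 / y * Real.exp (-1 / (a * y))], by rw [hc0, hg0]; exact hw0, ?_, ?_⟩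
  · refine tendsto_nhdsGT_zero_of_mul ?_ hgP hw0
    rw [tendsto_nhdsWithin_iff]
    refine ⟨by simpa using hid.mul hE, ?_⟩
    filter_upwards [self_mem_nhdsWithin] with y (hy : 0 < y)
    exact mul_pos hy (by positivity)
  · filter_upwards [hP.eventually hc, hP.eventually hgF, self_mem_nhdsWithin,
      hgP.eventually_const_lt hw0] with y h1 h2 (hy : 0 < y) h3
    simp only [Function.comp_apply] at h3
    set E := 1 / y * Real.exp (-1 / (a * y)) with hEdef
    set w := g ![y, E] with hw
    have hyE : y * E = Real.exp (-1 / (a * y)) := by rw [hEdef]; field_simp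
    refine ⟨?_, ?_⟩
    · refine (h1.mul_left (y * E)).congr_fun fun n => ?_
      simp only [Matrix.cons_val_zero, Matrix.cons_val_one]
      ring
    · simp only [F, Matrix.cons_val_zero, Matrix.cons_val_one] at h2
      have hlog : Real.log (y * E * w) = -1 / (a * y) + Real.log w := by
        rw [hyE, Real.log_mul (Real.exp_pos _).ne' h3.ne', Real.log_exp]
      rw [hlog]
      have e1 : (y * E * w) ^ 2 * (-1 / (a * y)) = -(y * E ^ 2 * w ^ 2 / a) := by
        field_simp
      have e2 : -a * (-1 / (a * y)) = 1 / y := by field_simp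
      linear_combination (-1 : ℝ) * h2 - e2 - M (y * E * w) * e1

/-! ### The scales τ, σ, η and the resonant equation -/

theorem tendsto_tau : Tendsto tau (𝓝[>] 0) (𝓝[>] 0) := by
  rw [tendsto_nhdsWithin_iff]
  constructor
  · have := (Real.continuousAt_rpow_const (0 : ℝ) (1 / 2) (Or.inr (by norm_num))).tendsto
    rw [Real.zero_rpow (by norm_num)] at this
    exact this.mono_left nhdsWithin_le_nhds
  · filter_upwards [self_mem_nhdsWithin] with s (hs : 0 < s) using Real.rpow_pos_of_pos hs _

theorem tau_sq {s : ℝ} (hs : 0 ≤ s) : tau s ^ 2 = s := by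
  rw [tau, ← Real.sqrt_eq_rpow, Real.sq_sqrt hs]

theorem tendsto_log_tau : Tendsto (fun s => Real.log (tau s)) (𝓝[>] 0) atBot :=
  Real.tendsto_log_nhdsGT_zero.comp tendsto_tau

theorem tendsto_sigma : Tendsto sigma (𝓝[>] 0) (𝓝[>] 0) := by
  have h1 : Tendsto (fun s => -1 / Real.log (tau s)) (𝓝[>] 0) (𝓝 0) :=
    tendsto_const_nhds.div_atBot tendsto_log_tau
  rw [tendsto_nhdsWithin_iff]
  constructor
  · have := (Real.continuousAt_rpow_const (0 : ℝ) (1 / 2) (Or.inr (by norm_num))).tendsto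
    rw [Real.zero_rpow (by norm_num)] at this
    exact this.comp h1
  · filter_upwards [tendsto_log_tau.eventually_lt_atBot 0] with s hs
    exact Real.rpow_pos_of_pos (div_pos_of_neg_of_neg (by norm_num) hs) _

theorem tendsto_eta : Tendsto eta (𝓝[>] 0) (𝓝 0) := by
  have h1 : Tendsto (fun u : ℝ => Real.log u / u) atTop (𝓝 0) := by
    simpa using Real.isLittleO_log_id_atTop.tendsto_div_nhds_zero
  have h2 := h1.comp (tendsto_neg_atBot_atTop.comp tendsto_log_tau)
  refine h2.congr fun s => ?_
  simp only [Function.comp_apply, eta, Real.log_inv, div_neg]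

/-- Since log σ = -½ log(-log τ) and σ² = -1/log τ, the logarithm of the scale τσ, once multiplied
by σ², is affine in η. This is why η has to enter the resonant expansion. -/
theorem log_tau_mul_sigma {s : ℝ} (hl : Real.log (tau s) < 0) :
    sigma s ^ 2 * Real.log (tau s * sigma s) = -1 - eta s / 2 := by
  set l := Real.log (tau s) with hldef
  -- Uses the convention log 0 = 0, which is incompatible with a negative logarithm.
  have hτ : tau s ≠ 0 := by rintro h; rw [h, Real.log_zero] at hldef; exact hl.ne hldef
  have hpos : 0 < -1 / l := div_pos_of_neg_of_neg (by norm_num) hl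
  have hσ : sigma s ^ 2 = -1 / l := by
    rw [sigma, ← hldef, ← Real.sqrt_eq_rpow, Real.sq_sqrt hpos.le]
  have hσ0 : sigma s ≠ 0 := (Real.rpow_pos_of_pos hpos _).ne'
  have hlogσ : Real.log (sigma s) = -(1 / 2) * Real.log (-l) := by
    rw [sigma, ← hldef, Real.log_rpow hpos, show -1 / l = (-l)⁻¹ by rw [inv_neg, neg_div, one_div],
      Real.log_inv]
    ring
  rw [Real.log_mul hτ hσ0, ← hldef, hlogσ, hσ, eta, Real.log_inv, ← hldef]
  have hl0 := hl.ne
  field_simp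
  ring

/-- With x = τσw and s = τ², division by τ² gives D(τ) = w² (σ² A + L (-1 - η/2 + σ² log w)), with A
and L taken at τσw. This is analytic in (τ, σ, η, w) and reduces to w² (-L 0) = D 0 at the origin;
the sign L 0 < 0 makes the root positive. -/
theorem exists_solution_eight {D A L : ℝ → ℝ} (hD : AnalyticAt ℝ D 0)
    (hA : AnalyticAt ℝ A 0) (hL : AnalyticAt ℝ L 0) (hD0 : 0 < D 0) (hL0 : L 0 < 0) :
    ∃ (c : ℕ × ℕ × ℕ → ℝ) (x : ℝ → ℝ), c (0, 0, 0) = (D 0 / -L 0) ^ (1 / 2 : ℝ) ∧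
      Tendsto x (𝓝[>] 0) (𝓝[>] 0) ∧ ∀ᶠ s in 𝓝[>] (0 : ℝ),
        HasSum (fun k => c k * tau s ^ (k.1 + 1) * sigma s ^ (k.2.1 + 1) * eta s ^ k.2.2) (x s) ∧
        s * D (tau s) = x s ^ 2 * (A (x s) + L (x s) * Real.log (x s)) := by
  set w₀ := (D 0 / -L 0) ^ (1 / 2 : ℝ) with hw₀
  have hb : 0 < D 0 / -L 0 := div_pos hD0 (neg_pos.2 hL0)
  have hw0 : 0 < w₀ := Real.rpow_pos_of_pos hb _
  have hwm : w₀ ^ 2 = D 0 / -L 0 := by rw [hw₀, ← Real.sqrt_eq_rpow, Real.sq_sqrt hb.le]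
  let F : (Fin 3 → ℝ) × ℝ → ℝ := fun p => p.2 ^ 2 * (p.1 1 ^ 2 * A (p.1 0 * p.1 1 * p.2) +
    L (p.1 0 * p.1 1 * p.2) * (-1 - p.1 2 / 2 + p.1 1 ^ 2 * Real.log p.2)) - D (p.1 0)
  have hF : AnalyticAt ℝ F (0, w₀) := by
    have h0 := analyticAt_pi_apply_fst (n := 3) 0 (0, w₀)
    have h1 := analyticAt_pi_apply_fst (n := 3) 1 (0, w₀)
    have h2 := analyticAt_pi_apply_fst (n := 3) 2 (0, w₀)
    have hw : AnalyticAt ℝ (fun p : (Fin 3 → ℝ) × ℝ => p.2) (0, w₀) := analyticAt_snd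
    have hx := (h0.fun_mul h1).fun_mul hw
    have hA' := AnalyticAt.fun_comp_of_eq hA hx (by simp)
    have hL' := AnalyticAt.fun_comp_of_eq hL hx (by simp)
    have hD' := AnalyticAt.fun_comp_of_eq hD h0 (by simp)
    have hlog : AnalyticAt ℝ (fun p : (Fin 3 → ℝ) × ℝ => Real.log p.2) (0, w₀) :=
      AnalyticAt.fun_comp_of_eq (analyticAt_log hw0) hw rfl
    exact ((hw.fun_pow 2).fun_mul (((h1.fun_pow 2).fun_mul hA').fun_add (hL'.fun_mul
      ((analyticAt_const.fun_sub (h2.fun_div analyticAt_const two_ne_zero)).fun_add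
        ((h1.fun_pow 2).fun_mul hlog))))).fun_sub hD'
  have hd : HasDerivAt (fun u => F (0, u)) (2 * w₀ * (-L 0)) w₀ := by
    simpa [F] using ((hasDerivAt_pow 2 w₀).mul_const (-L 0)).sub_const (D 0)
  obtain ⟨g, hg, hg0, hgF⟩ := exists_analyticAt_implicit hF
    (by simp [F, hwm, hL0.ne, div_neg]) (by
      have : 0 < -L 0 := neg_pos.2 hL0
      positivity) hd
  obtain ⟨c, hc0, hc⟩ := hg.exists_hasSum_three
  have hP := tendsto_vec_three (tendsto_tau.mono_right nhdsWithin_le_nhds)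
    (tendsto_sigma.mono_right nhdsWithin_le_nhds) tendsto_eta
  have hgP := hg.continuousAt.tendsto.comp hP
  rw [hg0] at hgP
  refine ⟨c, fun s => tau s * sigma s * g ![tau s, sigma s, eta s], by rw [hc0, hg0], ?_, ?_⟩
  · refine tendsto_nhdsGT_zero_of_mul ?_ hgP hw0
    have hτ := tendsto_nhdsWithin_iff.1 tendsto_tau
    have hσ := tendsto_nhdsWithin_iff.1 tendsto_sigma
    rw [tendsto_nhdsWithin_iff]
    refine ⟨by simpa using hτ.1.mul hσ.1, ?_⟩
    filter_upwards [hτ.2, hσ.2] with s h1 h2 using mul_pos (mem_Ioi.1 h1) (mem_Ioi.1 h2)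
  · filter_upwards [hP.eventually hc, hP.eventually hgF, self_mem_nhdsWithin,
      hgP.eventually_const_lt hw0, tendsto_log_tau.eventually_lt_atBot 0,
      (tendsto_nhdsWithin_iff.1 tendsto_tau).2, (tendsto_nhdsWithin_iff.1 tendsto_sigma).2]
      with s h1 h2 (hs : 0 < s) h3 hl (hτ : 0 < tau s) (hσ : 0 < sigma s)
    simp only [Function.comp_apply] at h3
    set w := g ![tau s, sigma s, eta s] with hw
    refine ⟨?_, ?_⟩
    · refine (h1.mul_left (tau s * sigma s)).congr_fun fun n => ?_
      simp only [Matrix.cons_val_zero, Matrix.cons_val_one, Matrix.cons_val]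
      ring
    · simp only [F, Matrix.cons_val_zero, Matrix.cons_val_one, Matrix.cons_val] at h2
      rw [Real.log_mul (mul_pos hτ hσ).ne' h3.ne']
      have e1 := log_tau_mul_sigma hl
      have e2 := tau_sq hs.le
      linear_combination (-s) * h2 - w ^ 2 * (sigma s ^ 2 * A (tau s * sigma s * w) +
        L (tau s * sigma s * w) * (sigma s ^ 2 * Real.log (tau s * sigma s) +
          sigma s ^ 2 * Real.log w)) * e2 - s * w ^ 2 * L (tau s * sigma s * w) * e1

/-! ### The radial integrals ∫ r^k / (r⁴ + t) -/

namespace LatticeBilaplacian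

/-- The singular part at `t = 0` of `∫₀^γ r^(n-1) / (r⁴ + t) dr`. -/
def singPart : ℕ → ℝ → ℝ
  | 0, _ => 0
  | 1, t => π / (2 * √2) * t ^ (-3 / 4 : ℝ)
  | 2, t => π / 4 * t ^ (-1 / 2 : ℝ)
  | 3, t => π / (2 * √2) * t ^ (-1 / 4 : ℝ)
  | 4, t => -(1 / 4) * Real.log t
  | n + 5, t => -t * singPart (n + 1) t

/-- Reflects r^{k+4}/(r⁴ + t) = r^k - t r^k/(r⁴ + t), whose first term contributes nothing singular.
It fails at n = 0, where `singPart 4` is a logarithm. -/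
theorem singPart_add_four {n : ℕ} (hn : 1 ≤ n) (t : ℝ) :
    singPart (n + 4) t = -t * singPart n t := by
  obtain ⟨n, rfl⟩ := Nat.exists_eq_add_of_le' hn
  rw [show n + 1 + 4 = n + 5 from rfl, singPart]

/-- From r⁴ + 1 = (r² + √2 r + 1)(r² - √2 r + 1): this primitive and the logarithmic one below have
derivatives (1 ± r²)/(2(r⁴ + 1)), whose sum and difference are 1/(r⁴ + 1) and r²/(r⁴ + 1). -/
theorem hasDerivAt_arctan_quartic (r : ℝ) :
    HasDerivAt (fun r => 1 / (2 * √2) * (Real.arctan (√2 * r + 1) + Real.arctan (√2 * r - 1)))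
      ((1 + r ^ 2) / (2 * (r ^ 4 + 1))) r := by
  have h2 : √2 ^ 2 = 2 := Real.sq_sqrt (by norm_num)
  have h1 := ((((hasDerivAt_id r).const_mul √2).add_const 1).arctan.add
    (((hasDerivAt_id r).const_mul √2).sub_const 1).arctan).const_mul (1 / (2 * √2))
  refine h1.congr_deriv ?_
  have e1 : 1 + (√2 * r + 1) ^ 2 = 2 * (r ^ 2 + √2 * r + 1) := by linear_combination r ^ 2 * h2
  have e2 : 1 + (√2 * r - 1) ^ 2 = 2 * (r ^ 2 - √2 * r + 1) := by linear_combination r ^ 2 * h2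
  have p1 : 0 < r ^ 2 + √2 * r + 1 := by nlinarith [sq_nonneg (√2 * r + 1)]
  have p2 : 0 < r ^ 2 - √2 * r + 1 := by nlinarith [sq_nonneg (√2 * r - 1)]
  have e3 : r ^ 4 + 1 = (r ^ 2 + √2 * r + 1) * (r ^ 2 - √2 * r + 1) := by
    linear_combination r ^ 2 * h2
  simp only [id, e1, e2, e3]
  have hs : (r ^ 2 + √2 * r + 1) + (r ^ 2 - √2 * r + 1) = 2 * (1 + r ^ 2) := by ring
  generalize r ^ 2 + √2 * r + 1 = P at *
  generalize r ^ 2 - √2 * r + 1 = Q at *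
  field_simp
  linear_combination hs

theorem hasDerivAt_log_quartic (r : ℝ) :
    HasDerivAt (fun r => 1 / (4 * √2) * (Real.log (r ^ 2 + √2 * r + 1) -
      Real.log (r ^ 2 - √2 * r + 1))) ((1 - r ^ 2) / (2 * (r ^ 4 + 1))) r := by
  have h2 : √2 ^ 2 = 2 := Real.sq_sqrt (by norm_num)
  have p1 : 0 < r ^ 2 + √2 * r + 1 := by nlinarith [sq_nonneg (√2 * r + 1)]
  have p2 : 0 < r ^ 2 - √2 * r + 1 := by nlinarith [sq_nonneg (√2 * r - 1)]
  have d1 : HasDerivAt (fun r : ℝ => r ^ 2 + √2 * r + 1) (2 * r + √2) r := by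
    simpa using ((hasDerivAt_pow 2 r).add ((hasDerivAt_id r).const_mul √2)).add_const 1
  have d2 : HasDerivAt (fun r : ℝ => r ^ 2 - √2 * r + 1) (2 * r - √2) r := by
    simpa using ((hasDerivAt_pow 2 r).sub ((hasDerivAt_id r).const_mul √2)).add_const 1
  refine (((d1.log p1.ne').sub (d2.log p2.ne')).const_mul (1 / (4 * √2))).congr_deriv ?_
  have e3 : r ^ 4 + 1 = (r ^ 2 + √2 * r + 1) * (r ^ 2 - √2 * r + 1) := by
    linear_combination r ^ 2 * h2
  rw [e3]
  have hs : (r ^ 2 + √2 * r + 1) + (r ^ 2 - √2 * r + 1) = 2 * (1 + r ^ 2) := by ring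
  have hd : (r ^ 2 + √2 * r + 1) - (r ^ 2 - √2 * r + 1) = 2 * √2 * r := by ring
  clear d1 d2 e3
  generalize r ^ 2 + √2 * r + 1 = P at *
  generalize r ^ 2 - √2 * r + 1 = Q at *
  field_simp
  linear_combination 2 * √2 * hs - 4 * r * hd

theorem tendsto_arctan_quartic : Tendsto
    (fun r => 1 / (2 * √2) * (Real.arctan (√2 * r + 1) + Real.arctan (√2 * r - 1)))
    atTop (𝓝 (π / (2 * √2))) := by
  have h : Tendsto (fun r : ℝ => √2 * r) atTop atTop := tendsto_id.const_mul_atTop (by positivity)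
  have ha := Real.tendsto_arctan_atTop.mono_right nhdsWithin_le_nhds
  have h1 := ha.comp (tendsto_atTop_add_const_right _ 1 h)
  have h2 := ha.comp (tendsto_atTop_add_const_right _ (-1) h)
  have := (h1.add h2).const_mul (1 / (2 * √2))
  rw [show π / (2 * √2) = 1 / (2 * √2) * (π / 2 + π / 2) by ring]
  exact this.congr fun r => by simp only [Function.comp_apply, sub_eq_add_neg]

theorem tendsto_log_quartic : Tendsto (fun r => 1 / (4 * √2) * (Real.log (r ^ 2 + √2 * r + 1) -
      Real.log (r ^ 2 - √2 * r + 1))) atTop (𝓝 0) := by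
  -- Inversion u = 1/r: the common factor r² drops out of the difference of logarithms.
  have hc : ContinuousAt (fun u : ℝ => 1 / (4 * √2) * (Real.log (1 + √2 * u + u ^ 2) -
      Real.log (1 - √2 * u + u ^ 2))) 0 := by
    refine ContinuousAt.mul continuousAt_const (ContinuousAt.sub ?_ ?_)
    · exact ContinuousAt.log (by fun_prop) (by simp)
    · exact ContinuousAt.log (by fun_prop) (by simp)
  have := hc.tendsto.comp tendsto_inv_atTop_zero
  simp only [mul_zero, add_zero, ne_eq, OfNat.ofNat_ne_zero, not_false_eq_true, zero_pow,
    Real.log_one, sub_zero, sub_self] at this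
  refine this.congr' ?_
  filter_upwards [eventually_gt_atTop 0] with r hr
  have p1 : 0 < r ^ 2 + √2 * r + 1 := by positivity
  have p2 : 0 < r ^ 2 - √2 * r + 1 := by
    nlinarith [sq_nonneg (√2 * r - 1), Real.sq_sqrt (show (0 : ℝ) ≤ 2 by norm_num)]
  have e1 : 1 + √2 * r⁻¹ + r⁻¹ ^ 2 = (r ^ 2 + √2 * r + 1) / r ^ 2 := by field_simp
  have e2 : 1 - √2 * r⁻¹ + r⁻¹ ^ 2 = (r ^ 2 - √2 * r + 1) / r ^ 2 := by field_simp
  simp only [Function.comp_apply, e1, e2]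
  rw [Real.log_div p1.ne' (by positivity), Real.log_div p2.ne' (by positivity)]
  ring

theorem integral_Ioi_of_deriv_nonneg {F f : ℝ → ℝ} {l : ℝ} (hF : ∀ r, HasDerivAt F (f r) r)
    (hf : ∀ r, 0 < r → 0 ≤ f r) (hl : Tendsto F atTop (𝓝 l)) :
    IntegrableOn f (Ioi 0) ∧ ∫ r in Ioi (0 : ℝ), f r = l - F 0 :=
  ⟨integrableOn_Ioi_deriv_of_nonneg' (fun x _ => hF x) (fun x hx => hf x hx) hl,
    integral_Ioi_of_hasDerivAt_of_nonneg' (fun x _ => hF x) (fun x hx => hf x hx) hl⟩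

theorem integral_quartic_zero : IntegrableOn (fun r : ℝ => r ^ 0 / (r ^ 4 + 1)) (Ioi 0) ∧
    ∫ r in Ioi (0 : ℝ), r ^ 0 / (r ^ 4 + 1) = π / (2 * √2) := by
  have := integral_Ioi_of_deriv_nonneg (f := fun r : ℝ => r ^ 0 / (r ^ 4 + 1))
    (fun r => ((hasDerivAt_arctan_quartic r).add (hasDerivAt_log_quartic r)).congr_deriv
      (by have : 0 < r ^ 4 + 1 := by positivity
          field_simp; ring))
    (fun r _ => by positivity) (tendsto_arctan_quartic.add tendsto_log_quartic)
  simpa [Real.arctan_neg] using this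

theorem integral_quartic_two : IntegrableOn (fun r : ℝ => r ^ 2 / (r ^ 4 + 1)) (Ioi 0) ∧
    ∫ r in Ioi (0 : ℝ), r ^ 2 / (r ^ 4 + 1) = π / (2 * √2) := by
  have := integral_Ioi_of_deriv_nonneg (f := fun r : ℝ => r ^ 2 / (r ^ 4 + 1))
    (fun r => ((hasDerivAt_arctan_quartic r).sub (hasDerivAt_log_quartic r)).congr_deriv
      (by have : 0 < r ^ 4 + 1 := by positivity
          field_simp; ring))
    (fun r _ => by positivity) (tendsto_arctan_quartic.sub tendsto_log_quartic)
  simpa [Real.arctan_neg] using this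

theorem integral_quartic_one : IntegrableOn (fun r : ℝ => r ^ 1 / (r ^ 4 + 1)) (Ioi 0) ∧
    ∫ r in Ioi (0 : ℝ), r ^ 1 / (r ^ 4 + 1) = π / 4 := by
  have ha := Real.tendsto_arctan_atTop.mono_right nhdsWithin_le_nhds
  have hl := (ha.comp (tendsto_pow_atTop (α := ℝ) two_ne_zero)).const_mul (1 / 2)
  have := integral_Ioi_of_deriv_nonneg (f := fun r : ℝ => r ^ 1 / (r ^ 4 + 1))
    (fun r => ((hasDerivAt_pow 2 r).arctan.const_mul (1 / 2)).congr_deriv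
      (by have : 0 < r ^ 4 + 1 := by positivity
          have : 0 < 1 + (r ^ 2) ^ 2 := by positivity
          simp; field_simp; ring))
    (fun r hr => by positivity) hl
  refine ⟨this.1, this.2.trans ?_⟩
  simp; ring

/-- Scaling by t^{1/4}: the integral is homogeneous in t of degree (k + 1 - 4)/4. -/
theorem integral_quartic_scale {k : ℕ} {C : ℝ}
    (h : IntegrableOn (fun r : ℝ => r ^ k / (r ^ 4 + 1)) (Ioi 0) ∧
      ∫ r in Ioi (0 : ℝ), r ^ k / (r ^ 4 + 1) = C) {t : ℝ} (ht : 0 < t) :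
    IntegrableOn (fun r : ℝ => r ^ k / (r ^ 4 + t)) (Ioi 0) ∧
      ∫ r in Ioi (0 : ℝ), r ^ k / (r ^ 4 + t) = C * t ^ (((k : ℝ) - 3) / 4) := by
  set b := t ^ (-(1 / 4) : ℝ) with hb
  have hb0 : 0 < b := Real.rpow_pos_of_pos ht _
  have hb4 : b ^ 4 = t⁻¹ := by
    rw [hb, ← Real.rpow_natCast, ← Real.rpow_mul ht.le, ← Real.rpow_neg_one]; norm_num
  have hE : ∀ r : ℝ, r ^ k / (r ^ 4 + t) = (b ^ 4 / b ^ k) * ((b * r) ^ k / ((b * r) ^ 4 + 1)) := by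
    intro r
    have h1 : 0 < r ^ 4 + t := by positivity
    have h2 : 0 < t⁻¹ * r ^ 4 + 1 := by positivity
    rw [mul_pow, mul_pow, hb4]
    field_simp
  simp only [hE]
  refine ⟨Integrable.const_mul ?_ _, ?_⟩
  · have := (integrableOn_Ioi_comp_mul_left_iff (fun r : ℝ => r ^ k / (r ^ 4 + 1)) 0 hb0).2
      (by simpa using h.1)
    exact this
  · rw [integral_const_mul, integral_comp_mul_left_Ioi (fun r : ℝ => r ^ k / (r ^ 4 + 1)) 0 hb0,
      mul_zero, h.2, smul_eq_mul]
    have : b ^ 4 / b ^ k * b⁻¹ = t ^ (((k : ℝ) - 3) / 4) := by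
      have e : b ^ 4 / b ^ k * b⁻¹ = b ^ ((3 : ℝ) - k) := by
        rw [Real.rpow_sub hb0, Real.rpow_natCast]
        norm_cast
        field_simp
      rw [e, hb, ← Real.rpow_mul ht.le]
      congr 1; ring
    rw [← this]; ring

/-- The pure power of t comes from the whole half-line; the removed tail r > γ stays away from the
singularity and is analytic. -/
theorem exists_analyticAt_integral_of_Ioi {k : ℕ} {C γ : ℝ} (hγ : 0 < γ)
    (h : IntegrableOn (fun r : ℝ => r ^ k / (r ^ 4 + 1)) (Ioi 0) ∧
      ∫ r in Ioi (0 : ℝ), r ^ k / (r ^ 4 + 1) = C) :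
    ∃ A : ℝ → ℝ, AnalyticAt ℝ A 0 ∧ ∀ t > 0,
      ∫ r in Ioc 0 γ, r ^ k / (r ^ 4 + t) = C * t ^ (((k : ℝ) - 3) / 4) + A t := by
  refine ⟨fun t => -∫ r in Ioi γ, r ^ k / (r ^ 4 + t), ?_, fun t ht => ?_⟩
  · refine (analyticAt_integral_div_add (pow_pos hγ 4) ?_ ?_ ?_).fun_neg
    · filter_upwards [ae_restrict_mem measurableSet_Ioi] with r (hr : γ < r)
      gcongr
    · exact (by fun_prop : Continuous fun r : ℝ => r ^ 4).aestronglyMeasurable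
    · have h1 : IntegrableOn (fun r : ℝ => r ^ k / (r ^ 4 + 1)) (Ioi γ) :=
        h.1.mono_set (Ioi_subset_Ioi hγ.le)
      refine (h1.const_mul (1 + (γ ^ 4)⁻¹)).mono'
        (by fun_prop : Measurable fun r : ℝ => r ^ k / r ^ 4).aestronglyMeasurable ?_
      filter_upwards [ae_restrict_mem measurableSet_Ioi] with r (hr : γ < r)
      have hr0 : 0 < r := hγ.trans hr
      rw [Real.norm_of_nonneg (by positivity)]
      have : γ ^ 4 ≤ r ^ 4 := by gcongr
      have h2 : (r ^ 4 + 1) / r ^ 4 ≤ 1 + (γ ^ 4)⁻¹ := by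
        rw [add_div, div_self (by positivity), one_div]
        gcongr
      calc r ^ k / r ^ 4 = (r ^ 4 + 1) / r ^ 4 * (r ^ k / (r ^ 4 + 1)) := by
            field_simp
        _ ≤ _ := by gcongr
  · have hs := integral_quartic_scale h ht
    have hu : Ioc 0 γ ∪ Ioi γ = Ioi 0 := Ioc_union_Ioi_eq_Ioi hγ.le
    have := setIntegral_union (f := fun r : ℝ => r ^ k / (r ^ 4 + t)) (μ := volume)
      (Ioc_disjoint_Ioi le_rfl) measurableSet_Ioi
      (hs.1.mono_set Ioc_subset_Ioi_self) (hs.1.mono_set (Ioi_subset_Ioi hγ.le))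
    rw [hu, hs.2] at this
    linarith

theorem continuous_pow_div_quartic (k : ℕ) {t : ℝ} (ht : 0 < t) :
    Continuous fun r : ℝ => r ^ k / (r ^ 4 + t) :=
  (continuous_pow k).div (by fun_prop) fun r => by positivity

theorem integrableOn_pow_div_quartic (k : ℕ) (γ : ℝ) {t : ℝ} (ht : 0 < t) :
    IntegrableOn (fun r : ℝ => r ^ k / (r ^ 4 + t)) (Ioc 0 γ) :=
  (continuous_pow_div_quartic k ht).integrableOn_Ioc

theorem integral_pow_div_quartic_add_four (k : ℕ) {γ t : ℝ} (hγ : 0 < γ) (ht : 0 < t) :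
    ∫ r in Ioc 0 γ, r ^ (k + 4) / (r ^ 4 + t) =
      γ ^ (k + 1) / ((k : ℝ) + 1) - t * ∫ r in Ioc 0 γ, r ^ k / (r ^ 4 + t) := by
  have h1 : ∫ r in Ioc 0 γ, r ^ k = γ ^ (k + 1) / ((k : ℝ) + 1) := by
    rw [← intervalIntegral.integral_of_le hγ.le, integral_pow]; simp
  rw [← h1, ← integral_const_mul, ← integral_sub]
  · refine setIntegral_congr_fun measurableSet_Ioc fun r hr => ?_
    have : 0 < r ^ 4 + t := by positivity
    field_simp
    ring
  · exact (continuous_pow k).integrableOn_Ioc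
  · exact (integrableOn_pow_div_quartic k γ ht).const_mul t

/-- For k ≤ 2 the half-line integral converges and scaling applies; k = 3 diverges at infinity and
is integrated explicitly by a logarithm; larger k reduce by the recursion of step 4. -/
theorem exists_analyticAt_integral_pow_div_quartic {γ : ℝ} (hγ : 0 < γ) (k : ℕ) :
    ∃ A : ℝ → ℝ, AnalyticAt ℝ A 0 ∧ ∀ t > 0,
      ∫ r in Ioc 0 γ, r ^ k / (r ^ 4 + t) = singPart (k + 1) t + A t := by
  induction k using Nat.strong_induction_on with
  | _ k ih =>
    match k, ih with
    | 0, _ =>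
      obtain ⟨A, hA, h⟩ := exists_analyticAt_integral_of_Ioi hγ integral_quartic_zero
      refine ⟨A, hA, fun t ht => ?_⟩
      rw [h t ht, singPart]; norm_num
    | 1, _ =>
      obtain ⟨A, hA, h⟩ := exists_analyticAt_integral_of_Ioi hγ integral_quartic_one
      refine ⟨A, hA, fun t ht => ?_⟩
      rw [h t ht, singPart]; norm_num
    | 2, _ =>
      obtain ⟨A, hA, h⟩ := exists_analyticAt_integral_of_Ioi hγ integral_quartic_two
      refine ⟨A, hA, fun t ht => ?_⟩
      rw [h t ht, singPart]; norm_num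
    | 3, _ =>
      have h4 : 0 < γ ^ 4 := by positivity
      refine ⟨fun t => 1 / 4 * Real.log (γ ^ 4 + t), ?_, fun t ht => ?_⟩
      · refine analyticAt_const.fun_mul (AnalyticAt.log ?_ (by simpa using h4))
        exact analyticAt_const.fun_add analyticAt_id
      · rw [← intervalIntegral.integral_of_le hγ.le,
          intervalIntegral.integral_eq_sub_of_hasDerivAt
            (f := fun r => 1 / 4 * Real.log (r ^ 4 + t)) (f' := fun r => r ^ 3 / (r ^ 4 + t))]
        · simp [singPart]; ring
        · intro r _
          have : 0 < r ^ 4 + t := by positivity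
          refine ((((hasDerivAt_pow 4 r).add_const t).log this.ne').const_mul (1 / 4)).congr_deriv ?_
          simp; field_simp
        · exact (continuous_pow_div_quartic 3 ht).intervalIntegrable _ _
    | k + 4, ih =>
      obtain ⟨A, hA, h⟩ := ih k (by omega)
      refine ⟨fun t => γ ^ (k + 1) / ((k : ℝ) + 1) - t * A t,
        analyticAt_const.fun_sub (analyticAt_id.fun_mul hA), fun t ht => ?_⟩
      rw [integral_pow_div_quartic_add_four k hγ ht, h t ht, show k + 4 + 1 = k + 1 + 4 by ring,
        singPart_add_four (by omega)]
      ring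

theorem abs_lt_pow_four_eventually {γ : ℝ} (hγ : 0 < γ) : ∀ᶠ t in 𝓝 (0 : ℝ), |t| < γ ^ 4 := by
  have h4 : 0 < γ ^ 4 := by positivity
  simpa using (continuous_abs.tendsto (0 : ℝ)).eventually_lt_const (by simpa using h4)

theorem summable_mul_neg_pow {β : ℕ → ℝ} {γ : ℝ} (hβ : Summable fun l => |β l| * γ ^ (4 * l))
    {t : ℝ} (ht : |t| < γ ^ 4) : Summable fun l => β l * (-t) ^ l := by
  refine Summable.of_norm_bounded hβ fun l => ?_
  rw [norm_mul, norm_pow, norm_neg, Real.norm_eq_abs, Real.norm_eq_abs, pow_mul]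
  gcongr

theorem analyticAt_tsum_mul_neg_pow {β : ℕ → ℝ} {γ : ℝ} (hγ : 0 < γ)
    (hβ : Summable fun l => |β l| * γ ^ (4 * l)) :
    AnalyticAt ℝ (fun t => ∑' l, β l * (-t) ^ l) 0 := by
  refine analyticAt_zero_of_hasSum (a := fun l => β l * (-1) ^ l) ?_
  filter_upwards [abs_lt_pow_four_eventually hγ] with t ht
  refine (summable_mul_neg_pow hβ ht).hasSum.congr_fun fun l => ?_
  rw [neg_pow t]; ring

/-- The recursion iterated l times; the sum collects the boundary terms ∫₀^γ r^{k+4i} dr, each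
multiplied by -t once for every later iteration. -/
theorem integral_pow_div_quartic_eq_sum (k l : ℕ) {γ t : ℝ} (hγ : 0 < γ) (ht : 0 < t) :
    ∫ r in Ioc 0 γ, r ^ (k + 4 * l) / (r ^ 4 + t) =
      (-t) ^ l * (∫ r in Ioc 0 γ, r ^ k / (r ^ 4 + t)) + ∑ i ∈ Finset.range l,
        (-t) ^ (l - 1 - i) * (γ ^ (k + 4 * i + 1) / ((k : ℝ) + 4 * i + 1)) := by
  induction l with
  | zero => simp
  | succ l ih =>
    rw [show k + 4 * (l + 1) = k + 4 * l + 4 by ring, integral_pow_div_quartic_add_four _ hγ ht, ih,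
      Finset.sum_range_succ, pow_succ]
    have : ∑ i ∈ Finset.range l, (-t) ^ (l + 1 - 1 - i) *
        (γ ^ (k + 4 * i + 1) / ((k : ℝ) + 4 * i + 1)) = -t * ∑ i ∈ Finset.range l,
        (-t) ^ (l - 1 - i) * (γ ^ (k + 4 * i + 1) / ((k : ℝ) + 4 * i + 1)) := by
      rw [Finset.mul_sum]
      refine Finset.sum_congr rfl fun i hi => ?_
      have hi' := Finset.mem_range.1 hi
      rw [show l + 1 - 1 - i = (l - 1 - i) + 1 by omega, pow_succ]
      ring
    rw [this]
    push_cast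
    simp only [Nat.sub_self, pow_zero]
    ring

theorem hasSum_antidiagonal {f : ℕ × ℕ → ℝ} {s : ℝ} (h : HasSum f s) :
    HasSum (fun l => ∑ p ∈ Finset.HasAntidiagonal.antidiagonal l, f p) s := by
  rw [← Finset.HasAntidiagonal.sigmaAntidiagonalEquivProd.hasSum_iff] at h
  refine h.sigma fun l => ?_
  have := hasSum_fintype (fun c : Finset.HasAntidiagonal.antidiagonal l => f c)
  rw [Finset.sum_coe_sort (Finset.HasAntidiagonal.antidiagonal l) f] at this
  exact this

theorem summable_geometric_mul_shift {b : ℕ → ℝ} (hb0 : ∀ l, 0 ≤ b l) (hb : Summable b) {q : ℝ}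
    (hq0 : 0 ≤ q) (hq1 : q < 1) : Summable fun p : ℕ × ℕ => q ^ p.1 * b (p.1 + p.2 + 1) := by
  have hbs : ∀ j, Summable fun i => b (j + i + 1) := fun j =>
    ((summable_nat_add_iff (j + 1)).2 hb).congr fun i => by congr 1; ring
  have h0 : ∀ p : ℕ × ℕ, 0 ≤ q ^ p.1 * b (p.1 + p.2 + 1) := fun p =>
    mul_nonneg (pow_nonneg hq0 _) (hb0 _)
  refine (summable_prod_of_nonneg h0).2 ⟨fun j => (hbs j).mul_left (q ^ j), ?_⟩
  -- For fixed j the inner sum is a tail of ∑ b, hence at most the full sum; the outer sum is then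
  -- geometric.
  refine Summable.of_nonneg_of_le (fun j => tsum_nonneg fun i => h0 (j, i))
    (fun j => ?_) ((summable_geometric_of_lt_one hq0 hq1).mul_right (∑' l, b l))
  have hj : ∑' i, q ^ j * b (j + i + 1) = q ^ j * ∑' i, b (j + i + 1) := tsum_mul_left
  refine hj.trans_le ?_
  refine mul_le_mul_of_nonneg_left ?_ (pow_nonneg hq0 _)
  have h2 : ∑' i, b (j + i + 1) = ∑' i, b (i + (j + 1)) := tsum_congr fun i => by congr 1; ring
  rw [h2, ← Summable.sum_add_tsum_nat_add (j + 1) hb]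
  exact le_add_of_nonneg_left (Finset.sum_nonneg fun l _ => hb0 l)

theorem summable_shift_kernel {γ : ℝ} (hγ : 0 < γ) (k : ℕ) {β : ℕ → ℝ}
    (hβ : Summable fun l => |β l| * γ ^ (4 * l)) {t : ℝ} (ht : |t| < γ ^ 4) :
    Summable fun p : ℕ × ℕ => (-t) ^ p.1 * (β (p.1 + p.2 + 1) *
      (γ ^ (k + 4 * p.2 + 1) / ((k : ℝ) + 4 * p.2 + 1))) := by
  have h4 : 0 < γ ^ 4 := by positivity
  obtain ⟨q, hq⟩ : ∃ q, q = |t| / γ ^ 4 := ⟨_, rfl⟩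
  have hq0 : 0 ≤ q := by rw [hq]; positivity
  have hq1 : q < 1 := hq ▸ (div_lt_one h4).2 ht
  have h2 : |t| = q * γ ^ 4 := by rw [hq]; field_simp
  have hS := summable_geometric_mul_shift (fun l => by positivity) hβ hq0 hq1
  refine Summable.of_norm_bounded (hS.mul_left (γ ^ (k + 1) / γ ^ 4)) fun p => ?_
  have hd : (1 : ℝ) ≤ (k : ℝ) + 4 * p.2 + 1 := by
    have : (0 : ℝ) ≤ k + 4 * p.2 := by positivity
    linarith
  have h1 : γ ^ (k + 4 * p.2 + 1) / ((k : ℝ) + 4 * p.2 + 1) ≤ γ ^ (k + 4 * p.2 + 1) :=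
    div_le_self (by positivity) hd
  rw [norm_mul, norm_mul, norm_pow, norm_neg, Real.norm_eq_abs, Real.norm_eq_abs,
    Real.norm_of_nonneg (by positivity)]
  refine (mul_le_mul_of_nonneg_left (mul_le_mul_of_nonneg_left h1 (abs_nonneg _))
    (by positivity)).trans (le_of_eq ?_)
  rw [h2, mul_pow, show 4 * (p.1 + p.2 + 1) = 4 * p.1 + (4 * p.2 + 4) by ring,
    show k + 4 * p.2 + 1 = (k + 1) + 4 * p.2 by ring, pow_add, pow_add, pow_add, pow_add, pow_mul, pow_mul]
  field_simp

/-- Summing the iterated recursion against β, the boundary terms form a double series in (j, i) with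
l = j + i + 1. Summed along antidiagonals it gives the series over l; summed over i first it is a
power series in t, hence analytic. -/
theorem exists_analyticAt_hasSum_quartic {γ : ℝ} (hγ : 0 < γ) (k : ℕ) {β : ℕ → ℝ}
    (hβ : Summable fun l => |β l| * γ ^ (4 * l)) :
    ∃ A : ℝ → ℝ, AnalyticAt ℝ A 0 ∧ ∀ᶠ t in 𝓝[>] (0 : ℝ),
      HasSum (fun l => β l * ∫ r in Ioc 0 γ, r ^ (k + 4 * l) / (r ^ 4 + t))
        ((∑' l, β l * (-t) ^ l) * (∫ r in Ioc 0 γ, r ^ k / (r ^ 4 + t)) + A t) := by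
  refine ⟨fun t => ∑' p : ℕ × ℕ, (-t) ^ p.1 * (β (p.1 + p.2 + 1) *
      (γ ^ (k + 4 * p.2 + 1) / ((k : ℝ) + 4 * p.2 + 1))), ?_, ?_⟩
  · refine analyticAt_zero_of_hasSum (a := fun j => (-1) ^ j * ∑' i : ℕ, β (j + i + 1) *
      (γ ^ (k + 4 * i + 1) / ((k : ℝ) + 4 * i + 1))) ?_
    filter_upwards [abs_lt_pow_four_eventually hγ] with t ht
    have hs := summable_shift_kernel hγ k hβ ht
    have := hs.hasSum.prod_fiberwise (fun j => (hs.prod_factor j).hasSum)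
    refine this.congr_fun fun j => ?_
    simp only
    rw [tsum_mul_left, neg_pow t]; ring
  · filter_upwards [(abs_lt_pow_four_eventually hγ).filter_mono nhdsWithin_le_nhds,
      self_mem_nhdsWithin] with t ht (ht0 : 0 < t)
    have h2 := hasSum_antidiagonal (summable_shift_kernel hγ k hβ ht).hasSum
    -- The term l = 0 has an empty boundary sum, so the antidiagonal index is l - 1.
    have h3 := (hasSum_nat_add_iff' (f := fun l => β l * ∑ i ∈ Finset.range l,
        (-t) ^ (l - 1 - i) * (γ ^ (k + 4 * i + 1) / ((k : ℝ) + 4 * i + 1))) 1).1 (by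
      simp only [Finset.range_one, Finset.sum_singleton, Finset.range_zero, Finset.sum_empty,
        mul_zero, sub_zero]
      refine h2.congr_fun fun l => ?_
      rw [Finset.Nat.sum_antidiagonal_eq_sum_range_succ_mk, Finset.mul_sum,
        ← Finset.sum_range_reflect]
      refine Finset.sum_congr rfl fun i hi => ?_
      have hi' := Finset.mem_range.1 hi
      have a1 : l - (l - i) = i := by omega
      have a3 : i + (l - i) + 1 = l + 1 := by omega
      simp only [Nat.add_sub_cancel, a1, a3]; ring)
    refine (((summable_mul_neg_pow hβ ht).hasSum.mul_right
      (∫ r in Ioc 0 γ, r ^ k / (r ^ 4 + t))).add h3).congr_fun fun l => ?_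
    rw [integral_pow_div_quartic_eq_sum k l hγ ht0]
    ring

theorem hasSum_integral_series_div_quartic {γ : ℝ} (k : ℕ) {b : ℕ → ℝ}
    (hb : Summable fun j => |b j| * γ ^ (2 * j)) {t : ℝ} (ht : 0 < t) :
    HasSum (fun j => b j * ∫ r in Ioc 0 γ, r ^ (k + 2 * j) / (r ^ 4 + t))
      (∫ r in Ioc 0 γ, (∑' j, b j * r ^ (k + 2 * j)) / (r ^ 4 + t)) := by
  have hintg : ∀ j, IntegrableOn (fun r : ℝ => b j * (r ^ (k + 2 * j) / (r ^ 4 + t))) (Ioc 0 γ) :=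
    fun j => (integrableOn_pow_div_quartic (k + 2 * j) γ ht).const_mul (b j)
  have hsum : Summable fun j => ∫ r in Ioc 0 γ, ‖b j * (r ^ (k + 2 * j) / (r ^ 4 + t))‖ := by
    refine Summable.of_nonneg_of_le (fun j => integral_nonneg fun r => norm_nonneg _) (fun j => ?_)
      (hb.mul_right (∫ r in Ioc 0 γ, r ^ k / (r ^ 4 + t)))
    rw [← integral_const_mul]
    refine setIntegral_mono_on (hintg j).norm ((integrableOn_pow_div_quartic k γ ht).const_mul _)
      measurableSet_Ioc fun r hr => ?_
    have hr0 : 0 < r := hr.1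
    have : r ^ (2 * j) ≤ γ ^ (2 * j) := by gcongr; exact hr.2
    rw [norm_mul, Real.norm_of_nonneg (by positivity : 0 ≤ r ^ (k + 2 * j) / (r ^ 4 + t)),
      Real.norm_eq_abs, pow_add]
    calc |b j| * (r ^ k * r ^ (2 * j) / (r ^ 4 + t))
        = |b j| * r ^ (2 * j) * (r ^ k / (r ^ 4 + t)) := by ring
      _ ≤ _ := by gcongr
  have hmain := hasSum_integral_of_summable_integral_norm hintg hsum
  have e : ∫ r in Ioc 0 γ, ∑' j, b j * (r ^ (k + 2 * j) / (r ^ 4 + t)) =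
      ∫ r in Ioc 0 γ, (∑' j, b j * r ^ (k + 2 * j)) / (r ^ 4 + t) := by
    refine setIntegral_congr_fun measurableSet_Ioc fun r _ => ?_
    simp only [← mul_div_assoc]
    rw [tsum_div_const]
  rw [e] at hmain
  exact hmain.congr_fun fun j => (integral_const_mul _ _).symm

/-- The exponents N - 1 + 2j fall into two classes modulo 4: j = 2l yields φ S_N and j = 2l + 1
yields ψ S_{N+2}. Only even-indexed coefficients enter φ, so φ(0) = b 0. -/
theorem exists_radial_decomposition {γ : ℝ} (hγ : 0 < γ) {N : ℕ} (hN : 1 ≤ N) {b : ℕ → ℝ}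
    (hb : Summable fun j => |b j| * γ ^ (2 * j)) :
    ∃ A φ ψ : ℝ → ℝ, AnalyticAt ℝ A 0 ∧ AnalyticAt ℝ φ 0 ∧ AnalyticAt ℝ ψ 0 ∧ φ 0 = b 0 ∧
      ∀ᶠ t in 𝓝[>] (0 : ℝ),
        ∫ r in Ioc 0 γ, (∑' j, b j * r ^ (N - 1 + 2 * j)) / (r ^ 4 + t) =
          A t + φ t * singPart N t + ψ t * singPart (N + 2) t := by
  obtain ⟨n, rfl⟩ := Nat.exists_eq_add_of_le' hN
  have he : Summable fun l => |b (2 * l)| * γ ^ (4 * l) := by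
    refine (hb.comp_injective (i := fun l => 2 * l) (fun a b h => by simpa using h)).congr fun l => ?_
    simp only [Function.comp_apply]; congr 2; ring
  have ho : Summable fun l => |b (2 * l + 1)| * γ ^ (4 * l) := by
    refine ((hb.comp_injective (i := fun l => 2 * l + 1)
      (fun a b h => by simpa using h)).mul_right (γ ^ 2)⁻¹).congr fun l => ?_
    simp only [Function.comp_apply]
    rw [show 2 * (2 * l + 1) = 4 * l + 2 by ring, pow_add]
    field_simp
  obtain ⟨A₁, hA₁, h₁⟩ := exists_analyticAt_hasSum_quartic hγ n he
  obtain ⟨A₂, hA₂, h₂⟩ := exists_analyticAt_hasSum_quartic hγ (n + 2) ho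
  obtain ⟨B₁, hB₁, g₁⟩ := exists_analyticAt_integral_pow_div_quartic hγ n
  obtain ⟨B₂, hB₂, g₂⟩ := exists_analyticAt_integral_pow_div_quartic hγ (n + 2)
  have hφ := analyticAt_tsum_mul_neg_pow hγ he
  have hψ := analyticAt_tsum_mul_neg_pow hγ ho
  refine ⟨fun t => A₁ t + A₂ t + (∑' l, b (2 * l) * (-t) ^ l) * B₁ t +
      (∑' l, b (2 * l + 1) * (-t) ^ l) * B₂ t, _, _,
    ((hA₁.fun_add hA₂).fun_add (hφ.fun_mul hB₁)).fun_add (hψ.fun_mul hB₂), hφ, hψ, ?_, ?_⟩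
  · have := hasSum_zero_pow_mul (fun l => b (2 * l))
    simpa using this.tsum_eq
  · filter_upwards [h₁, h₂, self_mem_nhdsWithin] with t e₁ e₂ (ht : 0 < t)
    rw [g₁ t ht] at e₁
    rw [g₂ t ht] at e₂
    have htot := HasSum.even_add_odd
      (f := fun j => b j * ∫ r in Ioc 0 γ, r ^ (n + 2 * j) / (r ^ 4 + t))
      (e₁.congr_fun fun l => by rw [show n + 2 * (2 * l) = n + 4 * l by ring])
      (e₂.congr_fun fun l => by rw [show n + 2 * (2 * l + 1) = n + 2 + 4 * l by ring])
    simp only [Nat.add_sub_cancel]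
    rw [(hasSum_integral_series_div_quartic n hb ht).unique htot]
    rw [show n + 1 + 2 = n + 2 + 1 by ring]
    ring

/-! ### Analyticity and evenness of |v|² -/

/-- The Euclidean length of a lattice point. -/
def latticeNorm {d : ℕ} (x : Fin d → ℤ) : ℝ := Real.sqrt (∑ i, (x i : ℝ) ^ 2)

theorem latticeNorm_nonneg {d : ℕ} (x : Fin d → ℤ) : 0 ≤ latticeNorm x := Real.sqrt_nonneg _

theorem abs_le_latticeNorm {d : ℕ} (x : Fin d → ℤ) (i : Fin d) : |(x i : ℝ)| ≤ latticeNorm x :=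
  Real.abs_le_sqrt (Finset.single_le_sum (f := fun i => (x i : ℝ) ^ 2)
    (fun _ _ => sq_nonneg _) (Finset.mem_univ i))

theorem summable_prod_pi {d : ℕ} {f : ℤ → ℝ} (hf0 : ∀ k, 0 ≤ f k) (hf : Summable f) :
    Summable fun x : Fin d → ℤ => ∏ i, f (x i) := by
  refine summable_of_sum_le (c := (∑' k, f k) ^ d)
    (fun x => Finset.prod_nonneg fun i _ => hf0 _) fun s => ?_
  let t : Fin d → Finset ℤ := fun i => s.image fun x => x i
  have hs : s ⊆ Fintype.piFinset t := fun x hx =>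
    Fintype.mem_piFinset.2 fun i => Finset.mem_image_of_mem _ hx
  calc ∑ x ∈ s, ∏ i, f (x i) ≤ ∑ x ∈ Fintype.piFinset t, ∏ i, f (x i) :=
        Finset.sum_le_sum_of_subset_of_nonneg hs fun x _ _ => Finset.prod_nonneg fun i _ => hf0 _
    _ = ∏ i, ∑ k ∈ t i, f k := (Finset.prod_univ_sum t fun _ k => f k).symm
    _ ≤ ∏ _i : Fin d, ∑' k, f k := by
        refine Finset.prod_le_prod (fun i _ => Finset.sum_nonneg fun k _ => hf0 k) fun i _ => ?_
        exact hf.sum_le_tsum _ fun k _ => hf0 k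
    _ = _ := by simp

theorem summable_exp_neg_mul_abs {b : ℝ} (hb : 0 < b) :
    Summable fun k : ℤ => Real.exp (-b * |(k : ℝ)|) := by
  have h : Summable fun n : ℕ => Real.exp (-b * n) := by
    have := Real.summable_exp_nat_mul_iff (a := -b) |>.2 (by linarith)
    simpa [mul_comm] using this
  refine Summable.of_nat_of_neg ?_ ?_
  · simpa using h
  · simpa using h

theorem summable_exp_neg_latticeNorm {d : ℕ} {b : ℝ} (hb : 0 < b) :
    Summable fun x : Fin d → ℤ => Real.exp (-b * latticeNorm x) := by
  -- The comparison with a product uses |x| ≥ (1/d) ∑ |x_i|, hence d > 0.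
  rcases Nat.eq_zero_or_pos d with rfl | hd
  · exact Summable.of_finite
  have hd' : (0 : ℝ) < d := by exact_mod_cast hd
  refine Summable.of_nonneg_of_le (fun _ => (Real.exp_pos _).le) (fun x => ?_)
    (summable_prod_pi (fun _ => (Real.exp_pos _).le) (summable_exp_neg_mul_abs (div_pos hb hd')))
  rw [← Real.exp_sum, Real.exp_le_exp, ← Finset.mul_sum]
  have : ∑ i, |(x i : ℝ)| ≤ d * latticeNorm x := by
    simpa using Finset.sum_le_sum fun i (_ : i ∈ Finset.univ) => abs_le_latticeNorm x i
  rw [neg_mul, neg_mul, neg_le_neg_iff]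
  calc b / d * ∑ i, |(x i : ℝ)| ≤ b / d * (d * latticeNorm x) := by gcongr
    _ = b * latticeNorm x := by field_simp

/-- Half of the decay rate is spent on summability; the other half leaves an exponential weight, and
ρ will bound the radius of convergence of v at 0 from below. -/
theorem ExpDecay.exists_summable {d : ℕ} {vhat : (Fin d → ℤ) → ℝ} (h : ExpDecay vhat) :
    ∃ ρ : ℝ, 0 < ρ ∧ Summable fun x => |vhat x| * Real.exp (latticeNorm x * ρ) := by
  obtain ⟨C, a, hC, ha, h⟩ := h
  refine ⟨a / 2, by positivity, ?_⟩
  refine Summable.of_nonneg_of_le (fun x => by positivity) (fun x => ?_)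
    ((summable_exp_neg_latticeNorm (d := d) (half_pos ha)).mul_left C)
  calc |vhat x| * Real.exp (latticeNorm x * (a / 2))
      ≤ C * Real.exp (-a * latticeNorm x) * Real.exp (latticeNorm x * (a / 2)) := by
        gcongr; exact h x
    _ = _ := by rw [mul_assoc, ← Real.exp_add]; congr 2; ring

theorem ExpDecay.summable_abs {d : ℕ} {vhat : (Fin d → ℤ) → ℝ} (h : ExpDecay vhat) :
    Summable fun x => |vhat x| := by
  obtain ⟨ρ, hρ, hs⟩ := h.exists_summable
  refine Summable.of_nonneg_of_le (fun x => abs_nonneg _) (fun x => ?_) hs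
  have : 1 ≤ Real.exp (latticeNorm x * ρ) :=
    Real.one_le_exp (mul_nonneg (latticeNorm_nonneg x) hρ.le)
  exact le_mul_of_one_le_right (abs_nonneg _) this

/-- The functional `p ↦ x · p`. -/
def phase {d : ℕ} (x : Fin d → ℤ) : Mom d →L[ℝ] ℝ :=
  innerSL ℝ (WithLp.toLp 2 fun i => (x i : ℝ))

theorem phase_apply {d : ℕ} (x : Fin d → ℤ) (p : Mom d) : phase x p = ∑ i, (x i : ℝ) * p i := by
  simp [phase, PiLp.inner_apply, mul_comm]

theorem norm_phase {d : ℕ} (x : Fin d → ℤ) : ‖phase x‖ = latticeNorm x := by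
  simp [phase, EuclideanSpace.norm_eq, latticeNorm]

/-- The un-normalised Fourier series of `v̂`. -/
def fourierSeries {d : ℕ} (vhat : (Fin d → ℤ) → ℝ) (p : Mom d) : ℂ :=
  ∑' x, (vhat x : ℂ) * Complex.exp (Complex.I * (phase x p : ℂ))

theorem v_eq {d : ℕ} (vhat : (Fin d → ℤ) → ℝ) (p : Mom d) :
    v vhat p = (((2 * π) ^ (-(d : ℝ) / 2) : ℝ) : ℂ) * fourierSeries vhat p := by
  simp only [v, fourierSeries, phase_apply]

theorem norm_fourier_term {d : ℕ} (vhat : (Fin d → ℤ) → ℝ) (p : Mom d) (x : Fin d → ℤ) :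
    ‖(vhat x : ℂ) * Complex.exp (Complex.I * (phase x p : ℂ))‖ = |vhat x| := by
  rw [norm_mul, mul_comm Complex.I, Complex.norm_exp_ofReal_mul_I, mul_one, Complex.norm_real,
    Real.norm_eq_abs]

theorem ExpDecay.continuous_v {d : ℕ} {vhat : (Fin d → ℤ) → ℝ} (h : ExpDecay vhat) :
    Continuous (v vhat) := by
  have : Continuous (fourierSeries vhat) :=
    continuous_tsum (fun x => by fun_prop) h.summable_abs
      fun x p => (norm_fourier_term vhat p x).le
  have h2 : v vhat = fun p => (((2 * π) ^ (-(d : ℝ) / 2) : ℝ) : ℂ) * fourierSeries vhat p :=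
    funext (v_eq vhat)
  rw [h2]
  exact continuous_const.mul this

theorem ExpDecay.exists_norm_v_le {d : ℕ} {vhat : (Fin d → ℤ) → ℝ} (h : ExpDecay vhat) :
    ∃ C, 0 ≤ C ∧ ∀ p, ‖v vhat p‖ ≤ C := by
  refine ⟨(2 * π) ^ (-(d : ℝ) / 2) * ∑' x, |vhat x|, by positivity, fun p => ?_⟩
  rw [v_eq, norm_mul, Complex.norm_real, Real.norm_of_nonneg (by positivity)]
  gcongr
  exact tsum_of_norm_bounded h.summable_abs.hasSum fun x => (norm_fourier_term vhat p x).le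

/-- Because v̂ is real, v(-p) is the conjugate of v(p). The evenness is what leaves only powers
r^{2j} in spherical means and makes odd differentials of |v|² vanish at 0. -/
theorem vSq_neg {d : ℕ} (vhat : (Fin d → ℤ) → ℝ) (p : Mom d) : vSq vhat (-p) = vSq vhat p := by
  have : fourierSeries vhat (-p) = (starRingEnd ℂ) (fourierSeries vhat p) := by
    rw [fourierSeries, fourierSeries, Complex.conj_tsum]
    refine tsum_congr fun x => ?_
    rw [map_mul, Complex.conj_ofReal, ← Complex.exp_conj, map_mul, Complex.conj_I,
      Complex.conj_ofReal, map_neg]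
    push_cast
    ring_nf
  rw [vSq, vSq, v_eq, v_eq, this, norm_mul, norm_mul, RCLike.norm_conj]

/-- The power series at the origin of `p ↦ v̂(x) e^{i x·p}`. -/
def fourierTermSeries {d : ℕ} (vhat : (Fin d → ℤ) → ℝ) (x : Fin d → ℤ) (n : ℕ) :
    ContinuousMultilinearMap ℝ (fun _ : Fin n => Mom d) ℂ :=
  ((vhat x : ℂ) * Complex.I ^ n / (n.factorial : ℂ)) •
    (ContinuousMultilinearMap.mkPiAlgebraFin ℝ n ℂ).compContinuousLinearMap
      fun _ => Complex.ofRealCLM.comp (phase x)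

theorem fourierTermSeries_apply_diag {d : ℕ} (vhat : (Fin d → ℤ) → ℝ) (x : Fin d → ℤ) (n : ℕ)
    (p : Mom d) : fourierTermSeries vhat x n (fun _ => p) =
      (vhat x : ℂ) * ((Complex.I * (phase x p : ℂ)) ^ n / (n.factorial : ℂ)) := by
  simp [fourierTermSeries, mul_pow]
  ring

theorem norm_fourierTermSeries_le {d : ℕ} (vhat : (Fin d → ℤ) → ℝ) (x : Fin d → ℤ) (n : ℕ) :
    ‖fourierTermSeries vhat x n‖ ≤ |vhat x| * (latticeNorm x ^ n / n.factorial) := by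
  rw [fourierTermSeries, norm_smul]
  have h1 : ‖(vhat x : ℂ) * Complex.I ^ n / (n.factorial : ℂ)‖ = |vhat x| / n.factorial := by
    simp
  have h2 : ‖Complex.ofRealCLM.comp (phase x)‖ ≤ latticeNorm x := by
    refine (ContinuousLinearMap.opNorm_comp_le _ _).trans ?_
    rw [Complex.ofRealCLM_norm, one_mul, norm_phase]
  have h3 : ‖(ContinuousMultilinearMap.mkPiAlgebraFin ℝ n ℂ).compContinuousLinearMap
      fun _ => Complex.ofRealCLM.comp (phase x)‖ ≤ latticeNorm x ^ n := by
    refine (ContinuousMultilinearMap.norm_compContinuousLinearMap_le _ _).trans ?_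
    rw [ContinuousMultilinearMap.norm_mkPiAlgebraFin, one_mul, Finset.prod_const, Finset.card_univ,
      Fintype.card_fin]
    gcongr
  rw [h1]
  calc _ ≤ |vhat x| / n.factorial * latticeNorm x ^ n := by gcongr
    _ = _ := by ring

/-- Each exponential is expanded at 0 and the sums over x and n are exchanged. The double series is
dominated by |v̂(x)| (|x|ρ)^n / n!, whose sum over n is |v̂(x)| e^{|x|ρ}. -/
theorem ExpDecay.analyticAt_fourierSeries {d : ℕ} {vhat : (Fin d → ℤ) → ℝ} (h : ExpDecay vhat) :
    AnalyticAt ℝ (fourierSeries vhat) 0 := by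
  obtain ⟨ρ, hρ, hs⟩ := h.exists_summable
  have hexp : ∀ (x : Fin d → ℤ) (y : ℝ),
      HasSum (fun n : ℕ => |vhat x| * ((latticeNorm x * y) ^ n / n.factorial))
        (|vhat x| * Real.exp (latticeNorm x * y)) := fun x y => by
    have := NormedSpace.expSeries_div_hasSum_exp (latticeNorm x * y)
    rw [← Real.exp_eq_exp_ℝ] at this
    exact this.mul_left _
  have hS : Summable fun q : (Fin d → ℤ) × ℕ =>
      |vhat q.1| * ((latticeNorm q.1 * ρ) ^ q.2 / q.2.factorial) := by
    have h0 : ∀ q : (Fin d → ℤ) × ℕ, 0 ≤ |vhat q.1| * ((latticeNorm q.1 * ρ) ^ q.2 / q.2.factorial) :=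
      fun q => by have := latticeNorm_nonneg q.1; positivity
    refine (summable_prod_of_nonneg h0).2 ⟨fun x => (hexp x ρ).summable, ?_⟩
    exact hs.congr fun x => (hexp x ρ).tsum_eq.symm
  have hbd : ∀ q : (Fin d → ℤ) × ℕ, ‖fourierTermSeries vhat q.1 q.2‖ * ρ ^ q.2 ≤
      |vhat q.1| * ((latticeNorm q.1 * ρ) ^ q.2 / q.2.factorial) := fun q => by
    calc _ ≤ |vhat q.1| * (latticeNorm q.1 ^ q.2 / q.2.factorial) * ρ ^ q.2 := by
          gcongr; exact norm_fourierTermSeries_le vhat q.1 q.2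
      _ = _ := by rw [mul_pow]; ring
  have hSn : ∀ n : ℕ, Summable fun x =>
      |vhat x| * ((latticeNorm x * ρ) ^ n / n.factorial) := fun n => by
    have := hS.prod_symm.prod_factor n
    exact this
  have hsn : ∀ n : ℕ, Summable fun x => ‖fourierTermSeries vhat x n‖ := fun n => by
    refine Summable.of_nonneg_of_le (fun _ => norm_nonneg _) (fun x => ?_)
      ((hSn n).mul_right ((ρ ^ n)⁻¹))
    rw [← div_eq_mul_inv, le_div_iff₀ (by positivity)]
    exact hbd (x, n)
  refine ⟨fun n => ∑' x, fourierTermSeries vhat x n, ENNReal.ofReal ρ, ?_, by simpa using hρ, ?_⟩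
  · refine FormalMultilinearSeries.le_radius_of_bound _
      (∑' x, |vhat x| * Real.exp (latticeNorm x * ρ)) fun n => ?_
    rw [Real.coe_toNNReal _ hρ.le]
    calc ‖∑' x, fourierTermSeries vhat x n‖ * ρ ^ n
        ≤ (∑' x, ‖fourierTermSeries vhat x n‖) * ρ ^ n := by
          gcongr; exact norm_tsum_le_tsum_norm (hsn n)
      _ = ∑' x, ‖fourierTermSeries vhat x n‖ * ρ ^ n := tsum_mul_right.symm
      _ ≤ ∑' x, |vhat x| * ((latticeNorm x * ρ) ^ n / n.factorial) :=
          Summable.tsum_le_tsum (fun x => hbd (x, n)) ((hsn n).mul_right _) (hSn n)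
      _ ≤ _ := by
          refine Summable.tsum_le_tsum (fun x => ?_) (hSn n) hs
          exact (hexp x ρ).summable.le_tsum n (fun j _ => by
            have := latticeNorm_nonneg x; positivity) |>.trans_eq (hexp x ρ).tsum_eq
  · intro y hy
    have hyρ : ‖y‖ < ρ := by
      simpa [← ofReal_norm, ENNReal.ofReal_lt_ofReal_iff hρ] using hy
    rw [zero_add]
    have hF : Summable fun q : (Fin d → ℤ) × ℕ => fourierTermSeries vhat q.1 q.2 fun _ => y := by
      refine Summable.of_norm_bounded hS fun q => ?_
      refine le_trans ?_ (hbd q)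
      refine ((fourierTermSeries vhat q.1 q.2).le_opNorm _).trans ?_
      rw [Finset.prod_const, Finset.card_univ, Fintype.card_fin]
      gcongr
    have h1 := hF.hasSum.prod_fiberwise (fun x => by
      have := (NormedSpace.expSeries_div_hasSum_exp (Complex.I * (phase x y : ℂ))).mul_left
        (vhat x : ℂ)
      rw [← Complex.exp_eq_exp_ℂ] at this
      exact this.congr_fun fun n => fourierTermSeries_apply_diag vhat x n y)
    have h2 : HasSum (fun q : ℕ × (Fin d → ℤ) => fourierTermSeries vhat q.2 q.1 fun _ => y)
        (fourierSeries vhat y) := by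
      have := (Equiv.prodComm ℕ (Fin d → ℤ)).hasSum_iff.2 hF.hasSum
      rw [← h1.tsum_eq] at this
      exact this
    refine h2.prod_fiberwise fun n => ?_
    have h3 := (hsn n).of_norm.hasSum
    exact h3.mapL (ContinuousMultilinearMap.apply ℝ (fun _ : Fin n => Mom d) ℂ fun _ => y)

theorem ExpDecay.analyticAt_vSq {d : ℕ} {vhat : (Fin d → ℤ) → ℝ} (h : ExpDecay vhat) :
    AnalyticAt ℝ (vSq vhat) 0 := by
  have hv : AnalyticAt ℝ (v vhat) 0 := by
    have h2 : v vhat = fun p => (((2 * π) ^ (-(d : ℝ) / 2) : ℝ) : ℂ) * fourierSeries vhat p :=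
      funext (v_eq vhat)
    rw [h2]
    exact analyticAt_const.fun_mul h.analyticAt_fourierSeries
  have hre : AnalyticAt ℝ (fun p => (v vhat p).re) 0 :=
    (Complex.reCLM.analyticAt _).comp hv
  have him : AnalyticAt ℝ (fun p => (v vhat p).im) 0 :=
    (Complex.imCLM.analyticAt _).comp hv
  have h2 : vSq vhat = fun p => (v vhat p).re * (v vhat p).re + (v vhat p).im * (v vhat p).im := by
    ext p
    rw [vSq, Complex.sq_norm, Complex.normSq_apply]
  rw [h2]
  exact (hre.fun_mul hre).fun_add (him.fun_mul him)

end LatticeBilaplacian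

/-! ### Restriction to rays and polarization -/

theorem HasFPowerSeriesAt.eventually_hasSum_ray {E : Type*} [NormedAddCommGroup E]
    [NormedSpace ℝ E] {f : E → ℝ} {p : FormalMultilinearSeries ℝ E ℝ}
    (hp : HasFPowerSeriesAt f p 0) (w : E) :
    ∀ᶠ r in 𝓝 (0 : ℝ), HasSum (fun n => p n (fun _ => w) * r ^ n) (f (r • w)) := by
  have ht : Tendsto (fun r : ℝ => r • w) (𝓝 0) (𝓝 0) := by
    have : Continuous fun r : ℝ => r • w := by fun_prop
    simpa using this.tendsto 0
  filter_upwards [ht.eventually hp.eventually_hasSum] with r hr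
  rw [zero_add] at hr
  refine hr.congr_fun fun n => ?_
  have := (p n).map_smul_univ (fun _ => r) (fun _ => w)
  simp only [Finset.prod_const, Finset.card_univ, Fintype.card_fin, smul_eq_mul] at this
  rw [this, mul_comm]

/-- Polarization without an explicit formula: if the degree-n term p_n vanishes on the diagonal,
then p_n alone is a power series of the zero function. The n-th derivative is the same
symmetrization of p_n for both functions, hence zero. -/
theorem iteratedFDeriv_eq_zero_of_diag {E : Type*} [NormedAddCommGroup E] [NormedSpace ℝ E]
    {f : E → ℝ} (hf : AnalyticAt ℝ f 0) {n : ℕ}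
    (h : ∀ w, iteratedFDeriv ℝ n f 0 (fun _ => w) = 0) : iteratedFDeriv ℝ n f 0 = 0 := by
  obtain ⟨p, r, hp⟩ := hf
  have hdiag : ∀ w, p n (fun _ => w) = 0 := fun w => by
    have := hp.factorial_smul w n
    rw [h, nsmul_eq_mul] at this
    simpa [Nat.factorial_ne_zero] using this
  let p' : FormalMultilinearSeries ℝ E ℝ := fun k => if k = n then p k else 0
  have hp' : HasFPowerSeriesOnBall (fun _ : E => (0 : ℝ)) p' 0 r := by
    refine ⟨hp.r_le.trans ?_, hp.r_pos, fun {y} _ => ?_⟩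
    · refine FormalMultilinearSeries.radius_le_of_le fun k => ?_
      by_cases hk : k = n <;> simp [p', hk]
    · have : ∀ k, p' k (fun _ => y) = 0 := fun k => by
        by_cases hk : k = n
        · subst hk; simpa [p'] using hdiag y
        · simp [p', hk]
      simp only [this]
      exact hasSum_zero
  ext w
  rw [hp.iteratedFDeriv_eq_sum_of_completeSpace w]
  have := hp'.iteratedFDeriv_eq_sum_of_completeSpace (n := n) w
  simp only [p', if_true] at this
  rw [← this]
  have h0 : (fun _ : E => (0 : ℝ)) = 0 := rfl
  simp

/-! ### The leading Taylor form and positivity of c_v -/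

namespace LatticeBilaplacian

/-- The leading Taylor form of `|v|²` at the origin. -/
def leadingForm {d : ℕ} (vhat : (Fin d → ℤ) → ℝ) (n : ℕ) (w : Mom d) : ℝ :=
  iteratedFDeriv ℝ (2 * n) (vSq vhat) 0 (fun _ => w) / ((2 * n).factorial : ℝ)

theorem continuous_leadingForm {d : ℕ} (vhat : (Fin d → ℤ) → ℝ) (n : ℕ) :
    Continuous (leadingForm vhat n) := by
  unfold leadingForm
  refine Continuous.div_const ?_ _
  exact (iteratedFDeriv ℝ (2 * n) (vSq vhat) 0).cont.comp (by fun_prop)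

theorem leadingForm_smul {d : ℕ} (vhat : (Fin d → ℤ) → ℝ) (n : ℕ) (r : ℝ) (w : Mom d) :
    leadingForm vhat n (r • w) = r ^ (2 * n) * leadingForm vhat n w := by
  have := (iteratedFDeriv ℝ (2 * n) (vSq vhat) 0).map_smul_univ (fun _ => r) (fun _ => w)
  simp only [Finset.prod_const, Finset.card_univ, Fintype.card_fin, smul_eq_mul] at this
  rw [leadingForm, this, leadingForm, mul_div_assoc]

/-- Terms of degree below 2n₀ vanish: the odd ones by evenness, the even ones by hypothesis. General
curves c(r) ~ r u are allowed, and not only rays, because the later change of variables bends rays.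
-/
theorem tendsto_vSq_div_pow {d : ℕ} {vhat : (Fin d → ℤ) → ℝ} (hv : ExpDecay vhat) {n₀ : ℕ}
    (hvanish : ∀ j < n₀, iteratedFDeriv ℝ (2 * j) (vSq vhat) 0 = 0) {c : ℝ → Mom d} {u : Mom d}
    (hc : Tendsto (fun r : ℝ => r⁻¹ • c r) (𝓝[>] 0) (𝓝 u)) :
    Tendsto (fun r => vSq vhat (c r) / r ^ (2 * n₀)) (𝓝[>] 0) (𝓝 (leadingForm vhat n₀ u)) := by
  obtain ⟨p, hp⟩ := hv.analyticAt_vSq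
  have hdiag : ∀ n w, p n (fun _ => w) =
      iteratedFDeriv ℝ n (vSq vhat) 0 (fun _ => w) / (n.factorial : ℝ) := fun n w => by
    obtain ⟨r, hpr⟩ := hp
    rw [← hpr.factorial_smul w n, nsmul_eq_mul]
    have : (n.factorial : ℝ) ≠ 0 := by exact_mod_cast n.factorial_ne_zero
    field_simp
  have hlow : ∀ n < 2 * n₀, ∀ w, p n (fun _ => w) = 0 := by
    intro n hn w
    rcases Nat.even_or_odd n with he | ho
    · obtain ⟨j, hj⟩ := he.two_dvd
      subst hj
      rw [hdiag, hvanish j (by omega)]; simp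
    · exact coeff_odd_eq_zero (hp.eventually_hasSum_ray w)
        (fun z => by rw [neg_smul, vSq_neg]) ho
  have hps : ∀ y, p.partialSum (2 * n₀ + 1) y = leadingForm vhat n₀ y := fun y => by
    rw [FormalMultilinearSeries.partialSum, Finset.sum_range_succ,
      Finset.sum_eq_zero (fun n hn => hlow n (Finset.mem_range.1 hn) y), zero_add, hdiag,
      leadingForm]
  have hcr : ∀ᶠ r in 𝓝[>] (0 : ℝ), c r = r • (r⁻¹ • c r) := by
    filter_upwards [self_mem_nhdsWithin] with r (hr : 0 < r)
    rw [smul_smul, mul_inv_cancel₀ hr.ne', one_smul]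
  have hr0 : Tendsto (fun r : ℝ => r) (𝓝[>] 0) (𝓝 0) := nhdsWithin_le_nhds
  have hc0 : Tendsto c (𝓝[>] 0) (𝓝 0) := by
    have := hr0.smul hc
    rw [zero_smul] at this
    exact this.congr' (hcr.mono fun r hr => hr.symm)
  have hO := (hp.isBigO_sub_partialSum_pow (2 * n₀ + 1)).comp_tendsto hc0
  obtain ⟨K, hK⟩ := hO.bound
  have h1 : Tendsto (fun r => leadingForm vhat n₀ (r⁻¹ • c r)) (𝓝[>] 0)
      (𝓝 (leadingForm vhat n₀ u)) :=
    ((continuous_leadingForm vhat n₀).tendsto u).comp hc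
  have h2 : Tendsto (fun r => (vSq vhat (c r) - leadingForm vhat n₀ (c r)) / r ^ (2 * n₀))
      (𝓝[>] 0) (𝓝 0) := by
    have hb : Tendsto (fun r : ℝ => K * (r * ‖r⁻¹ • c r‖ ^ (2 * n₀ + 1))) (𝓝[>] 0) (𝓝 0) := by
      simpa using (hr0.mul (hc.norm.pow (2 * n₀ + 1))).const_mul K
    refine squeeze_zero_norm' ?_ hb
    filter_upwards [hK, hcr, self_mem_nhdsWithin] with r hr1 hr2 (hr : 0 < r)
    simp only [Function.comp_apply, zero_add, hps] at hr1
    rw [norm_div, Real.norm_of_nonneg (by positivity : 0 ≤ r ^ (2 * n₀)), div_le_iff₀ (by positivity)]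
    refine hr1.trans (le_of_eq ?_)
    have : ‖c r‖ = r * ‖r⁻¹ • c r‖ := by
      rw [norm_smul, norm_inv, Real.norm_of_nonneg hr.le]; field_simp
    rw [norm_pow, norm_norm, this]; ring
  have := h1.add h2
  rw [add_zero] at this
  refine this.congr' ?_
  filter_upwards [hcr, self_mem_nhdsWithin] with r hr2 (hr : 0 < r)
  have h3 : leadingForm vhat n₀ (c r) = r ^ (2 * n₀) * leadingForm vhat n₀ (r⁻¹ • c r) := by
    rw [← leadingForm_smul, ← hr2]
  rw [h3]
  field_simp
  ring

theorem leadingForm_nonneg {d : ℕ} {vhat : (Fin d → ℤ) → ℝ} (hv : ExpDecay vhat) {n₀ : ℕ}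
    (hvanish : ∀ j < n₀, iteratedFDeriv ℝ (2 * j) (vSq vhat) 0 = 0) (w : Mom d) :
    0 ≤ leadingForm vhat n₀ w := by
  have h : Tendsto (fun r : ℝ => r⁻¹ • r • w) (𝓝[>] 0) (𝓝 w) := by
    refine tendsto_const_nhds.congr' ?_
    filter_upwards [self_mem_nhdsWithin] with r (hr : 0 < r)
    rw [smul_smul, inv_mul_cancel₀ hr.ne', one_smul]
  refine ge_of_tendsto (tendsto_vSq_div_pow hv hvanish h) ?_
  filter_upwards [self_mem_nhdsWithin] with r (hr : 0 < r)
  exact div_nonneg (sq_nonneg _) (by positivity)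

theorem exists_sphere_leadingForm_ne_zero {d : ℕ} (hd : 1 ≤ d) {vhat : (Fin d → ℤ) → ℝ}
    (hv : ExpDecay vhat) {n₀ : ℕ} (hnonvanish : iteratedFDeriv ℝ (2 * n₀) (vSq vhat) 0 ≠ 0) :
    ∃ w : Metric.sphere (0 : Mom d) 1, leadingForm vhat n₀ w ≠ 0 := by
  have : Nonempty (Fin d) := ⟨⟨0, hd⟩⟩
  by_contra! hcon
  refine hnonvanish (iteratedFDeriv_eq_zero_of_diag hv.analyticAt_vSq ?_)
  -- Homogeneity settles w ≠ 0 only: for n₀ = 0 it says nothing at the origin, which is reached by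
  -- continuity and density.
  have hz : ∀ w, leadingForm vhat n₀ w = 0 := by
    by_contra! hne
    obtain ⟨y, hy⟩ := hne
    have hopen : IsOpen {w | leadingForm vhat n₀ w ≠ 0} :=
      isOpen_ne_fun (continuous_leadingForm vhat n₀) continuous_const
    obtain ⟨z, hz, hz0⟩ := (dense_compl_singleton (0 : Mom d)).inter_open_nonempty _ hopen ⟨y, hy⟩
    have hz0' : ‖z‖ ≠ 0 := norm_ne_zero_iff.2 hz0
    refine hz ?_
    have := hcon ⟨‖z‖⁻¹ • z, by simp [norm_smul, hz0']⟩
    rw [show z = ‖z‖ • (‖z‖⁻¹ • z) by rw [smul_smul, mul_inv_cancel₀ hz0', one_smul],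
      leadingForm_smul, this, mul_zero]
  intro w
  have := hz w
  rw [leadingForm, div_eq_zero_iff] at this
  exact this.resolve_right (by exact_mod_cast Nat.factorial_ne_zero _)

theorem cV_eq {d : ℕ} (vhat : (Fin d → ℤ) → ℝ) (n₀ : ℕ) :
    cV vhat n₀ = 2 ^ (2 * n₀ + d) * ∫ w : Metric.sphere (0 : Mom d) 1, leadingForm vhat n₀ w
      ∂((volume : Measure (Mom d)).toSphere) := by
  simp only [cV, leadingForm]
  rw [integral_div]
  ring

/-- The integrand is continuous, nonnegative as a limit of quotients |v|²/r^{2n₀}, and nonzero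
somewhere on the sphere. -/
theorem cV_pos {d : ℕ} (hd : 1 ≤ d) {vhat : (Fin d → ℤ) → ℝ} (hv : ExpDecay vhat) {n₀ : ℕ}
    (hvanish : ∀ j < n₀, iteratedFDeriv ℝ (2 * j) (vSq vhat) 0 = 0)
    (hnonvanish : iteratedFDeriv ℝ (2 * n₀) (vSq vhat) 0 ≠ 0) : 0 < cV vhat n₀ := by
  obtain ⟨w, hw⟩ := exists_sphere_leadingForm_ne_zero hd hv hnonvanish
  rw [cV_eq]
  refine mul_pos (by positivity) ?_
  have hcont : Continuous fun w : Metric.sphere (0 : Mom d) 1 => leadingForm vhat n₀ w :=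
    (continuous_leadingForm vhat n₀).comp continuous_subtype_val
  exact hcont.integral_pos_of_hasCompactSupport_nonneg_nonzero
    (HasCompactSupport.of_compactSpace _) (fun w => leadingForm_nonneg hv hvanish _) hw

/-! ### The substitution that turns 𝔢 into |y|⁴ -/

/-- The one-dimensional change of variables `u = √2 sin (p / 2)`, solved for `p`. -/
def angle (u : ℝ) : ℝ := 2 * Real.arcsin (u / √2)

/-- The derivative of `angle`. -/
def angleDeriv (u : ℝ) : ℝ := 2 * (1 / √(1 - (u / √2) ^ 2) * (1 / √2))

theorem hasDerivAt_angle {u : ℝ} (hu : |u| < √2) : HasDerivAt angle (angleDeriv u) u := by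
  have h2 : 0 < √2 := by positivity
  have h1 : |u / √2| < 1 := by rw [abs_div, abs_of_pos h2]; exact (div_lt_one h2).2 hu
  have h3 := abs_lt.1 h1
  exact ((Real.hasDerivAt_arcsin h3.1.ne' h3.2.ne).comp u
    ((hasDerivAt_id u).div_const √2)).const_mul 2

theorem angle_zero : angle 0 = 0 := by simp [angle]

theorem angleDeriv_zero : angleDeriv 0 = √2 := by
  have : √2 ≠ 0 := by positivity
  simp only [angleDeriv, zero_div, ne_eq, OfNat.ofNat_ne_zero, not_false_eq_true, zero_pow,
    sub_zero, Real.sqrt_one, div_one, one_mul]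
  field_simp
  exact (Real.sq_sqrt (by norm_num)).symm

theorem analyticAt_angle : AnalyticAt ℝ angle 0 := by
  have h : AnalyticAt ℝ Real.arcsin 0 := by
    have : ContDiffAt ℝ ⊤ Real.arcsin 0 := Real.contDiffAt_arcsin (by norm_num) (by norm_num)
    exact this.analyticAt
  refine analyticAt_const.fun_mul (AnalyticAt.fun_comp_of_eq h ?_ (by simp))
  exact analyticAt_id.fun_div analyticAt_const (by positivity)

theorem analyticAt_angleDeriv : AnalyticAt ℝ angleDeriv 0 := by
  have h : AnalyticAt ℝ (deriv angle) 0 := analyticAt_angle.deriv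
  refine h.congr ?_
  have : ∀ᶠ u in 𝓝 (0 : ℝ), |u| < √2 := by
    exact (continuous_abs.tendsto (0 : ℝ)).eventually_lt_const (by simp)
  filter_upwards [this] with u hu using (hasDerivAt_angle hu).deriv

theorem one_sub_cos_angle {u : ℝ} (hu : |u| ≤ √2) : 1 - Real.cos (angle u) = u ^ 2 := by
  have h2 : 0 < √2 := by positivity
  have h1 : |u / √2| ≤ 1 := by rw [abs_div, abs_of_pos h2]; exact (div_le_one h2).2 hu
  have h3 := abs_le.1 h1
  have hs := Real.sin_arcsin h3.1 h3.2
  rw [angle, Real.cos_two_mul, Real.cos_sq', hs, div_pow, Real.sq_sqrt (by norm_num)]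
  ring

theorem angle_sin {p : ℝ} (hp : p ∈ Ioc (-π) π) : angle (√2 * Real.sin (p / 2)) = p := by
  have h2 : √2 ≠ 0 := by positivity
  rw [angle, mul_div_cancel_left₀ _ h2, Real.arcsin_sin (by linarith [hp.1]) (by linarith [hp.2])]
  ring

theorem sq_sqrt_two_mul_sin (p : ℝ) : (√2 * Real.sin (p / 2)) ^ 2 = 1 - Real.cos p := by
  have : Real.cos p = 2 * Real.cos (p / 2) ^ 2 - 1 := by rw [← Real.cos_two_mul]; ring_nf
  rw [mul_pow, Real.sq_sqrt (by norm_num), Real.sin_sq, this]; ring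

theorem angle_mem_Ioc {u : ℝ} (hu : |u| < √2) : angle u ∈ Ioc (-π) π := by
  have h2 : 0 < √2 := by positivity
  have h1 : |u / √2| < 1 := by rw [abs_div, abs_of_pos h2]; exact (div_lt_one h2).2 hu
  have h3 := abs_lt.1 h1
  have h4 := Real.neg_pi_div_two_lt_arcsin.2 h3.1
  have h5 := Real.arcsin_le_pi_div_two (u / √2)
  constructor <;> simp only [angle] <;> linarith

/-- The change of variables applied to each coordinate. -/
def angles {d : ℕ} (y : Mom d) : Mom d := WithLp.toLp 2 fun i => angle (y i)

/-- The Jacobian of `angles`. -/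
def anglesJacobian {d : ℕ} (y : Mom d) : ℝ := ∏ i, angleDeriv (y i)

theorem abs_apply_lt {d : ℕ} {y : Mom d} {γ : ℝ} (hy : ‖y‖ < γ) (i : Fin d) : |y i| < γ :=
  (PiLp.norm_apply_le y i).trans_lt hy

/-- The diagonal derivative of `angles`. -/
def anglesFDeriv {d : ℕ} (y : Mom d) : Mom d →L[ℝ] Mom d :=
  LinearMap.toContinuousLinearMap
    (Matrix.toLpLin 2 2 (Matrix.diagonal fun i => angleDeriv (y i)))

theorem det_anglesFDeriv {d : ℕ} (y : Mom d) : (anglesFDeriv y).det = anglesJacobian y := by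
  rw [anglesFDeriv, LinearMap.det_toContinuousLinearMap, Matrix.toLpLin_eq_toLin,
    LinearMap.det_toLin, Matrix.det_diagonal, anglesJacobian]

theorem hasFDerivAt_angles {d : ℕ} {y : Mom d} (hy : ‖y‖ < √2) :
    HasFDerivAt angles (anglesFDeriv y) y := by
  rw [← hasFDerivWithinAt_univ, hasFDerivWithinAt_euclidean]
  intro i
  rw [hasFDerivWithinAt_univ]
  have h1 : HasFDerivAt (fun x : Mom d => x i) (PiLp.proj 2 (fun _ : Fin d => ℝ) i) y :=
    (PiLp.proj (𝕜 := ℝ) 2 (fun _ : Fin d => ℝ) i).hasFDerivAt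
  have h2 := (hasDerivAt_angle (abs_apply_lt hy i)).hasFDerivAt.comp y h1
  refine h2.congr_fderiv ?_
  ext w
  simp [anglesFDeriv, Matrix.toLpLin_apply, Matrix.mulVec_diagonal, mul_comm]

theorem sum_one_sub_cos_angles {d : ℕ} {y : Mom d} (hy : ‖y‖ < √2) :
    ∑ i, (1 - Real.cos (angles y i)) = ‖y‖ ^ 2 := by
  rw [EuclideanSpace.real_norm_sq_eq]
  exact Finset.sum_congr rfl fun i _ => one_sub_cos_angle (abs_apply_lt hy i).le

theorem disp_angles {d : ℕ} {y : Mom d} (hy : ‖y‖ < √2) : disp (angles y) = ‖y‖ ^ 4 := by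
  rw [disp, sum_one_sub_cos_angles hy]; ring

theorem injOn_angles {d : ℕ} : InjOn (angles (d := d)) (Metric.ball 0 √2) := by
  intro y hy z hz h
  have h2 : 0 < √2 := by positivity
  have hb : ∀ w ∈ Metric.ball (0 : Mom d) √2, ∀ i, w i / √2 ∈ Icc (-1 : ℝ) 1 := fun w hw i => by
    have := abs_apply_lt (mem_ball_zero_iff.1 hw) i
    refine abs_le.1 ?_
    rw [abs_div, abs_of_pos h2]; exact (div_le_one h2).2 this.le
  ext i
  have hi : angle (y i) = angle (z i) := congrArg (fun p : Mom d => p i) h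
  simp only [angle, mul_eq_mul_left_iff, OfNat.ofNat_ne_zero, or_false] at hi
  have := Real.injOn_arcsin (hb y hy i) (hb z hz i) hi
  field_simp at this
  exact this

/-- The part of the cube on which the dispersion relation is below `γ⁴`. -/
def innerCube (d : ℕ) (γ : ℝ) : Set (Mom d) :=
  {p | p ∈ cube d ∧ ∑ i, (1 - Real.cos (p i)) < γ ^ 2}

/-- Since |y|² = ∑ (1 - cos p_i), balls correspond exactly to sublevel sets of the dispersion
relation in the cube. The bound γ ≤ √2 keeps every y_i/√2 in the open interval (-1, 1), where arcsin
is smooth. -/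
theorem image_angles_ball {d : ℕ} {γ : ℝ} (hγ : 0 < γ) (hγ2 : γ ≤ √2) :
    angles '' Metric.ball (0 : Mom d) γ = innerCube d γ := by
  ext p
  constructor
  · rintro ⟨y, hy, rfl⟩
    have hy' : ‖y‖ < γ := mem_ball_zero_iff.1 hy
    refine ⟨fun i => angle_mem_Ioc ((abs_apply_lt hy' i).trans_le hγ2), ?_⟩
    rw [sum_one_sub_cos_angles (hy'.trans_le hγ2)]
    gcongr
  · rintro ⟨hp, hlt⟩
    refine ⟨WithLp.toLp 2 fun i => √2 * Real.sin (p i / 2), ?_, ?_⟩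
    · rw [mem_ball_zero_iff]
      refine lt_of_pow_lt_pow_left₀ 2 hγ.le ?_
      rw [EuclideanSpace.real_norm_sq_eq]
      simpa only [sq_sqrt_two_mul_sin] using hlt
    · ext i
      exact angle_sin (hp i)

theorem measurableSet_cube (d : ℕ) : MeasurableSet (cube d) := by
  have : cube d = ⋂ i, (fun p : Mom d => p i) ⁻¹' Ioc (-π) π := by ext; simp [cube]
  rw [this]
  exact MeasurableSet.iInter fun i => (by fun_prop : Measurable fun p : Mom d => p i) measurableSet_Ioc

theorem continuous_sum_one_sub_cos (d : ℕ) :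
    Continuous fun p : Mom d => ∑ i, (1 - Real.cos (p i)) :=
  continuous_finsetSum _ fun i _ => by fun_prop

theorem continuous_disp (d : ℕ) : Continuous (disp (d := d)) :=
  (continuous_sum_one_sub_cos d).pow 2

theorem disp_nonneg {d : ℕ} (p : Mom d) : 0 ≤ disp p := sq_nonneg _

theorem measurableSet_innerCube (d : ℕ) (γ : ℝ) : MeasurableSet (innerCube d γ) :=
  (measurableSet_cube d).inter ((continuous_sum_one_sub_cos d).measurable measurableSet_Iio)

instance isFiniteMeasure_torusMeasure (d : ℕ) : IsFiniteMeasure (torusMeasure d) := by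
  refine ⟨?_⟩
  rw [torusMeasure, Measure.restrict_apply_univ]
  refine lt_of_le_of_lt (measure_mono ?_)
    (measure_closedBall_lt_top (x := (0 : Mom d)) (r := √d * π))
  intro p hp
  rw [mem_closedBall_zero_iff, EuclideanSpace.norm_eq]
  refine Real.sqrt_le_iff.2 ⟨by positivity, ?_⟩
  rw [mul_pow, Real.sq_sqrt (by positivity)]
  have : ∀ i, ‖p i‖ ^ 2 ≤ π ^ 2 := fun i => by
    gcongr
    exact abs_le.2 ⟨(hp i).1.le, (hp i).2⟩
  simpa using Finset.sum_le_sum fun i (_ : i ∈ Finset.univ) => this i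

/-- The weight `|v|²` in the new variables. -/
def weight {d : ℕ} (vhat : (Fin d → ℤ) → ℝ) (y : Mom d) : ℝ :=
  anglesJacobian y * vSq vhat (angles y)

theorem angleDeriv_nonneg (u : ℝ) : 0 ≤ angleDeriv u := by unfold angleDeriv; positivity

theorem anglesJacobian_nonneg {d : ℕ} (y : Mom d) : 0 ≤ anglesJacobian y :=
  Finset.prod_nonneg fun i _ => angleDeriv_nonneg (y i)

theorem setIntegral_innerCube {d : ℕ} (vhat : (Fin d → ℤ) → ℝ) {γ : ℝ} (hγ : 0 < γ)
    (hγ2 : γ ≤ √2) (t : ℝ) :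
    ∫ p in innerCube d γ, vSq vhat p / (disp p + t) =
      ∫ y in Metric.ball (0 : Mom d) γ, weight vhat y / (‖y‖ ^ 4 + t) := by
  have hlt : ∀ y ∈ Metric.ball (0 : Mom d) γ, ‖y‖ < √2 := fun y hy =>
    (mem_ball_zero_iff.1 hy).trans_le hγ2
  rw [← image_angles_ball hγ hγ2, integral_image_eq_integral_abs_det_fderiv_smul volume
    measurableSet_ball (fun y hy => (hasFDerivAt_angles (hlt y hy)).hasFDerivWithinAt)
    (injOn_angles.mono (Metric.ball_subset_ball hγ2))]
  refine setIntegral_congr_fun measurableSet_ball fun y hy => ?_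
  simp only [det_anglesFDeriv, disp_angles (hlt y hy), smul_eq_mul, weight]
  rw [abs_of_nonneg (anglesJacobian_nonneg y)]
  ring

theorem analyticAt_apply {d : ℕ} (i : Fin d) (y : Mom d) : AnalyticAt ℝ (fun y : Mom d => y i) y :=
  (PiLp.proj (𝕜 := ℝ) 2 (fun _ : Fin d => ℝ) i).analyticAt y

theorem analyticAt_angles {d : ℕ} : AnalyticAt ℝ (angles (d := d)) 0 := by
  have h : AnalyticAt ℝ (fun y : Mom d => fun i => angle (y i)) 0 :=
    AnalyticAt.pi fun i => AnalyticAt.fun_comp_of_eq analyticAt_angle (analyticAt_apply i 0) rfl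
  exact ((PiLp.continuousLinearEquiv 2 ℝ (fun _ : Fin d => ℝ)).symm.toContinuousLinearMap.analyticAt
    _).comp h

theorem angles_zero {d : ℕ} : angles (0 : Mom d) = 0 := by ext i; simp [angles, angle_zero]

theorem ExpDecay.analyticAt_weight {d : ℕ} {vhat : (Fin d → ℤ) → ℝ} (h : ExpDecay vhat) :
    AnalyticAt ℝ (weight vhat) 0 := by
  refine AnalyticAt.fun_mul ?_ (AnalyticAt.fun_comp_of_eq h.analyticAt_vSq analyticAt_angles
    angles_zero)
  exact Finset.analyticAt_fun_prod _ fun i _ =>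
    AnalyticAt.fun_comp_of_eq analyticAt_angleDeriv (analyticAt_apply i 0) rfl

theorem angle_neg (u : ℝ) : angle (-u) = -angle u := by
  simp [angle, neg_div, Real.arcsin_neg]

theorem weight_neg {d : ℕ} (vhat : (Fin d → ℤ) → ℝ) (y : Mom d) :
    weight vhat (-y) = weight vhat y := by
  have h1 : angles (-y) = -angles y := by ext i; simp [angles, angle_neg]
  have h2 : anglesJacobian (-y) = anglesJacobian y := by
    simp [anglesJacobian, angleDeriv, neg_div]
  rw [weight, h1, h2, vSq_neg, weight]

/-- The Jacobian tends to √2^d, and p ~ √2 r w gives √2^{2n₀} through homogeneity of the leading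
form. -/
theorem tendsto_weight_div_pow {d : ℕ} {vhat : (Fin d → ℤ) → ℝ} (hv : ExpDecay vhat) {n₀ : ℕ}
    (hvanish : ∀ j < n₀, iteratedFDeriv ℝ (2 * j) (vSq vhat) 0 = 0) (w : Mom d) :
    Tendsto (fun r : ℝ => weight vhat (r • w) / r ^ (2 * n₀)) (𝓝[>] 0)
      (𝓝 (√2 ^ (2 * n₀ + d) * leadingForm vhat n₀ w)) := by
  have hr0 : Tendsto (fun r : ℝ => r • w) (𝓝[>] 0) (𝓝 0) := by
    have : Continuous fun r : ℝ => r • w := by fun_prop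
    simpa using (this.tendsto 0).mono_left nhdsWithin_le_nhds
  have hJ : Tendsto (fun r : ℝ => anglesJacobian (r • w)) (𝓝[>] 0) (𝓝 (√2 ^ d)) := by
    have h0 : AnalyticAt ℝ (anglesJacobian (d := d)) 0 := Finset.analyticAt_fun_prod _ fun i _ =>
      AnalyticAt.fun_comp_of_eq analyticAt_angleDeriv (analyticAt_apply i 0) rfl
    have h1 := h0.continuousAt.tendsto
    have h2 : anglesJacobian (0 : Mom d) = √2 ^ d := by simp [anglesJacobian, angleDeriv_zero]
    rw [h2] at h1
    exact h1.comp hr0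
  have hc : Tendsto (fun r : ℝ => r⁻¹ • angles (r • w)) (𝓝[>] 0) (𝓝 (√2 • w)) := by
    have hF : HasDerivAt (fun r : ℝ => angles (r • w)) (anglesFDeriv 0 w) 0 := by
      have h1 : HasFDerivAt (angles (d := d)) (anglesFDeriv 0) ((0 : ℝ) • w) := by
        rw [zero_smul]; exact hasFDerivAt_angles (by simp)
      have := h1.comp_hasDerivAt (0 : ℝ) ((hasDerivAt_id (0 : ℝ)).smul_const w)
      rw [one_smul] at this
      exact this
    have h3 : anglesFDeriv (0 : Mom d) w = √2 • w := by
      ext i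
      simp [anglesFDeriv, Matrix.toLpLin_apply, angleDeriv_zero]
    rw [h3, hasDerivAt_iff_tendsto_slope] at hF
    refine (hF.mono_left (nhdsWithin_mono _ fun r (hr : 0 < r) => hr.ne')).congr fun r => ?_
    simp [slope, angles_zero]
  have := hJ.mul (tendsto_vSq_div_pow hv hvanish hc)
  rw [leadingForm_smul] at this
  have e : √2 ^ d * (√2 ^ (2 * n₀) * leadingForm vhat n₀ w) =
      √2 ^ (2 * n₀ + d) * leadingForm vhat n₀ w := by rw [pow_add]; ring
  rw [e] at this
  exact this.congr fun r => by rw [weight]; ring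

/-! ### Polar coordinates and the structure of the resolvent form -/

theorem integral_polar {d : ℕ} (hd : 1 ≤ d) {F : Mom d → ℝ} (hF : Integrable F) :
    ∫ y, F y = ∫ r in Ioi (0 : ℝ), r ^ (d - 1) *
      ∫ w : Metric.sphere (0 : Mom d) 1, F (r • (w : Mom d)) ∂((volume : Measure (Mom d)).toSphere) := by
  have : Nonempty (Fin d) := ⟨⟨0, hd⟩⟩
  have hmp := (volume : Measure (Mom d)).measurePreserving_homeomorphUnitSphereProd
  have hemb := (homeomorphUnitSphereProd (Mom d)).measurableEmbedding
  have hdim : Module.finrank ℝ (Mom d) = d := by simp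
  rw [hdim] at hmp
  let G : Metric.sphere (0 : Mom d) 1 × Ioi (0 : ℝ) → ℝ := fun q => F ((q.2 : ℝ) • (q.1 : Mom d))
  have hGF : ∀ x : ({0}ᶜ : Set (Mom d)), G (homeomorphUnitSphereProd (Mom d) x) = F x := by
    intro x
    have hx : ‖(x : Mom d)‖ ≠ 0 := norm_ne_zero_iff.2 x.2
    simp [G, smul_smul, hx]
  have hFc : Integrable (fun x : ({0}ᶜ : Set (Mom d)) => F x) ((volume : Measure (Mom d)).comap (↑)) := by
    have := (integrableOn_iff_comap_subtypeVal (f := F) (μ := volume)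
      (measurableSet_singleton (0 : Mom d)).compl).1 hF.integrableOn
    exact this
  have hG : Integrable G ((volume : Measure (Mom d)).toSphere.prod (Measure.volumeIoiPow (d - 1))) := by
    rw [← hmp.integrable_comp_emb hemb]
    exact hFc.congr (Filter.Eventually.of_forall fun x => (hGF x).symm)
  calc ∫ y, F y = ∫ x : ({0}ᶜ : Set (Mom d)), F x ∂((volume : Measure (Mom d)).comap (↑)) := by
        rw [integral_subtype_comap (measurableSet_singleton _).compl fun x => F x,
          restrict_compl_singleton]
    _ = ∫ q, G q ∂((volume : Measure (Mom d)).toSphere.prod (Measure.volumeIoiPow (d - 1))) := by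
        rw [← hmp.integral_comp hemb]
        exact integral_congr_ae (Filter.Eventually.of_forall fun x => (hGF x).symm)
    _ = ∫ r : Ioi (0 : ℝ), ∫ w, F ((r : ℝ) • (w : Mom d)) ∂((volume : Measure (Mom d)).toSphere)
          ∂(Measure.volumeIoiPow (d - 1)) := integral_prod_symm _ hG
    _ = _ := by
        simp only [Measure.volumeIoiPow, ENNReal.ofReal]
        rw [integral_withDensity_eq_integral_smul,
          integral_subtype_comap measurableSet_Ioi fun a : ℝ => Real.toNNReal (a ^ (d - 1)) •
            ∫ w, F (a • ((w : Metric.sphere (0 : Mom d) 1) : Mom d))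
              ∂((volume : Measure (Mom d)).toSphere),
          setIntegral_congr_fun measurableSet_Ioi fun x hx => ?_]
        · rw [NNReal.smul_def, Real.coe_toNNReal _ (pow_nonneg hx.out.le _), smul_eq_mul]
        · exact (measurable_subtype_coe.pow_const _).real_toNNReal

/-- The quadratic form `∫ |v|² / (𝔢 + t)` of the resolvent of `𝔢` at `-t`. -/
def resolventForm {d : ℕ} (vhat : (Fin d → ℤ) → ℝ) (t : ℝ) : ℝ :=
  ∫ q, vSq vhat q / (disp q + t) ∂(torusMeasure d)

theorem vSq_nonneg {d : ℕ} (vhat : (Fin d → ℤ) → ℝ) (p : Mom d) : 0 ≤ vSq vhat p := sq_nonneg _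

theorem ExpDecay.continuous_vSq {d : ℕ} {vhat : (Fin d → ℤ) → ℝ} (h : ExpDecay vhat) :
    Continuous (vSq vhat) := h.continuous_v.norm.pow 2

theorem ExpDecay.integrable_vSq {d : ℕ} {vhat : (Fin d → ℤ) → ℝ} (h : ExpDecay vhat) :
    Integrable (vSq vhat) (torusMeasure d) := by
  obtain ⟨C, hC, hb⟩ := h.exists_norm_v_le
  refine Integrable.of_bound h.continuous_vSq.aestronglyMeasurable (C ^ 2)
    (Filter.Eventually.of_forall fun p => ?_)
  rw [Real.norm_of_nonneg (vSq_nonneg _ _), vSq]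
  gcongr
  exact hb p

theorem integrable_div_add {X : Type*} [MeasurableSpace X] {ν : Measure X} {f g : X → ℝ} {δ : ℝ}
    (hf : Integrable f ν) (hg : AEStronglyMeasurable g ν) (hδ : 0 < δ) (h : ∀ᵐ x ∂ν, δ ≤ g x) :
    Integrable (fun x => f x / g x) ν := by
  refine (hf.norm.mul_const δ⁻¹).mono' (hf.aestronglyMeasurable.div₀ hg) ?_
  filter_upwards [h] with x hx
  rw [norm_div, Real.norm_of_nonneg (hδ.le.trans hx), div_eq_mul_inv]
  gcongr

theorem ExpDecay.integrable_vSq_div {d : ℕ} {vhat : (Fin d → ℤ) → ℝ} (h : ExpDecay vhat) {t : ℝ}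
    (ht : 0 < t) : Integrable (fun q => vSq vhat q / (disp q + t)) (torusMeasure d) :=
  integrable_div_add h.integrable_vSq
    ((continuous_disp d).add continuous_const).aestronglyMeasurable ht
    (Filter.Eventually.of_forall fun q => le_add_of_nonneg_left (disp_nonneg q))

theorem integral_ball_weight {d : ℕ} (hd : 1 ≤ d) {W : Mom d → ℝ} {γ t : ℝ}
    (ht : 0 < t) (hW : ContinuousOn W (Metric.closedBall 0 γ)) :
    ∫ y in Metric.ball (0 : Mom d) γ, W y / (‖y‖ ^ 4 + t) =
      ∫ r in Ioc 0 γ, r ^ (d - 1) * (∫ w : Metric.sphere (0 : Mom d) 1, W (r • (w : Mom d))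
        ∂((volume : Measure (Mom d)).toSphere)) / (r ^ 4 + t) := by
  have hc : ContinuousOn (fun y : Mom d => W y / (‖y‖ ^ 4 + t)) (Metric.closedBall 0 γ) := by
    refine hW.div (by fun_prop) fun y _ => ?_
    positivity
  have hintg : IntegrableOn (fun y : Mom d => W y / (‖y‖ ^ 4 + t)) (Metric.closedBall 0 γ) :=
    hc.integrableOn_compact (isCompact_closedBall _ _)
  have hball : Metric.ball (0 : Mom d) γ ⊆ Metric.closedBall 0 γ := Metric.ball_subset_closedBall
  -- The closed ball differs by a null sphere; its compactness gives integrability, and it matches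
  -- the radial interval `Ioc 0 γ`.
  have e1 : ∫ y in Metric.ball (0 : Mom d) γ, W y / (‖y‖ ^ 4 + t) =
      ∫ y in Metric.closedBall (0 : Mom d) γ, W y / (‖y‖ ^ 4 + t) := by
    refine setIntegral_congr_set ?_
    have : Nonempty (Fin d) := ⟨⟨0, hd⟩⟩
    refine (Filter.EventuallyLE.antisymm hball.eventuallyLE ?_)
    rw [ae_le_set, Metric.closedBall_sdiff_ball]
    exact Measure.addHaar_sphere _ _ _
  rw [e1, ← integral_indicator Metric.isClosed_closedBall.measurableSet,
    integral_polar hd (hintg.integrable_indicator Metric.isClosed_closedBall.measurableSet)]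
  have hsub : Ioc 0 γ ⊆ Ioi (0 : ℝ) := fun r hr => hr.1
  refine (setIntegral_eq_of_subset_of_forall_sdiff_eq_zero measurableSet_Ioi hsub ?_).trans ?_
  · intro r hr
    have hr0 : 0 < r := hr.1
    have hrγ : γ < r := by
      by_contra hcon
      exact hr.2 ⟨hr0, not_lt.1 hcon⟩
    have : ∀ w : Metric.sphere (0 : Mom d) 1, (Metric.closedBall (0 : Mom d) γ).indicator
        (fun y : Mom d => W y / (‖y‖ ^ 4 + t)) (r • (w : Mom d)) = 0 := fun w => by
      have hw : ‖(w : Mom d)‖ = 1 := by simp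
      refine indicator_of_notMem ?_ _
      rw [mem_closedBall_zero_iff, norm_smul, hw, mul_one, Real.norm_of_nonneg hr0.le]
      exact not_le.2 hrγ
    simp only [this, integral_zero, mul_zero]
  · refine setIntegral_congr_fun measurableSet_Ioc fun r hr => ?_
    have hr0 : 0 < r := hr.1
    simp only [mul_div_assoc]
    rw [← integral_div]
    congr 1
    refine integral_congr_ae (Filter.Eventually.of_forall fun w => ?_)
    have hw : ‖(w : Mom d)‖ = 1 := by simp
    have hn : ‖r • (w : Mom d)‖ = r := by rw [norm_smul, hw, mul_one, Real.norm_of_nonneg hr0.le]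
    simp only
    rw [indicator_of_mem (by rw [mem_closedBall_zero_iff, hn]; exact hr.2), hn]

/-- The Taylor series is integrated termwise over the sphere. Odd degrees drop out by evenness,
degrees below 2m and the value in degree 2m come from the limits along rays. -/
theorem exists_sphere_series {d : ℕ} (hd : 1 ≤ d) {W : Mom d → ℝ} (hW : AnalyticAt ℝ W 0)
    (heven : ∀ y, W (-y) = W y) {m : ℕ} {Q : Mom d → ℝ}
    (hlim : ∀ w, Tendsto (fun r : ℝ => W (r • w) / r ^ (2 * m)) (𝓝[>] 0) (𝓝 (Q w)))
    {γ₀ : ℝ} (hγ₀ : 0 < γ₀) :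
    ∃ γ, 0 < γ ∧ γ ≤ γ₀ ∧ ContinuousOn W (Metric.closedBall 0 γ) ∧ ∃ b : ℕ → ℝ,
      (Summable fun j => |b j| * γ ^ (2 * j)) ∧
      b 0 = ∫ w : Metric.sphere (0 : Mom d) 1, Q w ∂((volume : Measure (Mom d)).toSphere) ∧
      ∀ r ∈ Ioc 0 γ, r ^ (d - 1) * (∫ w : Metric.sphere (0 : Mom d) 1, W (r • (w : Mom d))
        ∂((volume : Measure (Mom d)).toSphere)) = ∑' j, b j * r ^ (2 * m + d - 1 + 2 * j) := by
  obtain ⟨p, R, hp⟩ := hW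
  obtain ⟨ρ, hρ0, hρ⟩ := ENNReal.lt_iff_exists_nnreal_btwn.1 hp.r_pos
  have hρ0' : 0 < (ρ : ℝ) := by exact_mod_cast hρ0
  set γ : ℝ := min ρ γ₀ with hγdef
  have hγ : 0 < γ := lt_min hρ0' hγ₀
  have hγR : ∀ y ∈ Metric.closedBall (0 : Mom d) γ, y ∈ Metric.eball (0 : Mom d) R := fun y hy => by
    have hyρ : ‖y‖ ≤ ρ := (mem_closedBall_zero_iff.1 hy).trans (min_le_left _ _)
    rw [Metric.mem_eball, edist_zero_right]
    refine lt_of_le_of_lt ?_ hρ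
    rw [enorm_le_coe]
    exact_mod_cast hyρ
  have hsum : Summable fun n => ‖p n‖ * γ ^ n := by
    refine Summable.of_nonneg_of_le (fun n => by positivity) (fun n => ?_)
      (p.summable_norm_mul_pow (hρ.trans_le hp.r_le))
    gcongr
    exact min_le_left _ _
  set σ := (volume : Measure (Mom d)).toSphere with hσ
  let a : ℕ → ℝ := fun n => ∫ w : Metric.sphere (0 : Mom d) 1, p n (fun _ => (w : Mom d)) ∂σ
  have hray : ∀ w, ∀ᶠ r in 𝓝 (0 : ℝ), HasSum (fun n => p n (fun _ => w) * r ^ n) (W (r • w)) :=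
    HasFPowerSeriesAt.eventually_hasSum_ray ⟨R, hp⟩
  have hodd : ∀ n, Odd n → a n = 0 := fun n hn => by
    have : ∀ w : Metric.sphere (0 : Mom d) 1, p n (fun _ => (w : Mom d)) = 0 := fun w =>
      coeff_odd_eq_zero (hray w) (fun z => by rw [neg_smul, heven]) hn
    simp [a, this]
  have hlow : ∀ n < 2 * m, a n = 0 := fun n hn => by
    have : ∀ w : Metric.sphere (0 : Mom d) 1, p n (fun _ => (w : Mom d)) = 0 := fun w =>
      (coeff_of_tendsto_div_pow (hray w) (hlim w)).1 n hn
    simp [a, this]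
  have hlead : a (2 * m) = ∫ w : Metric.sphere (0 : Mom d) 1, Q w ∂σ :=
    integral_congr_ae (Filter.Eventually.of_forall fun w =>
      (coeff_of_tendsto_div_pow (hray w) (hlim w)).2)
  have hpn : ∀ n (w : Metric.sphere (0 : Mom d) 1), ‖p n (fun _ => (w : Mom d))‖ ≤ ‖p n‖ := by
    intro n w
    refine ((p n).le_opNorm _).trans ?_
    simp
  have hcont : ∀ n, Continuous fun w : Metric.sphere (0 : Mom d) 1 => p n (fun _ => (w : Mom d)) :=
    fun n => (p n).cont.comp (by fun_prop)
  have hintg : ∀ n, Integrable (fun w : Metric.sphere (0 : Mom d) 1 => p n (fun _ => (w : Mom d))) σ :=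
    fun n => Integrable.of_bound (hcont n).aestronglyMeasurable _
      (Filter.Eventually.of_forall (hpn n))
  have hna : ∀ n, |a n| ≤ ‖p n‖ * σ.real univ := fun n => by
    have := norm_integral_le_of_norm_le_const (μ := σ) (Filter.Eventually.of_forall (hpn n))
    exact this
  have hasum : Summable fun n => |a n| * γ ^ n := by
    refine Summable.of_nonneg_of_le (fun n => by positivity) (fun n => ?_)
      (hsum.mul_left (σ.real univ))
    calc |a n| * γ ^ n ≤ ‖p n‖ * σ.real univ * γ ^ n := by gcongr; exact hna n
      _ = _ := by ring
  have hser : ∀ r ∈ Ioc 0 γ, HasSum (fun n => a n * r ^ n)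
      (∫ w : Metric.sphere (0 : Mom d) 1, W (r • (w : Mom d)) ∂σ) := by
    intro r hr
    have hr0 : 0 < r := hr.1
    have h1 := hasSum_integral_of_summable_integral_norm (μ := σ)
      (F := fun n (w : Metric.sphere (0 : Mom d) 1) => p n (fun _ => (w : Mom d)) * r ^ n)
      (fun n => (hintg n).mul_const _) (by
        refine Summable.of_nonneg_of_le (fun n => integral_nonneg fun w => norm_nonneg _)
          (fun n => ?_) (hsum.mul_right (σ.real univ))
        have hb : ∀ w : Metric.sphere (0 : Mom d) 1,
            ‖‖p n (fun _ => (w : Mom d)) * r ^ n‖‖ ≤ ‖p n‖ * γ ^ n := fun w => by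
          rw [norm_norm, norm_mul, norm_pow, Real.norm_of_nonneg hr0.le]
          gcongr
          · exact hpn n w
          · exact hr.2
        exact (le_abs_self _).trans (norm_integral_le_of_norm_le_const (μ := σ)
          (Filter.Eventually.of_forall hb)))
    have h2 : ∀ w : Metric.sphere (0 : Mom d) 1,
        ∑' n, p n (fun _ => (w : Mom d)) * r ^ n = W (r • (w : Mom d)) := fun w => by
      have hw : ‖(w : Mom d)‖ = 1 := by simp
      have hmem : r • (w : Mom d) ∈ Metric.closedBall (0 : Mom d) γ := by
        rw [mem_closedBall_zero_iff, norm_smul, hw, mul_one, Real.norm_of_nonneg hr0.le]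
        exact hr.2
      have h3 := hp.hasSum (hγR _ hmem)
      rw [zero_add] at h3
      rw [← h3.tsum_eq]
      refine tsum_congr fun n => ?_
      have := (p n).map_smul_univ (fun _ => r) (fun _ => (w : Mom d))
      simp only [Finset.prod_const, Finset.card_univ, Fintype.card_fin, smul_eq_mul] at this
      rw [this, mul_comm]
    simp only [h2, integral_mul_const] at h1
    exact h1
  refine ⟨γ, hγ, min_le_right _ _, hp.continuousOn.mono hγR, fun j => a (2 * m + 2 * j), ?_, ?_, ?_⟩
  · have h1 : Function.Injective fun j : ℕ => 2 * m + 2 * j := fun i j h => by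
      simpa using h
    refine ((hasum.comp_injective h1).mul_right (γ ^ (2 * m))⁻¹).congr fun j => ?_
    simp only [Function.comp_apply]
    rw [pow_add]; field_simp
  · simpa using hlead
  · intro r hr
    rw [← (hser r hr).tsum_eq, ← tsum_mul_left]
    have hinj : Function.Injective fun j : ℕ => 2 * m + 2 * j := fun i j h => by simpa using h
    rw [← hinj.tsum_eq]
    · refine tsum_congr fun j => ?_
      rw [show 2 * m + d - 1 + 2 * j = (d - 1) + (2 * m + 2 * j) by omega, pow_add]
      ring
    -- A degree outside the range of j ↦ 2m + 2j is odd or below 2m, and its spherical mean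
    -- vanishes.
    · intro n hn
      by_contra hcon
      refine hn ?_
      have : a n = 0 := by
        rcases Nat.even_or_odd n with he | ho
        · refine hlow n ?_
          by_contra hlt
          obtain ⟨k, hk⟩ := he
          exact hcon ⟨k - m, by simp only; omega⟩
        · exact hodd n ho
      simp [this]

theorem exists_resolventForm_structure {d : ℕ} (hd : 1 ≤ d) {vhat : (Fin d → ℤ) → ℝ}
    (hv : ExpDecay vhat) {n₀ : ℕ}
    (hvanish : ∀ j < n₀, iteratedFDeriv ℝ (2 * j) (vSq vhat) 0 = 0) :
    ∃ A φ ψ : ℝ → ℝ, AnalyticAt ℝ A 0 ∧ AnalyticAt ℝ φ 0 ∧ AnalyticAt ℝ ψ 0 ∧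
      φ 0 = cV vhat n₀ / √2 ^ (2 * n₀ + d) ∧
      ∀ᶠ t in 𝓝[>] (0 : ℝ), resolventForm vhat t =
        A t + φ t * singPart (2 * n₀ + d) t + ψ t * singPart (2 * n₀ + d + 2) t := by
  obtain ⟨γ, hγ, hγ2, hcont, b, hb, hb0, hser⟩ := exists_sphere_series hd hv.analyticAt_weight
    (weight_neg vhat) (tendsto_weight_div_pow hv hvanish) (γ₀ := √2) (by positivity)
  obtain ⟨A, φ, ψ, hA, hφ, hψ, hφ0, hdec⟩ := exists_radial_decomposition hγ
    (N := 2 * n₀ + d) (by omega) hb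
  let C : ℝ → ℝ := fun t => ∫ q in cube d \ innerCube d γ, vSq vhat q / (disp q + t)
  have hsub : innerCube d γ ⊆ cube d := fun p hp => hp.1
  have hdisp : ∀ᵐ q ∂(volume.restrict (cube d \ innerCube d γ)), γ ^ 4 ≤ disp q := by
    filter_upwards [ae_restrict_mem ((measurableSet_cube d).diff (measurableSet_innerCube d γ))]
      with q hq
    have : γ ^ 2 ≤ ∑ i, (1 - Real.cos (q i)) := by
      by_contra hlt
      exact hq.2 ⟨hq.1, not_le.1 hlt⟩
    calc γ ^ 4 = (γ ^ 2) ^ 2 := by ring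
      _ ≤ disp q := by rw [disp]; gcongr
  have hC : AnalyticAt ℝ C 0 := by
    refine analyticAt_integral_div_add (pow_pos hγ 4) hdisp
      (continuous_disp d).aestronglyMeasurable ?_
    have h1 : IntegrableOn (vSq vhat) (cube d \ innerCube d γ) :=
      IntegrableOn.mono_set (t := cube d) hv.integrable_vSq sdiff_subset
    exact integrable_div_add h1 (continuous_disp d).aestronglyMeasurable (pow_pos hγ 4) hdisp
  refine ⟨fun t => C t + A t, φ, ψ, hC.fun_add hA, hφ, hψ, ?_, ?_⟩
  · rw [hφ0, hb0, integral_const_mul, cV_eq]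
    -- The leading radial coefficient carries √2^N whereas c_v carries 2^N, whence φ(0) = c_v /
    -- √2^N.
    have h2 : (2 : ℝ) ^ (2 * n₀ + d) = √2 ^ (2 * n₀ + d) * √2 ^ (2 * n₀ + d) := by
      rw [← mul_pow, Real.mul_self_sqrt (by norm_num)]
    rw [h2]
    field_simp
  · filter_upwards [hdec, self_mem_nhdsWithin] with t h1 (ht : 0 < t)
    have hintg := hv.integrable_vSq_div ht
    have h2 := setIntegral_union (μ := volume) (f := fun q => vSq vhat q / (disp q + t))
      (disjoint_sdiff_left (s := innerCube d γ) (t := cube d)) (measurableSet_innerCube d γ)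
      (IntegrableOn.mono_set (t := cube d) hintg sdiff_subset)
      (IntegrableOn.mono_set (t := cube d) hintg hsub)
    rw [sdiff_union_of_subset hsub, setIntegral_innerCube vhat hγ hγ2,
      integral_ball_weight hd ht hcont] at h2
    rw [resolventForm, torusMeasure, h2]
    have h3 : ∫ r in Ioc 0 γ, r ^ (d - 1) * (∫ w : Metric.sphere (0 : Mom d) 1,
        weight vhat (r • (w : Mom d)) ∂((volume : Measure (Mom d)).toSphere)) / (r ^ 4 + t) =
        ∫ r in Ioc 0 γ, (∑' j, b j * r ^ (2 * n₀ + d - 1 + 2 * j)) / (r ^ 4 + t) :=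
      setIntegral_congr_fun measurableSet_Ioc fun r hr => by
        rw [hser r hr]
    rw [h3, h1]
    simp only [C]
    ring

/-! ### The eigenvalue equation μ B(t) = 1 -/

theorem ae_torusMeasure_disp_pos {d : ℕ} (hd : 1 ≤ d) : ∀ᵐ p ∂(torusMeasure d), 0 < disp p := by
  have : Nonempty (Fin d) := ⟨⟨0, hd⟩⟩
  have h0 : ∀ᵐ p ∂(volume : Measure (Mom d)), p ≠ 0 := by
    rw [ae_iff]; simp
  filter_upwards [ae_restrict_of_ae h0, ae_restrict_mem (measurableSet_cube d)] with p hp0 hp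
  refine lt_of_le_of_ne (disp_nonneg p) fun h => hp0 ?_
  have hs : ∑ i, (1 - Real.cos (p i)) = 0 := by
    rw [disp] at h
    exact pow_eq_zero_iff two_ne_zero |>.1 h.symm
  ext i
  have hi := (Finset.sum_eq_zero_iff_of_nonneg fun i _ => sub_nonneg.2 (Real.cos_le_one _)).1 hs i
    (Finset.mem_univ i)
  have hc : Real.cos (p i) = 1 := by linarith
  exact (Real.cos_eq_one_iff_of_lt_of_lt (by linarith [(hp i).1, Real.pi_pos])
    (by linarith [(hp i).2, Real.pi_pos])).1 hc

/-- By continuity, vanishing a.e. on the cube forces vanishing on the unit ball, and with it of all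
derivatives at 0. -/
theorem not_ae_eq_zero_vSq {d : ℕ} {vhat : (Fin d → ℤ) → ℝ} (hv : ExpDecay vhat) {n : ℕ}
    (h : iteratedFDeriv ℝ n (vSq vhat) 0 ≠ 0) : ¬ (vSq vhat =ᵐ[torusMeasure d] 0) := by
  intro hae
  refine h ?_
  have hball : Metric.ball (0 : Mom d) 1 ⊆ cube d := fun p hp i => by
    have := abs_lt.1 (abs_apply_lt (mem_ball_zero_iff.1 hp) i)
    have hpi := Real.pi_gt_three
    exact ⟨by linarith [this.1], by linarith [this.2]⟩
  have hz : ∀ p ∈ Metric.ball (0 : Mom d) 1, vSq vhat p = 0 := by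
    have h1 : vSq vhat =ᵐ[volume.restrict (Metric.ball (0 : Mom d) 1)] fun _ => (0 : ℝ) :=
      ae_mono (Measure.restrict_mono_set volume hball) hae
    exact fun p hp => Measure.eqOn_open_of_ae_eq h1 Metric.isOpen_ball
      hv.continuous_vSq.continuousOn continuousOn_const hp
  have hev : vSq vhat =ᶠ[𝓝 0] fun _ => (0 : ℝ) :=
    Filter.eventually_of_mem (Metric.ball_mem_nhds _ one_pos) hz
  rw [(Filter.EventuallyEq.iteratedFDeriv ℝ hev n).self_of_nhds]
  have h0 : (fun _ : Mom d => (0 : ℝ)) = 0 := rfl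
  ext w
  simp

theorem integral_vSq_mul_pos {d : ℕ} {vhat : (Fin d → ℤ) → ℝ}
    (hne : ¬ (vSq vhat =ᵐ[torusMeasure d] 0)) {g : Mom d → ℝ}
    (hg : ∀ᵐ p ∂(torusMeasure d), 0 < g p)
    (hi : Integrable (fun p => vSq vhat p * g p) (torusMeasure d)) :
    0 < ∫ p, vSq vhat p * g p ∂(torusMeasure d) := by
  have h0 : 0 ≤ᵐ[torusMeasure d] fun p => vSq vhat p * g p := by
    filter_upwards [hg] with p hp using mul_nonneg (vSq_nonneg _ _) hp.le
  refine lt_of_le_of_ne (integral_nonneg_of_ae h0) fun h => hne ?_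
  filter_upwards [(integral_eq_zero_iff_of_nonneg_ae h0 hi).1 h.symm, hg] with p hp hp2
  exact (mul_eq_zero.1 hp).resolve_right hp2.ne'

theorem resolventForm_pos {d : ℕ} {vhat : (Fin d → ℤ) → ℝ} (hv : ExpDecay vhat)
    (hne : ¬ (vSq vhat =ᵐ[torusMeasure d] 0)) {t : ℝ} (ht : 0 < t) : 0 < resolventForm vhat t := by
  have hi := hv.integrable_vSq_div ht
  simp only [div_eq_mul_inv] at hi
  have := integral_vSq_mul_pos hne (Filter.Eventually.of_forall fun p =>
    inv_pos.2 (add_pos_of_nonneg_of_pos (disp_nonneg p) ht)) hi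
  simpa only [resolventForm, div_eq_mul_inv] using this

theorem strictAntiOn_resolventForm {d : ℕ} {vhat : (Fin d → ℤ) → ℝ} (hv : ExpDecay vhat)
    (hne : ¬ (vSq vhat =ᵐ[torusMeasure d] 0)) : StrictAntiOn (resolventForm vhat) (Ioi 0) := by
  intro t (ht : 0 < t) s (hs : 0 < s) hts
  have hd := hv.integrable_vSq_div ht
  have hs' := hv.integrable_vSq_div hs
  have he : ∀ p, vSq vhat p / (disp p + t) - vSq vhat p / (disp p + s) =
      vSq vhat p * ((disp p + t)⁻¹ - (disp p + s)⁻¹) := fun p => by ring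
  have hi := hd.sub hs'
  have hpos := integral_vSq_mul_pos hne (g := fun p => (disp p + t)⁻¹ - (disp p + s)⁻¹)
    (Filter.Eventually.of_forall fun p => by
      have h1 : 0 < disp p + t := add_pos_of_nonneg_of_pos (disp_nonneg p) ht
      rw [sub_pos]
      gcongr) (hi.congr (Filter.Eventually.of_forall he))
  have h2 := integral_sub hd hs'
  rw [← resolventForm, ← resolventForm, integral_congr_ae (Filter.Eventually.of_forall he)] at h2
  linarith

theorem conj_mul_v {d : ℕ} (vhat : (Fin d → ℤ) → ℝ) (p : Mom d) :
    (starRingEnd ℂ) (v vhat p) * v vhat p = ((vSq vhat p : ℝ) : ℂ) := by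
  rw [mul_comm, Complex.mul_conj, Complex.normSq_eq_norm_sq, vSq]

theorem not_ae_eq_zero_v {d : ℕ} {vhat : (Fin d → ℤ) → ℝ}
    (hne : ¬ (vSq vhat =ᵐ[torusMeasure d] 0)) : ¬ (v vhat =ᵐ[torusMeasure d] 0) := fun h =>
  hne (h.mono fun p hp => by simp [vSq, hp])

/-- Rank-one Birman–Schwinger argument. The eigenvalue equation forces f = μ I v/(𝔢 + t) with I = ∫
v̄ f; pairing with v gives I = μ I B(t), and I ≠ 0 since otherwise f = 0. Conversely v/(𝔢 + t) is
bounded and solves the equation. -/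
theorem isEigenvalue_neg_iff {d : ℕ} {vhat : (Fin d → ℤ) → ℝ} (hv : ExpDecay vhat)
    (hne : ¬ (vSq vhat =ᵐ[torusMeasure d] 0)) (μ : ℝ) {t : ℝ} (ht : 0 < t) :
    IsEigenvalue vhat μ ((-t : ℝ) : ℂ) ↔ μ * resolventForm vhat t = 1 := by
  have hpos : ∀ p : Mom d, 0 < disp p + t := fun p => add_pos_of_nonneg_of_pos (disp_nonneg p) ht
  have hposC : ∀ p : Mom d, ((disp p + t : ℝ) : ℂ) ≠ 0 := fun p => by
    exact_mod_cast (hpos p).ne'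
  constructor
  · rintro ⟨f, hf, hf0, heq⟩
    set I := ∫ q, (starRingEnd ℂ) (v vhat q) * f q ∂(torusMeasure d) with hI
    have hf' : f =ᵐ[torusMeasure d] fun p => (μ * I) * (v vhat p / ((disp p + t : ℝ) : ℂ)) := by
      filter_upwards [heq] with p hp
      rw [hAct, ← hI] at hp
      have h1 := hposC p
      push_cast at hp h1 ⊢
      field_simp
      linear_combination hp
    have hI2 : I = μ * I * (resolventForm vhat t : ℂ) := by
      rw [resolventForm, ← integral_complex_ofReal, ← integral_const_mul]
      rw [hI]
      refine integral_congr_ae ?_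
      filter_upwards [hf'] with p hp
      rw [← hI, hp, Complex.ofReal_div, ← conj_mul_v]
      ring
    have hI0 : I ≠ 0 := by
      intro h0
      refine hf0 (hf'.trans ?_)
      simp only [h0, mul_zero, zero_mul]
      rfl
    have h3 : ((μ * resolventForm vhat t : ℝ) : ℂ) = 1 := by
      push_cast
      have : I * (μ * (resolventForm vhat t : ℂ)) = I * 1 := by rw [mul_one]; linear_combination -hI2
      exact mul_left_cancel₀ hI0 this
    exact_mod_cast h3
  · intro h
    refine ⟨fun p => v vhat p / ((disp p + t : ℝ) : ℂ), ?_, ?_, ?_⟩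
    · obtain ⟨C, hC, hb⟩ := hv.exists_norm_v_le
      have hcont : Continuous fun p : Mom d => v vhat p / ((disp p + t : ℝ) : ℂ) :=
        hv.continuous_v.div (Complex.continuous_ofReal.comp ((continuous_disp d).add continuous_const))
          hposC
      refine MemLp.of_bound hcont.aestronglyMeasurable (C / t)
        (Filter.Eventually.of_forall fun p => ?_)
      rw [norm_div, Complex.norm_real, Real.norm_of_nonneg (hpos p).le]
      gcongr
      · exact hb p
      · exact le_add_of_nonneg_left (disp_nonneg p)
    · intro h0
      refine not_ae_eq_zero_v hne (h0.mono fun p hp => ?_)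
      exact (div_eq_zero_iff.1 hp).resolve_right (hposC p)
    · refine Filter.Eventually.of_forall fun p => ?_
      have hI : ∫ q, (starRingEnd ℂ) (v vhat q) * (v vhat q / ((disp q + t : ℝ) : ℂ))
          ∂(torusMeasure d) = (resolventForm vhat t : ℂ) := by
        rw [resolventForm, ← integral_complex_ofReal]
        refine integral_congr_ae (Filter.Eventually.of_forall fun q => ?_)
        simp only
        rw [Complex.ofReal_div, ← conj_mul_v]; ring
      have hμ : (μ : ℂ) * (resolventForm vhat t : ℂ) = 1 := by exact_mod_cast h
      rw [hAct, hI]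
      have h1 := hposC p
      push_cast at h1 ⊢
      field_simp
      linear_combination -(v vhat p * (disp p + t)) * hμ

theorem tendsto_resolventForm_atTop {d : ℕ} {vhat : (Fin d → ℤ) → ℝ} (hv : ExpDecay vhat) :
    Tendsto (resolventForm vhat) atTop (𝓝 0) := by
  have h1 : Tendsto (fun t : ℝ => (∫ p, vSq vhat p ∂(torusMeasure d)) / t) atTop (𝓝 0) :=
    tendsto_const_nhds.div_atTop tendsto_id
  refine tendsto_of_tendsto_of_tendsto_of_le_of_le' tendsto_const_nhds h1 ?_ ?_
  · filter_upwards [eventually_gt_atTop 0] with t ht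
    exact integral_nonneg fun p => div_nonneg (vSq_nonneg _ _)
      (add_nonneg (disp_nonneg p) ht.le)
  · filter_upwards [eventually_gt_atTop 0] with t ht
    rw [resolventForm, ← integral_div]
    refine integral_mono (hv.integrable_vSq_div ht) (hv.integrable_vSq.div_const t) fun p => ?_
    exact div_le_div_of_nonneg_left (vSq_nonneg _ _) ht (le_add_of_nonneg_left (disp_nonneg p))

theorem continuousOn_resolventForm {d : ℕ} {vhat : (Fin d → ℤ) → ℝ} (hv : ExpDecay vhat) :
    ContinuousOn (resolventForm vhat) (Ioi 0) := by
  intro t (ht : 0 < t)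
  refine ContinuousAt.continuousWithinAt ?_
  -- Analyticity is used at the base point t by shifting: 𝔢 + t ≥ t > 0 serves as the denominator
  -- and s - t as the small parameter.
  have h := (analyticAt_integral_div_add (ν := torusMeasure d) (ε := fun p => disp p + t)
    (w := vSq vhat) ht (Filter.Eventually.of_forall fun p => le_add_of_nonneg_left (disp_nonneg p))
    ((continuous_disp d).add continuous_const).aestronglyMeasurable
    (hv.integrable_vSq_div ht)).continuousAt
  have h2 : ContinuousAt (fun s : ℝ => s - t) t := by fun_prop
  have h3 := ContinuousAt.comp_of_eq h h2 (sub_self t)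
  refine h3.congr (Filter.Eventually.of_forall fun s => ?_)
  simp [resolventForm, add_assoc]

/-! ### The threshold and the constant ĉ_v -/

/-- The sequence `1 / (n + 1)` used to approach the threshold. -/
theorem tendsto_one_div_nhdsGT : Tendsto (fun n : ℕ => 1 / ((n : ℝ) + 1)) atTop (𝓝[>] 0) :=
  tendsto_nhdsWithin_iff.2 ⟨tendsto_one_div_add_atTop_nhds_zero_nat,
    Filter.Eventually.of_forall fun _ => mem_Ioi.2 Nat.one_div_pos_of_nat⟩

theorem tendsto_lintegral_div_disp_add {d : ℕ} (hd : 1 ≤ d) {w : Mom d → ℝ} (hw : ∀ p, 0 ≤ w p)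
    (hwm : Measurable w) :
    Tendsto (fun n : ℕ => ∫⁻ p, ENNReal.ofReal (w p / (disp p + 1 / ((n : ℝ) + 1))) ∂(torusMeasure d))
      atTop (𝓝 (∫⁻ p, ENNReal.ofReal (w p / disp p) ∂(torusMeasure d))) := by
  refine lintegral_tendsto_of_tendsto_of_monotone (fun n => ?_) ?_ ?_
  · exact (hwm.div ((continuous_disp d).measurable.add_const _)).ennreal_ofReal.aemeasurable
  · filter_upwards [ae_torusMeasure_disp_pos hd] with p hp n m hnm
    have h1 : 0 < 1 / ((m : ℝ) + 1) := Nat.one_div_pos_of_nat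
    have h2 : 1 / ((m : ℝ) + 1) ≤ 1 / ((n : ℝ) + 1) := Nat.one_div_le_one_div hnm
    exact ENNReal.ofReal_le_ofReal (div_le_div_of_nonneg_left (hw p) (by linarith) (by linarith))
  · filter_upwards [ae_torusMeasure_disp_pos hd] with p hp
    refine (ENNReal.continuous_ofReal.tendsto _).comp ?_
    refine tendsto_const_nhds.div ?_ hp.ne'
    simpa using tendsto_const_nhds.add (tendsto_one_div_add_atTop_nhds_zero_nat (𝕜 := ℝ))

theorem tendsto_ofReal_resolventForm {d : ℕ} (hd : 1 ≤ d) {vhat : (Fin d → ℤ) → ℝ}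
    (hv : ExpDecay vhat) :
    Tendsto (fun n : ℕ => ENNReal.ofReal (resolventForm vhat (1 / ((n : ℝ) + 1)))) atTop
      (𝓝 (∫⁻ p, ENNReal.ofReal (vSq vhat p / disp p) ∂(torusMeasure d))) := by
  refine (tendsto_lintegral_div_disp_add hd (vSq_nonneg vhat)
    hv.continuous_vSq.measurable).congr fun n => ?_
  have hn : 0 < 1 / ((n : ℝ) + 1) := Nat.one_div_pos_of_nat
  rw [resolventForm, ofReal_integral_eq_lintegral_ofReal (hv.integrable_vSq_div hn)]
  exact Filter.Eventually.of_forall fun p => div_nonneg (vSq_nonneg _ _)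
    (add_nonneg (disp_nonneg p) hn.le)

theorem lintegral_vSq_div_pos {d : ℕ} (hd : 1 ≤ d) {vhat : (Fin d → ℤ) → ℝ} (hv : ExpDecay vhat)
    (hne : ¬ (vSq vhat =ᵐ[torusMeasure d] 0)) {g : Mom d → ℝ} (hgm : Measurable g)
    (hg : ∀ p, 0 < disp p → 0 < g p) :
    0 < ∫⁻ p, ENNReal.ofReal (vSq vhat p / g p) ∂(torusMeasure d) := by
  rw [pos_iff_ne_zero]
  intro h
  have hm : Measurable fun p => ENNReal.ofReal (vSq vhat p / g p) :=
    (hv.continuous_vSq.measurable.div hgm).ennreal_ofReal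
  rw [lintegral_eq_zero_iff hm] at h
  refine hne ?_
  filter_upwards [h, ae_torusMeasure_disp_pos hd] with p h1 h2
  have h3 := hg p h2
  have h4 : vSq vhat p / g p ≤ 0 := ENNReal.ofReal_eq_zero.1 h1
  have h5 : vSq vhat p ≤ 0 := by
    by_contra hcon
    exact absurd (div_pos (not_le.1 hcon) h3) (not_lt.2 h4)
  exact le_antisymm h5 (vSq_nonneg _ _)

theorem muO_nonneg {d : ℕ} (vhat : (Fin d → ℤ) → ℝ) : 0 ≤ muO vhat := ENNReal.toReal_nonneg

theorem exists_resolventForm_eq {d : ℕ} (hd : 1 ≤ d) {vhat : (Fin d → ℤ) → ℝ} (hv : ExpDecay vhat)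
    (hne : ¬ (vSq vhat =ᵐ[torusMeasure d] 0)) {μ : ℝ} (hμ : muO vhat < μ) :
    ∃ t, 0 < t ∧ μ * resolventForm vhat t = 1 := by
  have hμ0 : 0 < μ := (muO_nonneg vhat).trans_lt hμ
  set L := ∫⁻ p, ENNReal.ofReal (vSq vhat p / disp p) ∂(torusMeasure d) with hL
  have hL0 : 0 < L := lintegral_vSq_div_pos hd hv hne (continuous_disp d).measurable fun p hp => hp
  -- Comparing in `ENNReal` covers L = ∞, where μ_o = 0, together with the finite case; the root
  -- then comes from the intermediate value theorem.
  have hlt : ENNReal.ofReal (1 / μ) < L := by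
    have h1 : L⁻¹ < ENNReal.ofReal μ := by
      rw [ENNReal.lt_ofReal_iff_toReal_lt (ENNReal.inv_ne_top.2 hL0.ne')]
      exact hμ
    rw [one_div, ENNReal.ofReal_inv_of_pos hμ0]
    exact ENNReal.inv_lt_iff_inv_lt.1 h1
  obtain ⟨n, hn⟩ := ((tendsto_ofReal_resolventForm hd hv).eventually_const_lt hlt).exists
  have ha : 0 < 1 / ((n : ℝ) + 1) := Nat.one_div_pos_of_nat
  have hn' : 1 / μ < resolventForm vhat (1 / ((n : ℝ) + 1)) :=
    (ENNReal.ofReal_lt_ofReal_iff (resolventForm_pos hv hne ha)).1 hn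
  obtain ⟨b, hb1, hb2⟩ := (((tendsto_resolventForm_atTop hv).eventually_lt_const
    (one_div_pos.2 hμ0)).and (eventually_ge_atTop (1 / ((n : ℝ) + 1)))).exists
  have hcont : ContinuousOn (resolventForm vhat) (Icc (1 / ((n : ℝ) + 1)) b) :=
    (continuousOn_resolventForm hv).mono fun x hx => ha.trans_le hx.1
  obtain ⟨t, ht, hte⟩ := intermediate_value_Icc' hb2 hcont ⟨hb1.le, hn'.le⟩
  refine ⟨t, ha.trans_le ht.1, ?_⟩
  rw [hte]; field_simp

theorem existsUnique_negative_eigenvalue {d : ℕ} (hd : 1 ≤ d) {vhat : (Fin d → ℤ) → ℝ}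
    (hv : ExpDecay vhat) (hne : ¬ (vSq vhat =ᵐ[torusMeasure d] 0)) {μ : ℝ} (hμ : muO vhat < μ) :
    ∃! z : ℝ, z < 0 ∧ IsEigenvalue vhat μ (z : ℂ) := by
  obtain ⟨t, ht, hte⟩ := exists_resolventForm_eq hd hv hne hμ
  refine ⟨-t, ⟨neg_lt_zero.2 ht, (isEigenvalue_neg_iff hv hne μ ht).2 hte⟩, ?_⟩
  rintro z ⟨hz, hze⟩
  have hz' : 0 < -z := neg_pos.2 hz
  rw [← neg_neg z] at hze
  have h1 := (isEigenvalue_neg_iff hv hne μ hz').1 hze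
  have hμ0 : μ ≠ 0 := ((muO_nonneg vhat).trans_lt hμ).ne'
  have := (strictAntiOn_resolventForm hv hne).injOn hz' ht (mul_left_cancel₀ hμ0 (h1.trans hte.symm))
  linarith

/-- By uniqueness, any positive root t of the scalar equation is -e(μ), so the small roots built by
the implicit function theorem are the eigenvalue. -/
theorem neg_eigenvalue_eq {d : ℕ} (hd : 1 ≤ d) {vhat : (Fin d → ℤ) → ℝ}
    (hv : ExpDecay vhat) (hne : ¬ (vSq vhat =ᵐ[torusMeasure d] 0)) {e : ℝ → ℝ}
    (he : ∀ μ > muO vhat, e μ < 0 ∧ IsEigenvalue vhat μ (e μ : ℂ)) {μ t : ℝ} (hμ : muO vhat < μ)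
    (ht : 0 < t) (h : μ * resolventForm vhat t = 1) : -e μ = t := by
  have := (existsUnique_negative_eigenvalue hd hv hne hμ).unique (he μ hμ)
    ⟨neg_lt_zero.2 ht, (isEigenvalue_neg_iff hv hne μ ht).2 h⟩
  rw [this, neg_neg]

theorem muO_eq_zero_of_tendsto {d : ℕ} (hd : 1 ≤ d) {vhat : (Fin d → ℤ) → ℝ} (hv : ExpDecay vhat)
    (h : Tendsto (resolventForm vhat) (𝓝[>] 0) atTop) : muO vhat = 0 := by
  have h1 := ENNReal.tendsto_ofReal_atTop.comp (h.comp tendsto_one_div_nhdsGT)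
  rw [muO, tendsto_nhds_unique (tendsto_ofReal_resolventForm hd hv) h1]
  simp

theorem lintegral_eq_of_tendsto {d : ℕ} (hd : 1 ≤ d) {vhat : (Fin d → ℤ) → ℝ} (hv : ExpDecay vhat)
    {L : ℝ} (h : Tendsto (resolventForm vhat) (𝓝[>] 0) (𝓝 L)) :
    ∫⁻ p, ENNReal.ofReal (vSq vhat p / disp p) ∂(torusMeasure d) = ENNReal.ofReal L :=
  tendsto_nhds_unique (tendsto_ofReal_resolventForm hd hv)
    ((ENNReal.continuous_ofReal.tendsto L).comp (h.comp tendsto_one_div_nhdsGT))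

theorem measurable_vSq_div_disp {d : ℕ} {vhat : (Fin d → ℤ) → ℝ} (hv : ExpDecay vhat) :
    Measurable fun p => vSq vhat p / disp p :=
  hv.continuous_vSq.measurable.div (continuous_disp d).measurable

theorem vSq_div_disp_nonneg {d : ℕ} (vhat : (Fin d → ℤ) → ℝ) (p : Mom d) :
    0 ≤ vSq vhat p / disp p := div_nonneg (vSq_nonneg _ _) (disp_nonneg p)

/-- A finite limit of the resolvent form at the threshold determines `μ_o` and makes
`|v|² / 𝔢` integrable. -/
theorem threshold_of_tendsto {d : ℕ} (hd : 1 ≤ d) {vhat : (Fin d → ℤ) → ℝ} (hv : ExpDecay vhat)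
    (hne : ¬ (vSq vhat =ᵐ[torusMeasure d] 0)) {L : ℝ}
    (h : Tendsto (resolventForm vhat) (𝓝[>] 0) (𝓝 L)) :
    0 < L ∧ muO vhat = L⁻¹ ∧ Integrable (fun p => vSq vhat p / disp p) (torusMeasure d) ∧
      ∫ p, vSq vhat p / disp p ∂(torusMeasure d) = L := by
  have hl := lintegral_eq_of_tendsto hd hv h
  have hL0 := lintegral_vSq_div_pos hd hv hne (continuous_disp d).measurable fun p hp => hp
  rw [hl] at hL0
  have hL : 0 < L := ENNReal.ofReal_pos.1 hL0
  have hi : Integrable (fun p => vSq vhat p / disp p) (torusMeasure d) := by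
    refine ⟨(measurable_vSq_div_disp hv).aestronglyMeasurable, ?_⟩
    rw [hasFiniteIntegral_iff_ofReal (Filter.Eventually.of_forall (vSq_div_disp_nonneg vhat)), hl]
    exact ENNReal.ofReal_lt_top
  refine ⟨hL, ?_, hi, ?_⟩
  · rw [muO, hl, ENNReal.toReal_inv, ENNReal.toReal_ofReal hL.le]
  · rw [integral_eq_lintegral_of_nonneg_ae (Filter.Eventually.of_forall (vSq_div_disp_nonneg vhat))
      hi.aestronglyMeasurable, hl, ENNReal.toReal_ofReal hL.le]

/-- (L - B(t))/t = ∫ |v|² / (𝔢 (𝔢 + t)), which increases to ĉ_v as t decreases to 0 by monotone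
convergence, finite or not. -/
theorem tendsto_ofReal_difference_quotient {d : ℕ} (hd : 1 ≤ d) {vhat : (Fin d → ℤ) → ℝ}
    (hv : ExpDecay vhat) {L : ℝ}
    (hi : Integrable (fun p => vSq vhat p / disp p) (torusMeasure d))
    (hL : ∫ p, vSq vhat p / disp p ∂(torusMeasure d) = L) :
    Tendsto (fun n : ℕ => ENNReal.ofReal ((L - resolventForm vhat (1 / ((n : ℝ) + 1))) /
      (1 / ((n : ℝ) + 1)))) atTop (𝓝 (cHat vhat)) := by
  have h1 := tendsto_lintegral_div_disp_add hd (vSq_div_disp_nonneg vhat)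
    (measurable_vSq_div_disp hv)
  have h2 : ∫⁻ p, ENNReal.ofReal (vSq vhat p / disp p / disp p) ∂(torusMeasure d) = cHat vhat := by
    simp only [cHat, div_div, sq]
  rw [h2] at h1
  refine h1.congr fun n => ?_
  have hn : 0 < 1 / ((n : ℝ) + 1) := Nat.one_div_pos_of_nat
  set t := 1 / ((n : ℝ) + 1)
  have hintg : Integrable (fun p => vSq vhat p / disp p / (disp p + t)) (torusMeasure d) :=
    integrable_div_add hi ((continuous_disp d).add continuous_const).aestronglyMeasurable hn
      (Filter.Eventually.of_forall fun p => le_add_of_nonneg_left (disp_nonneg p))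
  rw [← ofReal_integral_eq_lintegral_ofReal hintg]
  · congr 1
    rw [← hL, resolventForm, ← integral_sub hi (hv.integrable_vSq_div hn), ← integral_div]
    refine integral_congr_ae ?_
    filter_upwards [ae_torusMeasure_disp_pos hd] with p hp
    have : 0 < disp p + t := by positivity
    field_simp
    ring
  · exact Filter.Eventually.of_forall fun p => div_nonneg (vSq_div_disp_nonneg vhat p)
      (add_nonneg (disp_nonneg p) hn.le)

theorem cHat_eq_of_tendsto {d : ℕ} (hd : 1 ≤ d) {vhat : (Fin d → ℤ) → ℝ}
    (hv : ExpDecay vhat) {L c : ℝ}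
    (hi : Integrable (fun p => vSq vhat p / disp p) (torusMeasure d))
    (hL : ∫ p, vSq vhat p / disp p ∂(torusMeasure d) = L)
    (h : Tendsto (fun t => (L - resolventForm vhat t) / t) (𝓝[>] 0) (𝓝 c)) :
    cHat vhat = ENNReal.ofReal c :=
  tendsto_nhds_unique (tendsto_ofReal_difference_quotient hd hv hi hL)
    ((ENNReal.continuous_ofReal.tendsto c).comp (h.comp tendsto_one_div_nhdsGT))

theorem cHat_eq_top_of_tendsto {d : ℕ} (hd : 1 ≤ d) {vhat : (Fin d → ℤ) → ℝ}
    (hv : ExpDecay vhat) {L : ℝ}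
    (hi : Integrable (fun p => vSq vhat p / disp p) (torusMeasure d))
    (hL : ∫ p, vSq vhat p / disp p ∂(torusMeasure d) = L)
    (h : Tendsto (fun t => (L - resolventForm vhat t) / t) (𝓝[>] 0) atTop) :
    cHat vhat = ⊤ :=
  tendsto_nhds_unique (tendsto_ofReal_difference_quotient hd hv hi hL)
    (ENNReal.tendsto_ofReal_atTop.comp (h.comp tendsto_one_div_nhdsGT))

theorem cHat_pos {d : ℕ} (hd : 1 ≤ d) {vhat : (Fin d → ℤ) → ℝ} (hv : ExpDecay vhat)
    (hne : ¬ (vSq vhat =ᵐ[torusMeasure d] 0)) : 0 < cHat vhat :=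
  lintegral_vSq_div_pos hd hv hne ((continuous_disp d).measurable.pow_const 2)
    fun _ hp => pow_pos hp 2

/-! ### The zero-energy state v/𝔢 -/

theorem aestronglyMeasurable_zeroState {d : ℕ} {vhat : (Fin d → ℤ) → ℝ} (hv : ExpDecay vhat) :
    AEStronglyMeasurable (zeroState vhat) (torusMeasure d) :=
  (hv.continuous_v.measurable.div
    (Complex.measurable_ofReal.comp (continuous_disp d).measurable)).aestronglyMeasurable

theorem memLp_zeroState_iff {d : ℕ} {vhat : (Fin d → ℤ) → ℝ} (hv : ExpDecay vhat) :
    MemLp (zeroState vhat) 2 (torusMeasure d) ↔ cHat vhat < ⊤ := by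
  have hm := aestronglyMeasurable_zeroState hv
  rw [memLp_two_iff_integrable_sq_norm hm, Integrable,
    hasFiniteIntegral_iff_ofReal (Filter.Eventually.of_forall fun p => sq_nonneg _)]
  have : ∀ p, ‖zeroState vhat p‖ ^ 2 = vSq vhat p / disp p ^ 2 := fun p => by
    rw [zeroState, norm_div, div_pow, Complex.norm_real, Real.norm_of_nonneg (disp_nonneg p), vSq]
  simp only [this, cHat]
  exact and_iff_right ((hm.norm.pow 2).congr (Filter.Eventually.of_forall this))

theorem not_ae_eq_zero_zeroState {d : ℕ} (hd : 1 ≤ d) {vhat : (Fin d → ℤ) → ℝ}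
    (hne : ¬ (vSq vhat =ᵐ[torusMeasure d] 0)) : ¬ (zeroState vhat =ᵐ[torusMeasure d] 0) := by
  intro h
  refine not_ae_eq_zero_v hne ?_
  filter_upwards [h, ae_torusMeasure_disp_pos hd] with p h1 h2
  exact (div_eq_zero_iff.1 h1).resolve_right (by exact_mod_cast h2.ne')

theorem conj_v_mul_zeroState {d : ℕ} (vhat : (Fin d → ℤ) → ℝ) (p : Mom d) :
    (starRingEnd ℂ) (v vhat p) * zeroState vhat p = ((vSq vhat p / disp p : ℝ) : ℂ) := by
  rw [zeroState, Complex.ofReal_div, ← conj_mul_v]; ring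

theorem hAct_zeroState {d : ℕ} (hd : 1 ≤ d) {vhat : (Fin d → ℤ) → ℝ} {L : ℝ} (hL : 0 < L)
    (hμ : muO vhat = L⁻¹) (hintg : ∫ p, vSq vhat p / disp p ∂(torusMeasure d) = L) :
    hAct vhat (muO vhat) (zeroState vhat) =ᵐ[torusMeasure d] 0 := by
  filter_upwards [ae_torusMeasure_disp_pos hd] with p hp
  have hp' : (disp p : ℂ) ≠ 0 := by exact_mod_cast hp.ne'
  have hL' : (L : ℂ) ≠ 0 := by exact_mod_cast hL.ne'
  rw [hAct]
  simp only [conj_v_mul_zeroState]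
  rw [integral_complex_ofReal, hintg, hμ, zeroState]
  push_cast
  simp only [Pi.zero_apply]
  field_simp
  ring

/-! ### Singular parts in the variables κ = t^{1/4} and x = t^{1/2} -/

/-- Raising j by 2 multiplies by -t = -κ⁴, so the sign changes every second step; this is the
integer division j / 2. -/
theorem singPart_odd {κ : ℝ} (hκ : 0 < κ) : ∀ j : ℕ,
    singPart (2 * j + 1) (κ ^ 4) = (-1) ^ (j / 2) * (π / (2 * √2)) * κ ^ (2 * (j : ℤ) - 3)
  | 0 => by
    have : (κ ^ 4 : ℝ) ^ (-3 / 4 : ℝ) = κ ^ (-3 : ℤ) := by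
      rw [← Real.rpow_natCast, ← Real.rpow_mul hκ.le, ← Real.rpow_intCast]; norm_num
    simp [singPart, this]
  | 1 => by
    have : (κ ^ 4 : ℝ) ^ (-1 / 4 : ℝ) = κ ^ (-1 : ℤ) := by
      rw [← Real.rpow_natCast, ← Real.rpow_mul hκ.le, ← Real.rpow_intCast]; norm_num
    simp only [singPart, this]; norm_num
  | j + 2 => by
    have h1 : 2 * (j + 2) + 1 = (2 * j + 1) + 4 := by ring
    have h2 : (2 * ((j + 2 : ℕ) : ℤ) - 3) = (2 * (j : ℤ) - 3) + 4 := by push_cast; ring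
    rw [h1, singPart_add_four (by omega), singPart_odd hκ j, h2, zpow_add₀ hκ.ne',
      Nat.add_div_right j two_pos, pow_succ, zpow_ofNat]
    ring

theorem singPart_four_mul_add_two {x : ℝ} (hx : 0 < x) : ∀ j : ℕ,
    singPart (4 * j + 2) (x ^ 2) = (-1) ^ j * (π / 4) * x ^ (2 * (j : ℤ) - 1)
  | 0 => by
    have : (x ^ 2 : ℝ) ^ (-1 / 2 : ℝ) = x ^ (-1 : ℤ) := by
      rw [← Real.rpow_natCast, ← Real.rpow_mul hx.le, ← Real.rpow_intCast]; norm_num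
    simp only [singPart, this]; norm_num
  | j + 1 => by
    have h1 : 4 * (j + 1) + 2 = (4 * j + 2) + 4 := by ring
    have h2 : (2 * ((j + 1 : ℕ) : ℤ) - 1) = (2 * (j : ℤ) - 1) + 2 := by push_cast; ring
    rw [h1, singPart_add_four (by omega), singPart_four_mul_add_two hx j, h2, zpow_add₀ hx.ne',
      pow_succ, zpow_ofNat]
    ring

theorem singPart_four_mul_add_four {x : ℝ} (hx : 0 < x) : ∀ j : ℕ,
    singPart (4 * j + 4) (x ^ 2) = (-1) ^ (j + 1) * (1 / 2) * x ^ (2 * j) * log x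
  | 0 => by
    simp only [singPart, Real.log_pow]; norm_num; ring
  | j + 1 => by
    rw [show 4 * (j + 1) + 4 = (4 * j + 4) + 4 by ring, singPart_add_four (by omega),
      singPart_four_mul_add_four hx j]
    ring

theorem tendsto_nhdsGT_of_comp_pow {X : Type*} {l : Filter X} {B : ℝ → X} {n : ℕ} (hn : n ≠ 0)
    (h : Tendsto (fun x => B (x ^ n)) (𝓝[>] 0) l) : Tendsto B (𝓝[>] 0) l := by
  have hr : Tendsto (fun t : ℝ => t ^ ((n : ℝ)⁻¹)) (𝓝[>] 0) (𝓝[>] 0) := by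
    refine tendsto_nhdsWithin_iff.2 ⟨?_, ?_⟩
    · have := (Real.continuousAt_rpow_const 0 ((n : ℝ)⁻¹) (Or.inr (by positivity))).tendsto
      rw [Real.zero_rpow (by positivity)] at this
      exact this.mono_left nhdsWithin_le_nhds
    · filter_upwards [self_mem_nhdsWithin] with t ht using Real.rpow_pos_of_pos ht _
  refine (h.comp hr).congr' ?_
  filter_upwards [self_mem_nhdsWithin] with t ht
  simp only [Function.comp_apply]
  rw [Real.rpow_inv_natCast_pow (le_of_lt ht) hn]

theorem tendsto_pow_nhdsGT {n : ℕ} (hn : n ≠ 0) :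
    Tendsto (fun x : ℝ => x ^ n) (𝓝[>] 0) (𝓝[>] 0) := by
  refine tendsto_nhdsWithin_iff.2 ⟨?_, ?_⟩
  · have : Tendsto (fun x : ℝ => x ^ n) (𝓝 0) (𝓝 (0 ^ n)) := (continuous_pow n).tendsto 0
    rw [zero_pow hn] at this
    exact this.mono_left nhdsWithin_le_nhds
  · filter_upwards [self_mem_nhdsWithin] with t ht using pow_pos (mem_Ioi.1 ht) n

theorem pow_four_rpow {x : ℝ} (hx : 0 ≤ x) : (x ^ 4) ^ (1 / 4 : ℝ) = x := by
  rw [← Real.rpow_natCast, ← Real.rpow_mul hx]; norm_num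

theorem sq_rpow {x : ℝ} (hx : 0 ≤ x) : (x ^ 2) ^ (1 / 2 : ℝ) = x := by
  rw [← Real.rpow_natCast, ← Real.rpow_mul hx]; norm_num

/-! ### Expansions of the inverse of the resolvent form -/

/-- Setting μ = y^m, the equation μ B = 1 becomes y^{-m} = κ^{-m} E(κ): the rescaled equation with
exponent -m and D = 1. -/
theorem expansion_odd_below {B e : ℝ → ℝ}
    (he : ∀ μ t : ℝ, 0 < μ → 0 < t → μ * B t = 1 → -e μ = t) {m : ℕ} (hm : m ≠ 0) {E : ℝ → ℝ}
    (hE : AnalyticAt ℝ E 0) (hE0 : 0 < E 0)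
    (hB : ∀ᶠ κ in 𝓝[>] (0 : ℝ), B (κ ^ 4) = κ ^ (-(m : ℤ)) * E κ) :
    ∃ c : ℕ → ℝ, c 0 = E 0 ^ (1 / (m : ℝ)) ∧
      ∀ᶠ y in 𝓝[>] (0 : ℝ), HasSum (fun n => c n * y ^ (n + 1)) ((-e (y ^ m)) ^ (1 / 4 : ℝ)) := by
  obtain ⟨c, κ, hc, hκ, h⟩ := exists_solution_odd (m := -(m : ℤ)) (by simpa using hm)
    (analyticAt_const (v := (1 : ℝ))) hE one_pos hE0
  refine ⟨c, ?_, ?_⟩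
  · rw [hc]
    push_cast
    rw [one_div (E 0), Real.inv_rpow hE0.le, one_div, one_div, inv_neg, Real.rpow_neg hE0.le, inv_inv]
  · filter_upwards [h, hκ.eventually hB, hκ.eventually self_mem_nhdsWithin, self_mem_nhdsWithin]
      with y ⟨h1, h2⟩ h3 h4 h5
    have h4' : 0 < κ y := h4
    have h5' : 0 < y := h5
    rw [he (y ^ m) (κ y ^ 4) (pow_pos h5' m) (pow_pos h4' 4) ?_]
    · rwa [pow_four_rpow h4'.le]
    · rw [h3, ← h2, mul_one, zpow_neg, zpow_natCast, mul_inv_cancel₀ (pow_pos h5' m).ne']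

theorem expansion_odd_above {B e : ℝ → ℝ} {L μ₀ : ℝ} (hL : 0 < L) (hμ : μ₀ = L⁻¹)
    (he : ∀ μ t : ℝ, μ₀ < μ → 0 < t → μ * B t = 1 → -e μ = t) {m : ℕ} (hm : m ≠ 0) {E : ℝ → ℝ}
    (hE : AnalyticAt ℝ E 0) (hE0 : 0 < E 0)
    (hB : ∀ᶠ κ in 𝓝[>] (0 : ℝ), L - B (κ ^ 4) = κ ^ m * E κ) :
    ∃ c : ℕ → ℝ, c 0 = (1 / (μ₀ ^ 2 * E 0)) ^ (1 / (m : ℝ)) ∧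
      ∀ᶠ y in 𝓝[>] (0 : ℝ),
        HasSum (fun n => c n * y ^ (n + 1)) ((-e (y ^ m + μ₀)) ^ (1 / 4 : ℝ)) := by
  have hμ0 : 0 < μ₀ := hμ ▸ inv_pos.2 hL
  -- With μ = μ₀ + y^m and L = 1/μ₀, L - 1/μ = y^m / (μ₀ (μ₀ + y^m)); hence this D, with D(0) =
  -- 1/μ₀².
  have hD : AnalyticAt ℝ (fun y : ℝ => 1 / (μ₀ * (μ₀ + y ^ m))) 0 := by
    refine AnalyticAt.div analyticAt_const (by fun_prop) ?_
    rw [zero_pow hm]; positivity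
  have hD0 : 0 < 1 / (μ₀ * (μ₀ + (0 : ℝ) ^ m)) := by rw [zero_pow hm]; positivity
  obtain ⟨c, κ, hc, hκ, h⟩ := exists_solution_odd (m := (m : ℤ)) (by simpa using hm) hD hE hD0 hE0
  refine ⟨c, ?_, ?_⟩
  · rw [hc, zero_pow hm, add_zero, div_div, sq, Int.cast_natCast]
  · filter_upwards [h, hκ.eventually hB, hκ.eventually self_mem_nhdsWithin, self_mem_nhdsWithin]
      with y ⟨h1, h2⟩ h3 h4 h5
    have h4' : 0 < κ y := h4
    have h5' : 0 < y := h5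
    have hym := pow_pos h5' m
    rw [he (y ^ m + μ₀) (κ y ^ 4) (by linarith) (pow_pos h4' 4) ?_]
    · rwa [pow_four_rpow h4'.le]
    · rw [zpow_natCast, zpow_natCast, ← h3] at h2
      have : B (κ y ^ 4) = L - y ^ m * (1 / (μ₀ * (μ₀ + y ^ m))) := by linarith
      rw [this, ← inv_inv L, ← hμ]
      have : μ₀ + y ^ m ≠ 0 := by positivity
      field_simp
      ring

theorem expansion_even_below {B e : ℝ → ℝ}
    (he : ∀ μ t : ℝ, 0 < μ → 0 < t → μ * B t = 1 → -e μ = t) {A L : ℝ → ℝ}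
    (hA : AnalyticAt ℝ A 0) (hL : AnalyticAt ℝ L 0) (hA0 : 0 < A 0)
    (hB : ∀ᶠ x in 𝓝[>] (0 : ℝ), B (x ^ 2) = x⁻¹ * (A x + L x * x * log x)) :
    ∃ c : ℕ × ℕ → ℝ, c (0, 0) = A 0 ∧ ∀ᶠ μ in 𝓝[>] (0 : ℝ),
      HasSum (fun k : ℕ × ℕ => c k * μ ^ (k.1 + 1) * (-(μ * Real.log μ)) ^ k.2)
        ((-e μ) ^ (1 / 2 : ℝ)) := by
  obtain ⟨c, x, hc, hx, h⟩ := exists_solution_even (m := -1) (by norm_num) (k := 1) le_rfl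
    (analyticAt_const (v := (1 : ℝ))) hA hL one_pos hA0
  refine ⟨c, ?_, ?_⟩
  · rw [hc]
    push_cast
    norm_num
    rw [Real.rpow_neg_one, inv_inv]
  · filter_upwards [h, hx.eventually hB, hx.eventually self_mem_nhdsWithin, self_mem_nhdsWithin]
      with y ⟨h1, h2⟩ h3 h4 h5
    have h4' : 0 < x y := h4
    have h5' : 0 < y := h5
    rw [he y (x y ^ 2) h5' (pow_pos h4' 2) ?_]
    · rw [sq_rpow h4'.le]; simpa using h1
    · rw [zpow_neg_one, zpow_neg_one, pow_one, ← h3] at h2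
      rw [← h2, mul_one, mul_inv_cancel₀ h5'.ne']

theorem expansion_even_above {B e : ℝ → ℝ} {Λ μ₀ : ℝ} (hΛ : 0 < Λ) (hμ : μ₀ = Λ⁻¹)
    (he : ∀ μ t : ℝ, μ₀ < μ → 0 < t → μ * B t = 1 → -e μ = t) {m k : ℕ} (hm : m ≠ 0) (hk : 1 ≤ k)
    {A L : ℝ → ℝ} (hA : AnalyticAt ℝ A 0) (hL : AnalyticAt ℝ L 0) (hA0 : 0 < A 0)
    (hB : ∀ᶠ x in 𝓝[>] (0 : ℝ), Λ - B (x ^ 2) = x ^ m * (A x + L x * x ^ k * log x)) :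
    ∃ c : ℕ × ℕ → ℝ, c (0, 0) = (1 / (μ₀ ^ 2 * A 0)) ^ (1 / (m : ℝ)) ∧
      ∀ᶠ y in 𝓝[>] (0 : ℝ),
        HasSum (fun n : ℕ × ℕ => c n * y ^ (n.1 + 1) * (-(y ^ k * Real.log y)) ^ n.2)
          ((-e (y ^ m + μ₀)) ^ (1 / 2 : ℝ)) := by
  have hμ0 : 0 < μ₀ := hμ ▸ inv_pos.2 hΛ
  have hD : AnalyticAt ℝ (fun y : ℝ => 1 / (μ₀ * (μ₀ + y ^ m))) 0 := by
    refine AnalyticAt.div analyticAt_const (by fun_prop) ?_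
    rw [zero_pow hm]; positivity
  have hD0 : 0 < 1 / (μ₀ * (μ₀ + (0 : ℝ) ^ m)) := by rw [zero_pow hm]; positivity
  obtain ⟨c, κ, hc, hκ, h⟩ := exists_solution_even (m := (m : ℤ)) (by simpa using hm) hk hD hA hL
    hD0 hA0
  refine ⟨c, ?_, ?_⟩
  · rw [hc, zero_pow hm, add_zero, div_div, sq, Int.cast_natCast]
  · filter_upwards [h, hκ.eventually hB, hκ.eventually self_mem_nhdsWithin, self_mem_nhdsWithin]
      with y ⟨h1, h2⟩ h3 h4 h5
    have h4' : 0 < κ y := h4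
    have h5' : 0 < y := h5
    have hym := pow_pos h5' m
    rw [he (y ^ m + μ₀) (κ y ^ 2) (by linarith) (pow_pos h4' 2) ?_]
    · rwa [sq_rpow h4'.le]
    · rw [zpow_natCast, zpow_natCast, ← h3] at h2
      have : B (κ y ^ 2) = Λ - y ^ m * (1 / (μ₀ * (μ₀ + y ^ m))) := by linarith
      rw [this, ← inv_inv Λ, ← hμ]
      have : μ₀ + y ^ m ≠ 0 := by positivity
      field_simp
      ring

theorem expansion_even_critical {B e : ℝ → ℝ}
    (he : ∀ μ t : ℝ, 0 < μ → 0 < t → μ * B t = 1 → -e μ = t) {a : ℝ} (ha : 0 < a) {A M : ℝ → ℝ}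
    (hA : AnalyticAt ℝ A 0) (hM : AnalyticAt ℝ M 0)
    (hB : ∀ᶠ x in 𝓝[>] (0 : ℝ), B (x ^ 2) = A x + (-a + x ^ 2 * M x) * log x) :
    ∃ c : ℕ × ℕ → ℝ, 0 < c (0, 0) ∧ ∀ᶠ μ in 𝓝[>] (0 : ℝ),
      HasSum (fun k : ℕ × ℕ => c k * μ ^ (k.1 + 1) *
        (1 / μ * Real.exp (-1 / (a * μ))) ^ (k.2 + 1)) ((-e μ) ^ (1 / 2 : ℝ)) := by
  obtain ⟨c, x, hc, hx, h⟩ := exists_solution_four ha hA hM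
  refine ⟨c, hc, ?_⟩
  filter_upwards [h, hx.eventually hB, hx.eventually self_mem_nhdsWithin, self_mem_nhdsWithin]
    with y ⟨h1, h2⟩ h3 h4 h5
  have h4' : 0 < x y := h4
  have h5' : 0 < y := h5
  rw [he y (x y ^ 2) h5' (pow_pos h4' 2) ?_]
  · rw [sq_rpow h4'.le]; simpa using h1
  · rw [h3, ← h2, mul_one_div_cancel h5'.ne']

theorem expansion_even_resonant {B e : ℝ → ℝ} {Λ μ₀ : ℝ} (hΛ : 0 < Λ) (hμ : μ₀ = Λ⁻¹)
    (he : ∀ μ t : ℝ, μ₀ < μ → 0 < t → μ * B t = 1 → -e μ = t)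
    {A L : ℝ → ℝ} (hA : AnalyticAt ℝ A 0) (hL : AnalyticAt ℝ L 0) (hL0 : L 0 < 0)
    (hB : ∀ᶠ x in 𝓝[>] (0 : ℝ), Λ - B (x ^ 2) = x ^ 2 * (A x + L x * log x)) :
    ∃ c : ℕ × ℕ × ℕ → ℝ, c (0, 0, 0) = (1 / (μ₀ ^ 2 * -L 0)) ^ (1 / 2 : ℝ) ∧
      ∀ᶠ s in 𝓝[>] (0 : ℝ),
        HasSum (fun k : ℕ × ℕ × ℕ => c k * tau s ^ (k.1 + 1) * sigma s ^ (k.2.1 + 1) *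
          eta s ^ k.2.2) ((-e (s + μ₀)) ^ (1 / 2 : ℝ)) := by
  have hμ0 : 0 < μ₀ := hμ ▸ inv_pos.2 hΛ
  have hD : AnalyticAt ℝ (fun y : ℝ => 1 / (μ₀ * (μ₀ + y ^ 2))) 0 := by
    refine AnalyticAt.div analyticAt_const (by fun_prop) ?_
    rw [zero_pow two_ne_zero]; positivity
  have hD0 : 0 < 1 / (μ₀ * (μ₀ + (0 : ℝ) ^ 2)) := by rw [zero_pow two_ne_zero]; positivity
  obtain ⟨c, κ, hc, hκ, h⟩ := exists_solution_eight hD hA hL hD0 hL0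
  refine ⟨c, ?_, ?_⟩
  · rw [hc, zero_pow two_ne_zero, add_zero, div_div, sq]
  · filter_upwards [h, hκ.eventually hB, hκ.eventually self_mem_nhdsWithin, self_mem_nhdsWithin]
      with y ⟨h1, h2⟩ h3 h4 h5
    have h4' : 0 < κ y := h4
    have h5' : 0 < y := h5
    rw [he (y + μ₀) (κ y ^ 2) (by linarith) (pow_pos h4' 2) ?_]
    · rw [sq_rpow h4'.le]; simpa using h1
    · rw [← h3, tau_sq h5'.le] at h2
      have : B (κ y ^ 2) = Λ - y * (1 / (μ₀ * (μ₀ + y))) := by linarith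
      rw [this, ← inv_inv Λ, ← hμ]
      have : μ₀ + y ≠ 0 := by positivity
      field_simp
      ring

/-! ### Local forms of the resolvent form according to N -/

/-- `B` equals `A + φ S_N + ψ S_{N+2}` near `0⁺` with `A`, `φ`, `ψ` analytic at `0`, where
`S_n` is `singPart n`, `A 0 = Λ` and `φ 0 = a`. -/
def HasSingularExpansion (B : ℝ → ℝ) (N : ℕ) (a Λ : ℝ) : Prop :=
  ∃ A φ ψ : ℝ → ℝ, AnalyticAt ℝ A 0 ∧ AnalyticAt ℝ φ 0 ∧ AnalyticAt ℝ ψ 0 ∧ A 0 = Λ ∧ φ 0 = a ∧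
    ∀ᶠ t in 𝓝[>] 0, B t = A t + φ t * singPart N t + ψ t * singPart (N + 2) t

theorem AnalyticAt.exists_eq_add_mul {f : ℝ → ℝ} (hf : AnalyticAt ℝ f 0) :
    ∃ g : ℝ → ℝ, AnalyticAt ℝ g 0 ∧ ∀ t, f t = f 0 + t * g t := by
  obtain ⟨p, hp⟩ := hf
  refine ⟨dslope f 0, ⟨_, hp.has_fpower_series_dslope_fslope⟩, fun t => ?_⟩
  have := sub_smul_dslope f 0 t
  simp only [sub_zero, smul_eq_mul] at this
  rw [this]; ring

theorem AnalyticAt.exists_eq_comp_pow {f : ℝ → ℝ} (hf : AnalyticAt ℝ f 0) {n : ℕ} (hn : n ≠ 0) :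
    ∃ g : ℝ → ℝ, AnalyticAt ℝ g 0 ∧ ∀ x, g x = f (x ^ n) :=
  ⟨_, hf.fun_comp_of_eq (analyticAt_id.fun_pow n) (zero_pow hn), fun _ => rfl⟩

variable {B : ℝ → ℝ} {a Λ : ℝ}

/-- In κ the parts S_N and S_{N+2} are multiples of κ^{2j-3} and κ^{2j-1}, so ψ enters only as a κ²
correction to the coefficient of φ. -/
theorem HasSingularExpansion.odd {j : ℕ} (h : HasSingularExpansion B (2 * j + 1) a Λ) :
    ∃ A F : ℝ → ℝ, AnalyticAt ℝ A 0 ∧ AnalyticAt ℝ F 0 ∧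
      F 0 = (-1) ^ (j / 2) * (π / (2 * √2)) * a ∧
      ∀ᶠ κ in 𝓝[>] 0, B (κ ^ 4) = Λ + κ ^ 4 * A κ + κ ^ (2 * (j : ℤ) - 3) * F κ := by
  obtain ⟨A, φ, ψ, hA, hφ, hψ, rfl, rfl, h⟩ := h
  obtain ⟨A₁, hA₁, hAe⟩ := AnalyticAt.exists_eq_add_mul hA
  obtain ⟨φ', hφ', eφ⟩ := AnalyticAt.exists_eq_comp_pow hφ four_ne_zero
  obtain ⟨ψ', hψ', eψ⟩ := AnalyticAt.exists_eq_comp_pow hψ four_ne_zero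
  obtain ⟨A', hA', eA⟩ := AnalyticAt.exists_eq_comp_pow hA₁ four_ne_zero
  refine ⟨A', fun κ => (-1) ^ (j / 2) * (π / (2 * √2)) * φ' κ +
    (-1) ^ ((j + 1) / 2) * (π / (2 * √2)) * κ ^ 2 * ψ' κ,
    hA', by fun_prop, by simp [eφ], ?_⟩
  filter_upwards [(tendsto_pow_nhdsGT four_ne_zero).eventually h, self_mem_nhdsWithin] with κ h hκ
  have hκ' : 0 < κ := hκ
  have h2 : (2 * ((j + 1 : ℕ) : ℤ) - 3) = (2 * (j : ℤ) - 3) + 2 := by push_cast; ring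
  rw [h, show 2 * j + 1 + 2 = 2 * (j + 1) + 1 by ring, singPart_odd hκ', singPart_odd hκ', hAe, h2,
    zpow_add₀ hκ'.ne', zpow_ofNat, ← eA, ← eφ, ← eψ]
  ring

theorem HasSingularExpansion.odd_lt {j : ℕ} (hj : j ≤ 1)
    (h : HasSingularExpansion B (2 * j + 1) a Λ) :
    ∃ E : ℝ → ℝ, AnalyticAt ℝ E 0 ∧ E 0 = π / (2 * √2) * a ∧
      ∀ᶠ κ in 𝓝[>] 0, B (κ ^ 4) = κ ^ (-((3 - 2 * j : ℕ) : ℤ)) * E κ := by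
  obtain ⟨A, F, hA, hF, hF0, h⟩ := h.odd
  refine ⟨fun κ => κ ^ (3 - 2 * j) * (Λ + κ ^ 4 * A κ) + F κ, by fun_prop, ?_, ?_⟩
  · have : 3 - 2 * j ≠ 0 := by omega
    simp [this, hF0, Nat.div_eq_of_lt (show j < 2 by omega)]
  · filter_upwards [h, self_mem_nhdsWithin] with κ h hκ
    have hκ' : κ ≠ 0 := (mem_Ioi.1 hκ).ne'
    have h2 : (2 * (j : ℤ) - 3) = -((3 - 2 * j : ℕ) : ℤ) := by omega
    rw [h, h2, mul_add, zpow_neg, zpow_natCast, inv_mul_cancel_left₀ (pow_ne_zero _ hκ')]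

/-- The singular power κ^{2j-3} is positive but below κ⁴, so it beats the linear term of the regular
part. Here j / 2 = 1, and its sign makes Λ - B positive to leading order when a > 0. -/
theorem HasSingularExpansion.odd_mid {j : ℕ} (hj : 2 ≤ j) (hj' : j ≤ 3)
    (h : HasSingularExpansion B (2 * j + 1) a Λ) :
    ∃ E : ℝ → ℝ, AnalyticAt ℝ E 0 ∧ E 0 = π / (2 * √2) * a ∧
      ∀ᶠ κ in 𝓝[>] 0, Λ - B (κ ^ 4) = κ ^ (2 * j - 3) * E κ := by
  obtain ⟨A, F, hA, hF, hF0, h⟩ := h.odd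
  refine ⟨fun κ => -(κ ^ (7 - 2 * j) * A κ) - F κ, by fun_prop, ?_, ?_⟩
  · have : 7 - 2 * j ≠ 0 := by omega
    have h2 : j / 2 = 1 := by omega
    simp [this, hF0, h2]
  · filter_upwards [h] with κ h
    have h2 : (2 * (j : ℤ) - 3) = ((2 * j - 3 : ℕ) : ℤ) := by omega
    have h3 : κ ^ 4 = κ ^ (2 * j - 3) * κ ^ (7 - 2 * j) := by rw [← pow_add]; congr 1; omega
    rw [h, h2, zpow_natCast]
    linear_combination (-A κ) * h3

/-- Now 2j - 3 ≥ 5, so the singular part is of higher order than κ⁴ = t and the linear regular term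
leads. -/
theorem HasSingularExpansion.odd_gt {j : ℕ} (hj : 4 ≤ j)
    (h : HasSingularExpansion B (2 * j + 1) a Λ) :
    ∃ E : ℝ → ℝ, AnalyticAt ℝ E 0 ∧ ∀ᶠ κ in 𝓝[>] 0, Λ - B (κ ^ 4) = κ ^ 4 * E κ := by
  obtain ⟨A, F, hA, hF, -, h⟩ := h.odd
  refine ⟨fun κ => -A κ - κ ^ (2 * j - 7) * F κ, by fun_prop, ?_⟩
  filter_upwards [h] with κ h
  have h2 : (2 * (j : ℤ) - 3) = ((2 * j - 3 : ℕ) : ℤ) := by omega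
  have h3 : κ ^ (2 * j - 3) = κ ^ 4 * κ ^ (2 * j - 7) := by rw [← pow_add]; congr 1; omega
  rw [h, h2, zpow_natCast, h3]
  ring

theorem HasSingularExpansion.two (h : HasSingularExpansion B 2 a Λ) :
    ∃ A L : ℝ → ℝ, AnalyticAt ℝ A 0 ∧ AnalyticAt ℝ L 0 ∧ A 0 = π / 4 * a ∧
      ∀ᶠ x in 𝓝[>] 0, B (x ^ 2) = x⁻¹ * (A x + L x * x * log x) := by
  obtain ⟨A, φ, ψ, hA, hφ, hψ, rfl, rfl, h⟩ := h
  obtain ⟨A', hA', eA⟩ := AnalyticAt.exists_eq_comp_pow hA two_ne_zero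
  obtain ⟨φ', hφ', eφ⟩ := AnalyticAt.exists_eq_comp_pow hφ two_ne_zero
  obtain ⟨ψ', hψ', eψ⟩ := AnalyticAt.exists_eq_comp_pow hψ two_ne_zero
  refine ⟨fun x => x * A' x + π / 4 * φ' x, fun x => -(1 / 2) * ψ' x, by fun_prop,
    by fun_prop, by simp [eφ], ?_⟩
  filter_upwards [(tendsto_pow_nhdsGT two_ne_zero).eventually h, self_mem_nhdsWithin] with x h hx
  have hx' : 0 < x := hx
  have h1 := singPart_four_mul_add_two hx' 0
  have h2 := singPart_four_mul_add_four hx' 0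
  norm_num at h1 h2
  rw [h, h1, h2, ← eA, ← eφ, ← eψ]
  field_simp

theorem HasSingularExpansion.four (h : HasSingularExpansion B 4 a Λ) :
    ∃ A M : ℝ → ℝ, AnalyticAt ℝ A 0 ∧ AnalyticAt ℝ M 0 ∧
      ∀ᶠ x in 𝓝[>] 0, B (x ^ 2) = A x + (-(a / 2) + x ^ 2 * M x) * log x := by
  obtain ⟨A, φ, ψ, hA, hφ, hψ, rfl, rfl, h⟩ := h
  -- The constant φ(0) is split off because the exponential ansatz needs a logarithm with exactly
  -- constant coefficient up to x² terms.
  obtain ⟨φ₁, hφ₁, hφe⟩ := AnalyticAt.exists_eq_add_mul hφ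
  obtain ⟨A', hA', eA⟩ := AnalyticAt.exists_eq_comp_pow hA two_ne_zero
  obtain ⟨φ', hφ', eφ⟩ := AnalyticAt.exists_eq_comp_pow hφ₁ two_ne_zero
  obtain ⟨ψ', hψ', eψ⟩ := AnalyticAt.exists_eq_comp_pow hψ two_ne_zero
  refine ⟨fun x => A' x - π / 4 * x * ψ' x, fun x => -(1 / 2) * φ' x, by fun_prop,
    by fun_prop, ?_⟩
  filter_upwards [(tendsto_pow_nhdsGT two_ne_zero).eventually h, self_mem_nhdsWithin] with x h hx
  have hx' : 0 < x := hx
  have h1 := singPart_four_mul_add_four hx' 0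
  have h2 := singPart_four_mul_add_two hx' 1
  norm_num at h1 h2
  rw [h, h1, h2, hφe (x ^ 2), ← eA, ← eφ, ← eψ]
  ring

theorem HasSingularExpansion.six (h : HasSingularExpansion B 6 a Λ) :
    ∃ A L : ℝ → ℝ, AnalyticAt ℝ A 0 ∧ AnalyticAt ℝ L 0 ∧ A 0 = π / 4 * a ∧
      ∀ᶠ x in 𝓝[>] 0, Λ - B (x ^ 2) = x ^ 1 * (A x + L x * x ^ 1 * log x) := by
  obtain ⟨A, φ, ψ, hA, hφ, hψ, rfl, rfl, h⟩ := h
  obtain ⟨A₁, hA₁, hAe⟩ := AnalyticAt.exists_eq_add_mul hA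
  obtain ⟨A', hA', eA⟩ := AnalyticAt.exists_eq_comp_pow hA₁ two_ne_zero
  obtain ⟨φ', hφ', eφ⟩ := AnalyticAt.exists_eq_comp_pow hφ two_ne_zero
  obtain ⟨ψ', hψ', eψ⟩ := AnalyticAt.exists_eq_comp_pow hψ two_ne_zero
  refine ⟨fun x => -(x * A' x) + π / 4 * φ' x, fun x => -(1 / 2) * ψ' x,
    by fun_prop, by fun_prop, by simp [eφ], ?_⟩
  filter_upwards [(tendsto_pow_nhdsGT two_ne_zero).eventually h, self_mem_nhdsWithin] with x h hx
  have hx' : 0 < x := hx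
  have h1 := singPart_four_mul_add_two hx' 1
  have h2 := singPart_four_mul_add_four hx' 1
  norm_num at h1 h2
  rw [h, h1, h2, hAe (x ^ 2), ← eA, ← eφ, ← eψ]
  ring

theorem HasSingularExpansion.eight (h : HasSingularExpansion B 8 a Λ) :
    ∃ A L : ℝ → ℝ, AnalyticAt ℝ A 0 ∧ AnalyticAt ℝ L 0 ∧ L 0 = -(a / 2) ∧
      ∀ᶠ x in 𝓝[>] 0, Λ - B (x ^ 2) = x ^ 2 * (A x + L x * log x) := by
  obtain ⟨A, φ, ψ, hA, hφ, hψ, rfl, rfl, h⟩ := h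
  obtain ⟨A₁, hA₁, hAe⟩ := AnalyticAt.exists_eq_add_mul hA
  obtain ⟨A', hA', eA⟩ := AnalyticAt.exists_eq_comp_pow hA₁ two_ne_zero
  obtain ⟨φ', hφ', eφ⟩ := AnalyticAt.exists_eq_comp_pow hφ two_ne_zero
  obtain ⟨ψ', hψ', eψ⟩ := AnalyticAt.exists_eq_comp_pow hψ two_ne_zero
  refine ⟨fun x => -A' x - π / 4 * x * ψ' x, fun x => -(1 / 2) * φ' x,
    by fun_prop, by fun_prop, by simp [eφ]; ring, ?_⟩
  filter_upwards [(tendsto_pow_nhdsGT two_ne_zero).eventually h, self_mem_nhdsWithin] with x h hx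
  have hx' : 0 < x := hx
  have h1 := singPart_four_mul_add_four hx' 1
  have h2 := singPart_four_mul_add_two hx' 2
  norm_num at h1 h2
  rw [h, h1, h2, hAe (x ^ 2), ← eA, ← eφ, ← eψ]
  norm_cast
  ring

theorem HasSingularExpansion.even_gt {N : ℕ} (hN : 10 ≤ N) (hN' : Even N)
    (h : HasSingularExpansion B N a Λ) :
    ∃ A L : ℝ → ℝ, AnalyticAt ℝ A 0 ∧ AnalyticAt ℝ L 0 ∧
      ∀ᶠ x in 𝓝[>] 0, Λ - B (x ^ 2) = x ^ 2 * (A x + L x * x ^ 2 * log x) := by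
  obtain ⟨A, φ, ψ, hA, hφ, hψ, rfl, rfl, h⟩ := h
  obtain ⟨A₁, hA₁, hAe⟩ := AnalyticAt.exists_eq_add_mul hA
  obtain ⟨A', hA', eA⟩ := AnalyticAt.exists_eq_comp_pow hA₁ two_ne_zero
  obtain ⟨φ', hφ', eφ⟩ := AnalyticAt.exists_eq_comp_pow hφ two_ne_zero
  obtain ⟨ψ', hψ', eψ⟩ := AnalyticAt.exists_eq_comp_pow hψ two_ne_zero
  have hcases : ∃ i, N = 4 * (i + 2) + 2 ∨ N = 4 * (i + 2) + 4 := by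
    obtain ⟨k, rfl⟩ := hN'
    -- Dividing N by 4 gives i + 2 when N ≡ 2 and i + 3 when N ≡ 0 modulo 4, hence the extra unit.
    exact ⟨(k + k) / 4 - 2 - (if (k + k) % 4 = 0 then 1 else 0), by split_ifs <;> omega⟩
  obtain ⟨i, rfl | rfl⟩ := hcases
  · refine ⟨fun x => -A' x - (-1) ^ i * (π / 4) * x ^ (2 * i + 1) * φ' x,
      fun x => (-1) ^ i * (1 / 2) * x ^ (2 * i) * ψ' x, by fun_prop, by fun_prop, ?_⟩
    filter_upwards [(tendsto_pow_nhdsGT two_ne_zero).eventually h, self_mem_nhdsWithin] with x h hx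
    have hx' : 0 < x := hx
    have h1 : (2 * ((i + 2 : ℕ) : ℤ) - 1) = ((2 * i + 3 : ℕ) : ℤ) := by push_cast; ring
    rw [h, singPart_four_mul_add_two hx', show 4 * (i + 2) + 2 + 2 = 4 * (i + 2) + 4 by ring,
      singPart_four_mul_add_four hx', h1, zpow_natCast, hAe (x ^ 2), ← eA, ← eφ, ← eψ]
    ring
  · refine ⟨fun x => -A' x + (-1) ^ i * (π / 4) * x ^ (2 * i + 3) * ψ' x,
      fun x => (-1) ^ i * (1 / 2) * x ^ (2 * i) * φ' x, by fun_prop, by fun_prop, ?_⟩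
    filter_upwards [(tendsto_pow_nhdsGT two_ne_zero).eventually h, self_mem_nhdsWithin] with x h hx
    have hx' : 0 < x := hx
    have h1 : (2 * ((i + 3 : ℕ) : ℤ) - 1) = ((2 * i + 5 : ℕ) : ℤ) := by push_cast; ring
    rw [h, singPart_four_mul_add_four hx', show 4 * (i + 2) + 4 + 2 = 4 * (i + 3) + 2 by ring,
      singPart_four_mul_add_two hx', h1, zpow_natCast, hAe (x ^ 2), ← eA, ← eφ, ← eψ]
    ring

/-! ### Limits at the threshold -/

theorem tendsto_atTop_of_eq_zpow_neg_mul {p m : ℕ} (hp : p ≠ 0) (hm : m ≠ 0) {E : ℝ → ℝ} {E₀ : ℝ}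
    (hE₀ : 0 < E₀) (hE : Tendsto E (𝓝[>] 0) (𝓝 E₀))
    (h : ∀ᶠ x in 𝓝[>] 0, B (x ^ p) = x ^ (-(m : ℤ)) * E x) : Tendsto B (𝓝[>] 0) atTop := by
  refine tendsto_nhdsGT_of_comp_pow hp (Tendsto.congr' (h.mono fun _ h => h.symm) ?_)
  refine Tendsto.atTop_mul_pos hE₀ ?_ hE
  simp only [zpow_neg, zpow_natCast]
  exact tendsto_inv_nhdsGT_zero.comp (tendsto_pow_nhdsGT hm)

theorem tendsto_nhds_of_sub_eq_pow_mul {p m : ℕ} (hp : p ≠ 0) (hm : m ≠ 0) {E : ℝ → ℝ} {E₀ : ℝ}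
    (hE : Tendsto E (𝓝[>] 0) (𝓝 E₀)) (h : ∀ᶠ x in 𝓝[>] 0, Λ - B (x ^ p) = x ^ m * E x) :
    Tendsto B (𝓝[>] 0) (𝓝 Λ) := by
  refine tendsto_nhdsGT_of_comp_pow hp ?_
  have h1 : Tendsto (fun x => Λ - x ^ m * E x) (𝓝[>] 0) (𝓝 (Λ - 0 * E₀)) :=
    tendsto_const_nhds.sub (((tendsto_pow_nhdsGT hm).mono_right nhdsWithin_le_nhds).mul hE)
  rw [zero_mul, sub_zero] at h1
  refine h1.congr' (h.mono fun x h => ?_)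
  rw [← h]; ring

theorem tendsto_quotient_atTop_of_sub_eq_pow_mul {p m : ℕ} (hmp : m < p) {E : ℝ → ℝ}
    {E₀ : ℝ} (hE₀ : 0 < E₀) (hE : Tendsto E (𝓝[>] 0) (𝓝 E₀))
    (h : ∀ᶠ x in 𝓝[>] 0, Λ - B (x ^ p) = x ^ m * E x) :
    Tendsto (fun t => (Λ - B t) / t) (𝓝[>] 0) atTop := by
  refine tendsto_atTop_of_eq_zpow_neg_mul (m := p - m) (p := p) (by omega) (by omega) hE₀ hE ?_
  filter_upwards [h, self_mem_nhdsWithin] with x h hx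
  have hx' : x ≠ 0 := (mem_Ioi.1 hx).ne'
  have : x ^ p = x ^ m * x ^ (p - m) := by rw [← pow_add]; congr 1; omega
  rw [h, this, zpow_neg, zpow_natCast]
  field_simp

theorem tendsto_quotient_nhds_of_sub_eq_pow_mul {p : ℕ} (hp : p ≠ 0) {E : ℝ → ℝ}
    {E₀ : ℝ} (hE : Tendsto E (𝓝[>] 0) (𝓝 E₀))
    (h : ∀ᶠ x in 𝓝[>] 0, Λ - B (x ^ p) = x ^ p * E x) :
    Tendsto (fun t => (Λ - B t) / t) (𝓝[>] 0) (𝓝 E₀) := by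
  refine tendsto_nhdsGT_of_comp_pow hp (hE.congr' ?_)
  filter_upwards [h, self_mem_nhdsWithin] with x h hx
  have hx' : x ≠ 0 := (mem_Ioi.1 hx).ne'
  rw [h]
  field_simp

theorem AnalyticAt.tendsto_nhdsGT {f : ℝ → ℝ} (hf : AnalyticAt ℝ f 0) :
    Tendsto f (𝓝[>] 0) (𝓝 (f 0)) := hf.continuousAt.tendsto.mono_left nhdsWithin_le_nhds

theorem tendsto_add_mul_pow_mul_log {A L : ℝ → ℝ} (hA : AnalyticAt ℝ A 0) (hL : AnalyticAt ℝ L 0)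
    {k : ℕ} (hk : 1 ≤ k) :
    Tendsto (fun x => A x + L x * x ^ k * log x) (𝓝[>] 0) (𝓝 (A 0)) := by
  have := (AnalyticAt.tendsto_nhdsGT hA).add ((AnalyticAt.tendsto_nhdsGT hL).mul
    (tendsto_pow_mul_log_nhdsGT_zero hk))
  rw [mul_zero, add_zero] at this
  exact this.congr fun x => by ring

theorem HasSingularExpansion.tendsto_atTop {N : ℕ} (hN : 1 ≤ N) (hN' : N ≤ 4) (ha : 0 < a)
    (h : HasSingularExpansion B N a Λ) : Tendsto B (𝓝[>] 0) atTop := by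
  interval_cases N
  · obtain ⟨E, hE, hE0, h⟩ := HasSingularExpansion.odd_lt (j := 0) (by norm_num) h
    exact tendsto_atTop_of_eq_zpow_neg_mul four_ne_zero (by norm_num) (hE0 ▸ by positivity)
      (AnalyticAt.tendsto_nhdsGT hE) h
  · obtain ⟨A, L, hA, hL, hA0, h⟩ := h.two
    refine tendsto_atTop_of_eq_zpow_neg_mul (m := 1) two_ne_zero (by norm_num) (hA0 ▸ by positivity)
      (tendsto_add_mul_pow_mul_log hA hL le_rfl) (h.mono fun x h => ?_)
    rw [h]; norm_num
  · obtain ⟨E, hE, hE0, h⟩ := HasSingularExpansion.odd_lt (j := 1) (by norm_num) h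
    exact tendsto_atTop_of_eq_zpow_neg_mul four_ne_zero (by norm_num) (hE0 ▸ by positivity)
      (AnalyticAt.tendsto_nhdsGT hE) h
  · obtain ⟨A, M, hA, hM, h⟩ := h.four
    refine tendsto_nhdsGT_of_comp_pow two_ne_zero (Tendsto.congr' (h.mono fun _ h => h.symm) ?_)
    refine (AnalyticAt.tendsto_nhdsGT hA).add_atTop ?_
    have h1 : AnalyticAt ℝ (fun x => -(a / 2) + x ^ 2 * M x) 0 := by fun_prop
    refine Tendsto.neg_mul_atBot (C := -(a / 2)) (by linarith) ?_ Real.tendsto_log_nhdsGT_zero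
    simpa using AnalyticAt.tendsto_nhdsGT h1

theorem HasSingularExpansion.eight_tendsto (h : HasSingularExpansion B 8 a Λ) (ha : 0 < a) :
    Tendsto B (𝓝[>] 0) (𝓝 Λ) ∧ Tendsto (fun t => (Λ - B t) / t) (𝓝[>] 0) atTop := by
  obtain ⟨A, L, hA, hL, hL0, h⟩ := h.eight
  constructor
  -- The factor A + L log x itself diverges; one power of x is moved inside so that it has a limit.
  · have h1 : AnalyticAt ℝ (fun x => x * A x) 0 := by fun_prop
    refine tendsto_nhds_of_sub_eq_pow_mul two_ne_zero one_ne_zero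
      (tendsto_add_mul_pow_mul_log h1 hL le_rfl) (h.mono fun x h => ?_)
    rw [h]; ring
  · refine tendsto_nhdsGT_of_comp_pow two_ne_zero ?_
    have h1 : Tendsto (fun x => A x + L x * log x) (𝓝[>] 0) atTop :=
      (AnalyticAt.tendsto_nhdsGT hA).add_atTop (Tendsto.neg_mul_atBot (C := L 0)
        (by rw [hL0]; linarith) (AnalyticAt.tendsto_nhdsGT hL) Real.tendsto_log_nhdsGT_zero)
    refine h1.congr' ?_
    filter_upwards [h, self_mem_nhdsWithin] with x h hx
    have hx' : x ≠ 0 := (mem_Ioi.1 hx).ne'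
    rw [h]
    field_simp

theorem HasSingularExpansion.tendsto_mid {N : ℕ} (hN : 5 ≤ N) (hN' : N ≤ 8) (ha : 0 < a)
    (h : HasSingularExpansion B N a Λ) :
    Tendsto B (𝓝[>] 0) (𝓝 Λ) ∧ Tendsto (fun t => (Λ - B t) / t) (𝓝[>] 0) atTop := by
  interval_cases N
  · obtain ⟨E, hE, hE0, h⟩ := HasSingularExpansion.odd_mid (j := 2) (by norm_num) (by norm_num) h
    exact ⟨tendsto_nhds_of_sub_eq_pow_mul four_ne_zero (by norm_num)
      (AnalyticAt.tendsto_nhdsGT hE) h, tendsto_quotient_atTop_of_sub_eq_pow_mul (by norm_num)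
      (hE0 ▸ by positivity) (AnalyticAt.tendsto_nhdsGT hE) h⟩
  · obtain ⟨A, L, hA, hL, hA0, h⟩ := h.six
    have h1 := tendsto_add_mul_pow_mul_log hA hL le_rfl
    exact ⟨tendsto_nhds_of_sub_eq_pow_mul two_ne_zero one_ne_zero h1 h,
      tendsto_quotient_atTop_of_sub_eq_pow_mul one_lt_two (hA0 ▸ by positivity) h1 h⟩
  · obtain ⟨E, hE, hE0, h⟩ := HasSingularExpansion.odd_mid (j := 3) (by norm_num) (by norm_num) h
    exact ⟨tendsto_nhds_of_sub_eq_pow_mul four_ne_zero (by norm_num)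
      (AnalyticAt.tendsto_nhdsGT hE) h, tendsto_quotient_atTop_of_sub_eq_pow_mul (by norm_num)
      (hE0 ▸ by positivity) (AnalyticAt.tendsto_nhdsGT hE) h⟩
  · exact h.eight_tendsto ha

theorem HasSingularExpansion.tendsto_gt {N : ℕ} (hN : 9 ≤ N) (h : HasSingularExpansion B N a Λ) :
    Tendsto B (𝓝[>] 0) (𝓝 Λ) ∧ ∃ c, Tendsto (fun t => (Λ - B t) / t) (𝓝[>] 0) (𝓝 c) := by
  obtain hev | ⟨j, rfl⟩ := Nat.even_or_odd N
  · obtain ⟨A, L, hA, hL, h⟩ := h.even_gt (by obtain ⟨k, rfl⟩ := hev; omega) hev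
    have h1 := tendsto_add_mul_pow_mul_log hA hL one_le_two
    exact ⟨tendsto_nhds_of_sub_eq_pow_mul two_ne_zero two_ne_zero h1 h, _,
      tendsto_quotient_nhds_of_sub_eq_pow_mul two_ne_zero h1 h⟩
  · obtain ⟨E, hE, h⟩ := h.odd_gt (by omega)
    exact ⟨tendsto_nhds_of_sub_eq_pow_mul four_ne_zero four_ne_zero
      (AnalyticAt.tendsto_nhdsGT hE) h, _,
      tendsto_quotient_nhds_of_sub_eq_pow_mul four_ne_zero (AnalyticAt.tendsto_nhdsGT hE) h⟩

theorem exists_hasSingularExpansion_resolventForm {d : ℕ} (hd : 1 ≤ d) {vhat : (Fin d → ℤ) → ℝ}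
    (hv : ExpDecay vhat) {n₀ : ℕ}
    (hvanish : ∀ j < n₀, iteratedFDeriv ℝ (2 * j) (vSq vhat) 0 = 0) :
    ∃ Λ, HasSingularExpansion (resolventForm vhat) (2 * n₀ + d) (cV vhat n₀ / √2 ^ (2 * n₀ + d))
      Λ := by
  obtain ⟨A, φ, ψ, hA, hφ, hψ, hφ0, h⟩ := exists_resolventForm_structure hd hv hvanish
  exact ⟨A 0, A, φ, ψ, hA, hφ, hψ, rfl, hφ0, h⟩

/-! ### Passing to μ - μ_o and to fractional powers -/

theorem eventually_sub_of_eventually {P : ℝ → Prop} {μ₀ : ℝ}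
    (h : ∀ᶠ s in 𝓝[>] 0, P s) : ∀ᶠ μ in 𝓝[>] μ₀, P (μ - μ₀) := by
  have : Tendsto (fun μ => μ - μ₀) (𝓝[>] μ₀) (𝓝[>] 0) := by
    refine tendsto_nhdsWithin_iff.2 ⟨?_, ?_⟩
    · have h : Tendsto (fun μ => μ - μ₀) (𝓝 μ₀) (𝓝 (μ₀ - μ₀)) :=
        (continuous_sub_right μ₀).tendsto μ₀
      rw [sub_self] at h
      exact h.mono_left nhdsWithin_le_nhds
    · filter_upwards [self_mem_nhdsWithin] with μ hμ using mem_Ioi.2 (sub_pos.2 hμ)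
  exact this.eventually h

theorem eventually_rpow_of_eventually {P : ℝ → ℝ → Prop} {m : ℕ} (hm : m ≠ 0)
    (h : ∀ᶠ y in 𝓝[>] (0 : ℝ), P y (y ^ m)) : ∀ᶠ s in 𝓝[>] (0 : ℝ), P (s ^ (1 / (m : ℝ))) s := by
  have hr : Tendsto (fun t : ℝ => t ^ (1 / (m : ℝ))) (𝓝[>] 0) (𝓝[>] 0) := by
    refine tendsto_nhdsWithin_iff.2 ⟨?_, ?_⟩
    · have := (Real.continuousAt_rpow_const 0 (1 / (m : ℝ)) (Or.inr (by positivity))).tendsto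
      rw [Real.zero_rpow (by positivity)] at this
      exact this.mono_left nhdsWithin_le_nhds
    · filter_upwards [self_mem_nhdsWithin] with t ht using Real.rpow_pos_of_pos ht _
  filter_upwards [hr.eventually h, self_mem_nhdsWithin] with s hs hs0
  rwa [one_div, Real.rpow_inv_natCast_pow (le_of_lt hs0) hm, ← one_div] at hs

theorem rpow_one_div_pow {s : ℝ} (hs : 0 ≤ s) (m n : ℕ) :
    (s ^ (1 / (m : ℝ))) ^ (n + 1) = s ^ (((n : ℝ) + 1) / m) := by
  rw [← Real.rpow_natCast, ← Real.rpow_mul hs]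
  congr 1
  push_cast
  ring

/-- Change of variable `y = s^{1/m}` in a power series expansion. -/
theorem eventually_hasSum_rpow {c : ℕ → ℝ} {f : ℝ → ℝ} {m : ℕ} (hm : m ≠ 0)
    (h : ∀ᶠ y in 𝓝[>] (0 : ℝ), HasSum (fun n => c n * y ^ (n + 1)) (f (y ^ m))) :
    ∀ᶠ s in 𝓝[>] (0 : ℝ), HasSum (fun n : ℕ => c n * s ^ (((n : ℝ) + 1) / m)) (f s) := by
  filter_upwards [eventually_rpow_of_eventually (P := fun y s => HasSum (fun n => c n * y ^ (n + 1))
    (f s)) hm h, self_mem_nhdsWithin] with s hs hs0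
  simpa only [rpow_one_div_pow (le_of_lt hs0)] using hs

theorem sqrt_two_pow_two_mul (k : ℕ) : √2 ^ (2 * k) = 2 ^ k := by
  rw [pow_mul, Real.sq_sqrt zero_le_two]

theorem pi_div_mul_div_sqrt_two_pow (k : ℕ) (x : ℝ) :
    π / (2 * √2) * (x / √2 ^ (2 * k + 1)) = π * x / (4 * 2 ^ k) := by
  rw [pow_succ, sqrt_two_pow_two_mul]
  have h : √2 * √2 = 2 := Real.mul_self_sqrt zero_le_two
  have h0 : √2 ≠ 0 := by positivity
  rw [div_mul_div_comm, show 2 * √2 * (2 ^ k * √2) = 4 * 2 ^ k by linear_combination 2 * 2 ^ k * h]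

/-! ### The ten expansions and their leading constants -/

section expansions

variable {d : ℕ} {vhat : (Fin d → ℤ) → ℝ} {n₀ : ℕ} {e : ℝ → ℝ} {Λ : ℝ}

theorem expansion_one (hN : 2 * n₀ + d = 1) (hc : 0 < cV vhat n₀)
    (h : HasSingularExpansion (resolventForm vhat) (2 * n₀ + d) (cV vhat n₀ / √2 ^ (2 * n₀ + d)) Λ)
    (he : ∀ μ t : ℝ, 0 < μ → 0 < t → μ * resolventForm vhat t = 1 → -e μ = t) :
    ∃ c : ℕ → ℝ, c 0 = (π * cV vhat n₀ / 4) ^ (1 / 3 : ℝ) ∧ ∀ᶠ μ in 𝓝[>] (0 : ℝ),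
      HasSum (fun n : ℕ => c n * μ ^ (((n : ℝ) + 1) / 3)) ((-e μ) ^ (1 / 4 : ℝ)) := by
  rw [hN] at h
  obtain ⟨E, hE, hE0, hB⟩ := HasSingularExpansion.odd_lt (j := 0) (by norm_num) h
  have := pi_div_mul_div_sqrt_two_pow 0 (cV vhat n₀)
  norm_num at this hE0
  rw [this] at hE0
  obtain ⟨c, hc0, hs⟩ := expansion_odd_below he three_ne_zero hE (hE0 ▸ by positivity) hB
  refine ⟨c, by rw [hc0, hE0]; norm_num, ?_⟩
  exact_mod_cast eventually_hasSum_rpow (f := fun μ => (-e μ) ^ (1 / 4 : ℝ)) three_ne_zero hs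

theorem expansion_three (hN : 2 * n₀ + d = 3) (hc : 0 < cV vhat n₀)
    (h : HasSingularExpansion (resolventForm vhat) (2 * n₀ + d) (cV vhat n₀ / √2 ^ (2 * n₀ + d)) Λ)
    (he : ∀ μ t : ℝ, 0 < μ → 0 < t → μ * resolventForm vhat t = 1 → -e μ = t) :
    ∃ c : ℕ → ℝ, c 0 = π * cV vhat n₀ / 8 ∧ ∀ᶠ μ in 𝓝[>] (0 : ℝ),
      HasSum (fun n : ℕ => c n * μ ^ (n + 1)) ((-e μ) ^ (1 / 4 : ℝ)) := by
  rw [hN] at h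
  obtain ⟨E, hE, hE0, hB⟩ := HasSingularExpansion.odd_lt (j := 1) (by norm_num) h
  rw [show 3 = 2 * 1 + 1 by norm_num, pi_div_mul_div_sqrt_two_pow 1] at hE0
  norm_num at hE0
  obtain ⟨c, hc0, hs⟩ := expansion_odd_below (m := 1) he one_ne_zero hE (hE0 ▸ by positivity) hB
  refine ⟨c, by rw [hc0, hE0]; norm_num, ?_⟩
  simpa only [pow_one] using hs

theorem expansion_five (hN : 2 * n₀ + d = 5) (hc : 0 < cV vhat n₀) (hΛ : 0 < Λ)
    (hμ : muO vhat = Λ⁻¹)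
    (h : HasSingularExpansion (resolventForm vhat) (2 * n₀ + d) (cV vhat n₀ / √2 ^ (2 * n₀ + d)) Λ)
    (he : ∀ μ t : ℝ, muO vhat < μ → 0 < t → μ * resolventForm vhat t = 1 → -e μ = t) :
    ∃ c : ℕ → ℝ, c 0 = 16 / (π * cV vhat n₀ * muO vhat ^ 2) ∧ ∀ᶠ μ in 𝓝[>] (muO vhat),
      HasSum (fun n : ℕ => c n * (μ - muO vhat) ^ (n + 1)) ((-e μ) ^ (1 / 4 : ℝ)) := by
  rw [hN] at h
  obtain ⟨E, hE, hE0, hB⟩ :=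
    HasSingularExpansion.odd_mid (j := 2) (by norm_num) (by norm_num) h
  rw [show 5 = 2 * 2 + 1 by norm_num, pi_div_mul_div_sqrt_two_pow 2] at hE0
  norm_num at hE0
  obtain ⟨c, hc0, hs⟩ := expansion_odd_above (m := 1) hΛ hμ he one_ne_zero hE (hE0 ▸ by positivity)
    hB
  refine ⟨c, ?_, ?_⟩
  · rw [hc0, hE0]
    norm_num
    ring
  · simpa using eventually_sub_of_eventually (μ₀ := muO vhat) hs

theorem expansion_seven (hN : 2 * n₀ + d = 7) (hc : 0 < cV vhat n₀) (hΛ : 0 < Λ)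
    (hμ : muO vhat = Λ⁻¹)
    (h : HasSingularExpansion (resolventForm vhat) (2 * n₀ + d) (cV vhat n₀ / √2 ^ (2 * n₀ + d)) Λ)
    (he : ∀ μ t : ℝ, muO vhat < μ → 0 < t → μ * resolventForm vhat t = 1 → -e μ = t) :
    ∃ c : ℕ → ℝ, c 0 = (32 / (π * cV vhat n₀ * muO vhat ^ 2)) ^ (1 / 3 : ℝ) ∧
      ∀ᶠ μ in 𝓝[>] (muO vhat),
        HasSum (fun n : ℕ => c n * (μ - muO vhat) ^ (((n : ℝ) + 1) / 3))
          ((-e μ) ^ (1 / 4 : ℝ)) := by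
  rw [hN] at h
  obtain ⟨E, hE, hE0, hB⟩ :=
    HasSingularExpansion.odd_mid (j := 3) (by norm_num) (by norm_num) h
  rw [show 7 = 2 * 3 + 1 by norm_num, pi_div_mul_div_sqrt_two_pow 3] at hE0
  norm_num at hE0
  obtain ⟨c, hc0, hs⟩ := expansion_odd_above (m := 3) hΛ hμ he three_ne_zero hE
    (hE0 ▸ by positivity) hB
  refine ⟨c, ?_, ?_⟩
  · rw [hc0, hE0]
    congr 1
    have := (hμ ▸ inv_pos.2 hΛ : 0 < muO vhat)
    field_simp
  · have h1 := eventually_hasSum_rpow (f := fun s => (-e (s + muO vhat)) ^ (1 / 4 : ℝ))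
      three_ne_zero hs
    simpa using eventually_sub_of_eventually (μ₀ := muO vhat) h1

theorem expansion_odd_gt (hN : 9 ≤ 2 * n₀ + d) (hodd : Odd d) (hΛ : 0 < Λ) (hμ : muO vhat = Λ⁻¹)
    (h : HasSingularExpansion (resolventForm vhat) (2 * n₀ + d) (cV vhat n₀ / √2 ^ (2 * n₀ + d)) Λ)
    (hpos : 0 < cHat vhat)
    (hhat : ∀ c, Tendsto (fun t => (Λ - resolventForm vhat t) / t) (𝓝[>] 0) (𝓝 c) →
      cHat vhat = ENNReal.ofReal c)
    (he : ∀ μ t : ℝ, muO vhat < μ → 0 < t → μ * resolventForm vhat t = 1 → -e μ = t) :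
    ∃ c : ℕ → ℝ, c 0 = (muO vhat ^ 2 * (cHat vhat).toReal) ^ (-1 / 4 : ℝ) ∧
      ∀ᶠ μ in 𝓝[>] (muO vhat),
        HasSum (fun n : ℕ => c n * (μ - muO vhat) ^ (((n : ℝ) + 1) / 4))
          ((-e μ) ^ (1 / 4 : ℝ)) := by
  obtain ⟨k, rfl⟩ := hodd
  rw [show 2 * n₀ + (2 * k + 1) = 2 * (n₀ + k) + 1 by ring] at h
  obtain ⟨E, hE, hB⟩ := h.odd_gt (by omega)
  -- The leading coefficient E(0) is the limit of (Λ - B(t))/t, hence ĉ_v; its positivity follows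
  -- from that of ĉ_v.
  have hE0 := hhat _ (tendsto_quotient_nhds_of_sub_eq_pow_mul four_ne_zero
    (AnalyticAt.tendsto_nhdsGT hE) hB)
  rw [hE0] at hpos
  have hpos' := ENNReal.ofReal_pos.1 hpos
  have hμ0 : 0 < muO vhat := hμ ▸ inv_pos.2 hΛ
  obtain ⟨c, hc0, hs⟩ := expansion_odd_above (m := 4) hΛ hμ he four_ne_zero hE hpos' hB
  refine ⟨c, ?_, ?_⟩
  · rw [hc0, hE0, ENNReal.toReal_ofReal hpos'.le, neg_div, Real.rpow_neg (by positivity), one_div,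
      Real.inv_rpow (by positivity)]
    norm_num
  · have h1 := eventually_hasSum_rpow (f := fun s => (-e (s + muO vhat)) ^ (1 / 4 : ℝ))
      four_ne_zero hs
    simpa using eventually_sub_of_eventually (μ₀ := muO vhat) h1

theorem expansion_two (hN : 2 * n₀ + d = 2) (hc : 0 < cV vhat n₀)
    (h : HasSingularExpansion (resolventForm vhat) (2 * n₀ + d) (cV vhat n₀ / √2 ^ (2 * n₀ + d)) Λ)
    (he : ∀ μ t : ℝ, 0 < μ → 0 < t → μ * resolventForm vhat t = 1 → -e μ = t) :
    ∃ c : ℕ × ℕ → ℝ, c (0, 0) = π * cV vhat n₀ / 8 ∧ ∀ᶠ μ in 𝓝[>] (0 : ℝ),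
      HasSum (fun k : ℕ × ℕ => c k * μ ^ (k.1 + 1) * (-(μ * Real.log μ)) ^ k.2)
        ((-e μ) ^ (1 / 2 : ℝ)) := by
  rw [hN] at h
  obtain ⟨A, L, hA, hL, hA0, hB⟩ := h.two
  obtain ⟨c, hc0, hs⟩ := expansion_even_below he hA hL (hA0 ▸ by positivity) hB
  refine ⟨c, ?_, hs⟩
  rw [hc0, hA0, Real.sq_sqrt zero_le_two]
  ring

theorem expansion_four (hN : 2 * n₀ + d = 4) (hc : 0 < cV vhat n₀)
    (h : HasSingularExpansion (resolventForm vhat) (2 * n₀ + d) (cV vhat n₀ / √2 ^ (2 * n₀ + d)) Λ)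
    (he : ∀ μ t : ℝ, 0 < μ → 0 < t → μ * resolventForm vhat t = 1 → -e μ = t) :
    ∃ c : ℕ × ℕ → ℝ, 0 < c (0, 0) ∧ ∀ᶠ μ in 𝓝[>] (0 : ℝ),
      HasSum (fun k : ℕ × ℕ => c k * μ ^ (k.1 + 1) *
        (1 / μ * Real.exp (-1 / (cV vhat n₀ / 8 * μ))) ^ (k.2 + 1)) ((-e μ) ^ (1 / 2 : ℝ)) := by
  rw [hN] at h
  obtain ⟨A, M, hA, hM, hB⟩ := h.four
  have ha : cV vhat n₀ / √2 ^ 4 / 2 = cV vhat n₀ / 8 := by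
    rw [show 4 = 2 * 2 by norm_num, sqrt_two_pow_two_mul]; ring
  rw [ha] at hB
  exact expansion_even_critical he (by positivity) hA hM hB

theorem neg_mul_log_eq_two_mul_theta {s : ℝ} (hs : 0 < s) : -(s * log s) = 2 * theta s := by
  rw [theta, tau_sq hs.le, tau, Real.log_rpow hs]
  ring

theorem expansion_six (hN : 2 * n₀ + d = 6) (hc : 0 < cV vhat n₀) (hΛ : 0 < Λ)
    (hμ : muO vhat = Λ⁻¹)
    (h : HasSingularExpansion (resolventForm vhat) (2 * n₀ + d) (cV vhat n₀ / √2 ^ (2 * n₀ + d)) Λ)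
    (he : ∀ μ t : ℝ, muO vhat < μ → 0 < t → μ * resolventForm vhat t = 1 → -e μ = t) :
    ∃ c : ℕ × ℕ → ℝ, c (0, 0) = 32 / (π * cV vhat n₀ * muO vhat ^ 2) ∧
      ∀ᶠ μ in 𝓝[>] (muO vhat), HasSum (fun k : ℕ × ℕ =>
        c k * tau (μ - muO vhat) ^ (2 * k.1 + 2) * theta (μ - muO vhat) ^ k.2)
          ((-e μ) ^ (1 / 2 : ℝ)) := by
  rw [hN] at h
  obtain ⟨A, L, hA, hL, hA0, hB⟩ := h.six
  obtain ⟨c, hc0, hs⟩ := expansion_even_above hΛ hμ he one_ne_zero le_rfl hA hL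
    (hA0 ▸ by positivity) hB
  -- Here the series variable is s itself, and -s log s = 2θ; the powers of 2 are absorbed into the
  -- coefficients.
  refine ⟨fun k => c k * 2 ^ k.2, ?_, ?_⟩
  · simp only
    rw [hc0, hA0, show 6 = 2 * 3 by norm_num, sqrt_two_pow_two_mul]
    norm_num
    ring
  · have h1 : ∀ᶠ s in 𝓝[>] (0 : ℝ), HasSum (fun k : ℕ × ℕ => c k * 2 ^ k.2 *
        tau s ^ (2 * k.1 + 2) * theta s ^ k.2) ((-e (s + muO vhat)) ^ (1 / 2 : ℝ)) := by
      filter_upwards [hs, self_mem_nhdsWithin] with s hs hs0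
      have hs0' : 0 < s := hs0
      rw [pow_one] at hs
      convert hs using 1
      ext k
      rw [show 2 * k.1 + 2 = 2 * (k.1 + 1) by ring, pow_mul, tau_sq hs0'.le,
        neg_mul_log_eq_two_mul_theta hs0', mul_pow]
      ring
    simpa using eventually_sub_of_eventually (μ₀ := muO vhat) h1

theorem expansion_eight (hN : 2 * n₀ + d = 8) (hc : 0 < cV vhat n₀) (hΛ : 0 < Λ)
    (hμ : muO vhat = Λ⁻¹)
    (h : HasSingularExpansion (resolventForm vhat) (2 * n₀ + d) (cV vhat n₀ / √2 ^ (2 * n₀ + d)) Λ)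
    (he : ∀ μ t : ℝ, muO vhat < μ → 0 < t → μ * resolventForm vhat t = 1 → -e μ = t) :
    ∃ c : ℕ × ℕ × ℕ → ℝ, c (0, 0, 0) = (32 / (cV vhat n₀ * muO vhat ^ 2)) ^ (1 / 2 : ℝ) ∧
      ∀ᶠ μ in 𝓝[>] (muO vhat), HasSum (fun k : ℕ × ℕ × ℕ =>
        c k * tau (μ - muO vhat) ^ (k.1 + 1) * sigma (μ - muO vhat) ^ (k.2.1 + 1) *
          eta (μ - muO vhat) ^ k.2.2) ((-e μ) ^ (1 / 2 : ℝ)) := by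
  rw [hN] at h
  obtain ⟨A, L, hA, hL, hL0, hB⟩ := h.eight
  rw [show 8 = 2 * 4 by norm_num, sqrt_two_pow_two_mul] at hL0
  have hL0' : -L 0 = cV vhat n₀ / 32 := by rw [hL0]; ring
  obtain ⟨c, hc0, hs⟩ := expansion_even_resonant hΛ hμ he hA hL (by linarith) hB
  refine ⟨c, ?_, ?_⟩
  · rw [hc0, hL0']
    congr 1
    have := (hμ ▸ inv_pos.2 hΛ : 0 < muO vhat)
    field_simp
  · simpa using eventually_sub_of_eventually (μ₀ := muO vhat) hs

theorem expansion_even_gt (hN : 10 ≤ 2 * n₀ + d) (heven : Even d) (hΛ : 0 < Λ)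
    (hμ : muO vhat = Λ⁻¹)
    (h : HasSingularExpansion (resolventForm vhat) (2 * n₀ + d) (cV vhat n₀ / √2 ^ (2 * n₀ + d)) Λ)
    (hpos : 0 < cHat vhat)
    (hhat : ∀ c, Tendsto (fun t => (Λ - resolventForm vhat t) / t) (𝓝[>] 0) (𝓝 c) →
      cHat vhat = ENNReal.ofReal c)
    (he : ∀ μ t : ℝ, muO vhat < μ → 0 < t → μ * resolventForm vhat t = 1 → -e μ = t) :
    ∃ c : ℕ × ℕ → ℝ, c (0, 0) = (muO vhat ^ 2 * (cHat vhat).toReal) ^ (-1 / 2 : ℝ) ∧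
      ∀ᶠ μ in 𝓝[>] (muO vhat), HasSum (fun k : ℕ × ℕ =>
        c k * tau (μ - muO vhat) ^ (k.1 + 1) * theta (μ - muO vhat) ^ k.2)
          ((-e μ) ^ (1 / 2 : ℝ)) := by
  obtain ⟨A, L, hA, hL, hB⟩ := h.even_gt hN ((even_two_mul n₀).add heven)
  have hA0 := hhat _ (tendsto_quotient_nhds_of_sub_eq_pow_mul two_ne_zero
    (tendsto_add_mul_pow_mul_log hA hL one_le_two) hB)
  rw [hA0] at hpos
  have hpos' := ENNReal.ofReal_pos.1 hpos
  have hμ0 : 0 < muO vhat := hμ ▸ inv_pos.2 hΛ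
  obtain ⟨c, hc0, hs⟩ := expansion_even_above hΛ hμ he two_ne_zero one_le_two hA hL hpos' hB
  refine ⟨c, ?_, ?_⟩
  · rw [hc0, hA0, ENNReal.toReal_ofReal hpos'.le, neg_div, Real.rpow_neg (by positivity), one_div,
      Real.inv_rpow (by positivity)]
    norm_num
  · have h1 : ∀ᶠ s in 𝓝[>] (0 : ℝ), HasSum (fun k : ℕ × ℕ => c k * tau s ^ (k.1 + 1) *
        theta s ^ k.2) ((-e (s + muO vhat)) ^ (1 / 2 : ℝ)) := by
      -- With m = k = 2 the series variable is y = τ, so -y² log y is exactly θ.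
      filter_upwards [tendsto_tau.eventually hs, self_mem_nhdsWithin] with s hs hs0
      rw [tau_sq (le_of_lt hs0)] at hs
      simpa only [theta, tau_sq (le_of_lt hs0)] using hs
    simpa using eventually_sub_of_eventually (μ₀ := muO vhat) h1

end expansions

end LatticeBilaplacian

end

/-! ### The theorem -/

theorem theorem2 (d : ℕ) (hd : 1 ≤ d) (vhat : (Fin d → ℤ) → ℝ)
    (hv0 : vhat ≠ 0) (hv : ExpDecay vhat) (n₀ : ℕ)
    (hvanish : ∀ j < n₀, iteratedFDeriv ℝ (2 * j) (vSq vhat) 0 = 0)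
    (hnonvanish : iteratedFDeriv ℝ (2 * n₀) (vSq vhat) 0 ≠ 0) :
    -- positivity of the constants
    0 < cV vhat n₀ ∧ 0 < cHat vhat ∧
    -- the zero-energy solution
    (5 ≤ 2 * n₀ + d →
      ¬ (zeroState vhat =ᵐ[torusMeasure d] 0) ∧
      Integrable (fun q => (starRingEnd ℂ) (v vhat q) * zeroState vhat q) (torusMeasure d) ∧
      hAct vhat (muO vhat) (zeroState vhat) =ᵐ[torusMeasure d] 0 ∧
      AEStronglyMeasurable (zeroState vhat) (torusMeasure d)) ∧
    (2 * n₀ + d ∈ ({5, 6, 7, 8} : Set ℕ) → ¬ MemLp (zeroState vhat) 2 (torusMeasure d)) ∧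
    (9 ≤ 2 * n₀ + d → MemLp (zeroState vhat) 2 (torusMeasure d)) ∧
    -- the negative eigenvalue is well defined above the threshold
    (∀ μ > muO vhat, ∃! z : ℝ, z < 0 ∧ IsEigenvalue vhat μ (z : ℂ)) ∧
    -- the threshold vanishes or not
    (2 * n₀ + d ≤ 4 → muO vhat = 0) ∧
    (5 ≤ 2 * n₀ + d → 0 < muO vhat) ∧
    -- expansions of the negative eigenvalue
    ∀ e : ℝ → ℝ, (∀ μ > muO vhat, e μ < 0 ∧ IsEigenvalue vhat μ (e μ : ℂ)) →
      (2 * n₀ + d = 1 → ∃ c : ℕ → ℝ, c 0 = (π * cV vhat n₀ / 4) ^ (1 / 3 : ℝ) ∧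
        ∀ᶠ μ in 𝓝[>] (0 : ℝ),
          HasSum (fun n : ℕ => c n * μ ^ (((n : ℝ) + 1) / 3)) ((-e μ) ^ (1 / 4 : ℝ))) ∧
      (2 * n₀ + d = 3 → ∃ c : ℕ → ℝ, c 0 = π * cV vhat n₀ / 8 ∧
        ∀ᶠ μ in 𝓝[>] (0 : ℝ),
          HasSum (fun n : ℕ => c n * μ ^ (n + 1)) ((-e μ) ^ (1 / 4 : ℝ))) ∧
      (2 * n₀ + d = 5 → ∃ c : ℕ → ℝ, c 0 = 16 / (π * cV vhat n₀ * muO vhat ^ 2) ∧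
        ∀ᶠ μ in 𝓝[>] (muO vhat),
          HasSum (fun n : ℕ => c n * (μ - muO vhat) ^ (n + 1)) ((-e μ) ^ (1 / 4 : ℝ))) ∧
      (2 * n₀ + d = 7 → ∃ c : ℕ → ℝ,
        c 0 = (32 / (π * cV vhat n₀ * muO vhat ^ 2)) ^ (1 / 3 : ℝ) ∧
        ∀ᶠ μ in 𝓝[>] (muO vhat),
          HasSum (fun n : ℕ => c n * (μ - muO vhat) ^ (((n : ℝ) + 1) / 3))
            ((-e μ) ^ (1 / 4 : ℝ))) ∧
      (Odd d → 9 ≤ 2 * n₀ + d → ∃ c : ℕ → ℝ,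
        c 0 = (muO vhat ^ 2 * (cHat vhat).toReal) ^ (-1 / 4 : ℝ) ∧
        ∀ᶠ μ in 𝓝[>] (muO vhat),
          HasSum (fun n : ℕ => c n * (μ - muO vhat) ^ (((n : ℝ) + 1) / 4))
            ((-e μ) ^ (1 / 4 : ℝ))) ∧
      (2 * n₀ + d = 2 → ∃ c : ℕ × ℕ → ℝ, c (0, 0) = π * cV vhat n₀ / 8 ∧
        ∀ᶠ μ in 𝓝[>] (0 : ℝ),
          HasSum (fun k : ℕ × ℕ => c k * μ ^ (k.1 + 1) * (-(μ * Real.log μ)) ^ k.2)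
            ((-e μ) ^ (1 / 2 : ℝ))) ∧
      (2 * n₀ + d = 4 → ∃ c : ℕ × ℕ → ℝ, 0 < c (0, 0) ∧
        ∀ᶠ μ in 𝓝[>] (0 : ℝ),
          HasSum (fun k : ℕ × ℕ => c k * μ ^ (k.1 + 1) *
              (1 / μ * Real.exp (-1 / (cV vhat n₀ / 8 * μ))) ^ (k.2 + 1))
            ((-e μ) ^ (1 / 2 : ℝ))) ∧
      (2 * n₀ + d = 6 → ∃ c : ℕ × ℕ → ℝ,
        c (0, 0) = 32 / (π * cV vhat n₀ * muO vhat ^ 2) ∧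
        ∀ᶠ μ in 𝓝[>] (muO vhat),
          HasSum (fun k : ℕ × ℕ =>
              c k * tau (μ - muO vhat) ^ (2 * k.1 + 2) * theta (μ - muO vhat) ^ k.2)
            ((-e μ) ^ (1 / 2 : ℝ))) ∧
      (2 * n₀ + d = 8 → ∃ c : ℕ × ℕ × ℕ → ℝ,
        c (0, 0, 0) = (32 / (cV vhat n₀ * muO vhat ^ 2)) ^ (1 / 2 : ℝ) ∧
        ∀ᶠ μ in 𝓝[>] (muO vhat),
          HasSum (fun k : ℕ × ℕ × ℕ =>
              c k * tau (μ - muO vhat) ^ (k.1 + 1) * sigma (μ - muO vhat) ^ (k.2.1 + 1) *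
                eta (μ - muO vhat) ^ k.2.2)
            ((-e μ) ^ (1 / 2 : ℝ))) ∧
      (Even d → 10 ≤ 2 * n₀ + d → ∃ c : ℕ × ℕ → ℝ,
        c (0, 0) = (muO vhat ^ 2 * (cHat vhat).toReal) ^ (-1 / 2 : ℝ) ∧
        ∀ᶠ μ in 𝓝[>] (muO vhat),
          HasSum (fun k : ℕ × ℕ =>
              c k * tau (μ - muO vhat) ^ (k.1 + 1) * theta (μ - muO vhat) ^ k.2)
            ((-e μ) ^ (1 / 2 : ℝ))) := by
  have hne := not_ae_eq_zero_vSq hv hnonvanish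
  have hcV := cV_pos hd hv hvanish hnonvanish
  have hHat := cHat_pos hd hv hne
  obtain ⟨Λ, hB⟩ := exists_hasSingularExpansion_resolventForm hd hv hvanish
  have ha : 0 < cV vhat n₀ / √2 ^ (2 * n₀ + d) := by positivity
  have hzero : 2 * n₀ + d ≤ 4 → muO vhat = 0 := fun hN =>
    muO_eq_zero_of_tendsto hd hv (hB.tendsto_atTop (by omega) hN ha)
  have hlim : 5 ≤ 2 * n₀ + d → Tendsto (resolventForm vhat) (𝓝[>] 0) (𝓝 Λ) := fun hN => by
    rcases le_or_gt (2 * n₀ + d) 8 with h8 | h8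
    · exact (hB.tendsto_mid hN h8 ha).1
    · exact (hB.tendsto_gt h8).1
  have hthr := fun hN => threshold_of_tendsto hd hv hne (hlim hN)
  refine ⟨hcV, hHat, fun hN => ?_, fun hN => ?_, fun hN => ?_,
    fun μ hμ => existsUnique_negative_eigenvalue hd hv hne hμ, hzero, fun hN => ?_, ?_⟩
  · obtain ⟨hΛ, hμ, hi, hintg⟩ := hthr hN
    refine ⟨not_ae_eq_zero_zeroState hd hne, ?_, hAct_zeroState hd hΛ hμ hintg,
      aestronglyMeasurable_zeroState hv⟩
    simp only [conj_v_mul_zeroState]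
    exact hi.ofReal
  · have hN' : 5 ≤ 2 * n₀ + d ∧ 2 * n₀ + d ≤ 8 := by
      simp only [mem_insert_iff, mem_singleton_iff] at hN
      omega
    obtain ⟨-, -, hi, hintg⟩ := hthr hN'.1
    rw [memLp_zeroState_iff hv, cHat_eq_top_of_tendsto hd hv hi hintg
      (hB.tendsto_mid hN'.1 hN'.2 ha).2]
    exact lt_irrefl _
  · obtain ⟨-, -, hi, hintg⟩ := hthr (by omega)
    obtain ⟨-, c, hc⟩ := hB.tendsto_gt hN
    rw [memLp_zeroState_iff hv, cHat_eq_of_tendsto hd hv hi hintg hc]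
    exact ENNReal.ofReal_lt_top
  · obtain ⟨hΛ, hμ, -⟩ := hthr hN
    exact hμ ▸ inv_pos.2 hΛ
  · intro e he
    have hsol : ∀ μ t : ℝ, muO vhat < μ → 0 < t → μ * resolventForm vhat t = 1 → -e μ = t :=
      fun μ t hμ ht h => neg_eigenvalue_eq hd hv hne he hμ ht h
    -- For N ≤ 4 the threshold is 0, so positivity of μ is the only constraint.
    have hsol0 : 2 * n₀ + d ≤ 4 → ∀ μ t : ℝ, 0 < μ → 0 < t → μ * resolventForm vhat t = 1 →
        -e μ = t := fun hN μ t hμ ht h => hsol μ t ((hzero hN).trans_lt hμ) ht h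
    have hhat : 5 ≤ 2 * n₀ + d → ∀ c, Tendsto (fun t => (Λ - resolventForm vhat t) / t) (𝓝[>] 0)
        (𝓝 c) → cHat vhat = ENNReal.ofReal c := fun hN c hc =>
      cHat_eq_of_tendsto hd hv (hthr hN).2.2.1 (hthr hN).2.2.2 hc
    exact ⟨fun hN => expansion_one hN hcV hB (hsol0 (by omega)),
      fun hN => expansion_three hN hcV hB (hsol0 (by omega)),
      fun hN => expansion_five hN hcV (hthr (by omega)).1 (hthr (by omega)).2.1 hB hsol,
      fun hN => expansion_seven hN hcV (hthr (by omega)).1 (hthr (by omega)).2.1 hB hsol,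
      fun hodd hN => expansion_odd_gt hN hodd (hthr (by omega)).1 (hthr (by omega)).2.1 hB hHat
        (hhat (by omega)) hsol,
      fun hN => expansion_two hN hcV hB (hsol0 (by omega)),
      fun hN => expansion_four hN hcV hB (hsol0 (by omega)),
      fun hN => expansion_six hN hcV (hthr (by omega)).1 (hthr (by omega)).2.1 hB hsol,
      fun hN => expansion_eight hN hcV (hthr (by omega)).1 (hthr (by omega)).2.1 hB hsol,
      fun heven hN => expansion_even_gt hN heven (hthr (by omega)).1 (hthr (by omega)).2.1 hB hHat
        (hhat (by omega)) hsol⟩
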